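/- **Setting.** Let $\mathcal G^1$ be a finite connected graph with a subgraph $X$ (the *relative part*) containing all vertices; $\widehat\Gamma$ denotes the set of edges not in $X$ (the *train track part*). Some vertices are *auxiliary*: every edge at an auxiliary vertex (an *auxiliary half-edge*) lies in $X$ and has a non-auxiliary other end. An *auxiliary edge* $e=h\circ h'$ is a path of two different half-edges $h,h'$ through an auxiliary vertex; each one has an associated edge path $\eta_e$ in $\mathcal G^1$ with the same endpoints, with $\eta_{\bar e}=\overline{\eta_e}$, and $\mathcal G^2$ is obtained from $\mathcal G^1$ by attaching for each $e$ a 2-cell along $\bar e\circ\eta_e$. Let $\Gamma$ be the graph of all non-auxiliary vertices and edges, let $\widehat r$ replace each $e$ on a path by $\eta_e$, and assume that some power $r$ of $\widehat r$ maps all auxiliary edges to reduced paths in $\Gamma$ and defines a retraction $r:\mathcal G^2\to\Gamma$. Let $f:\mathcal G^2\to\mathcal G^2$ be a continuous map which maps vertices of $\mathcal G^1$ to vertices, vertices of $\Gamma$ to vertices of $\Gamma$, edges to edge paths, and $X$ to $X$. Subpaths in $X$ are considered up to homotopy rel endpoints in $X$. A path in $\mathcal G^1$ is *relatively reduced* if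 each subpath that is homotopic rel endpoints in $\mathcal G^2$ to a path in $X$ lies in $X$; a path $\gamma$ is *legal* if $f^t(\gamma)$ is relatively reduced for all $t\ge1$. A *turn* is a path $e\circ\chi\circ e'$ with $e,e'$ in $\widehat\Gamma$ and $\chi$ in $X$. A reduced path $\gamma$ is *strongly legal* if it is legal and if every turn of $\widehat r(\gamma)$ that is not legal is a turn of one of the inserted paths $\eta_e$. A turn $e\circ\chi\circ e'$ is *illegal* if it is not legal or if $e\circ\chi$ or $\chi\circ e'$ is not strongly legal. An *INP* is a reduced edge path $\eta=\eta'\circ\eta''$ whose first and last edges are in $\widehat\Gamma$, with $\eta',\eta''$ legal, $f^t(\eta)$ not legal for all $t\ge0$, and $f^{t_0}(\eta)$ homotopic rel endpoints in $\mathcal G^1$ to $\eta$ for some $t_0\ge1$. The map $f$ is a *$\beta$-train track map* representing $\alpha\in\mathrm{Aut}(F_n)$ if: 1. the INPs are precisely the paths $\eta_e$; 2. some isomorphism $\pi_1\mathcal G^2\cong F_n$ conjugates $f_*$ to the outer automorphism defined by $\alpha$, and every conjugacy class given by a loop in $X$ has polynomial $\alpha$-growth; 3. each component of $X$ is $\pi_1$-injective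 in $\mathcal G^2$; 4. $r\circ f|_\Gamma$ is a relative train track map in the sense of Bestvina–Handel; 5. every edge of $\widehat\Gamma$ is strongly legal and has an image under some $f^t$, $t\ge 1$, that runs over at least two edges of $\widehat\Gamma$; 6. $f$ maps strongly legal edge paths between vertices of $\Gamma$ to strongly legal paths; 7. for each edge path $\gamma$ between vertices of $\Gamma$ some $f^{t}(\gamma)$ is homotopic rel endpoints in $\mathcal G^2$ to a strongly legal path, where $t$ depends only on the number of illegal turns of $\gamma$; and each loop based at a vertex of $\Gamma$ has an image under some $f^t$ that is freely homotopic in $\mathcal G^2$ to a loop all of whose powers are legal. A *pre-INP* is a path $r(e)$ with $e$ an auxiliary edge. A pre-INP $r(e)$ in a reduced path of $\Gamma$ is *isolated* if it contains every other pre-INP of that path which meets it in more than a point. A path $\gamma$ in $\mathcal G^1$ with endpoints in $\Gamma$ (an edge path, except that its first and last edge may be partially traversed if they lie in $\widehat\Gamma$) is *normalized* if $r(\gamma)$ is reduced and $\gamma$ is obtained from $r(\gamma)$ by replacing every isolated pre-INP $r(e)$ by $e$. The *relative length* $|\cdot|_{rel}$ of paths, in $\mathcal G^1$ and in the 1-skeleton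 of the universal covering $\widetilde{\mathcal G}^2$, gives length $1$ to the edges of $\widehat\Gamma$ and length $0$ to the edges of $X$ (respectively to their lifts); $d_{rel}$ is the resulting path pseudo-metric. **Proposition.** Let $f:\mathcal G^2\to\mathcal G^2$ be a $\beta$-train track map representing an automorphism of a free group $F_n$. There exist constants $\lambda,\mu>0$ such that every lift $\gamma$ to $\widetilde{\mathcal G}^2$ of every normalized path in $\mathcal G^1$ is a relative $(\lambda,\mu)$-quasi-geodesic: for every subpath $\gamma'$ of $\gamma$, with endpoints $x',y'$, one has $$|\gamma'|_{rel}\le\lambda\, d_{rel}(x',y')+\mu .$$ -/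

import Mathlib

/-- A graph in the sense of Serre: oriented edges with a fixed-point free reversal `inv`. -/
structure SerreGraph where
  V : Type
  E : Type
  src : E → V
  inv : E → E
  inv_inv : ∀ e, inv (inv e) = e
  inv_ne : ∀ e, inv e ≠ e

namespace SerreGraph

/-- Terminal vertex of an oriented edge. -/
def tgt (G : SerreGraph) (e : G.E) : G.V := G.src (G.inv e)

/-- `G.IsPath u l v`: the list `l` is an edge path from `u` to `v` (backtracking allowed). -/
def IsPath (G : SerreGraph) : G.V → List G.E → G.V → Prop
  | u, [], v => u = v
  | u, e :: l, v => G.src e = u ∧ IsPath G (G.tgt e) l v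

/-- The edge path with inverted orientation. -/
def rev (G : SerreGraph) (l : List G.E) : List G.E := (l.map G.inv).reverse

/-- No edge is followed by its inverse. -/
def Reduced (G : SerreGraph) (l : List G.E) : Prop :=
  l.IsChain (fun e e' => e' ≠ G.inv e)

/-- An edge path together with its endpoints. -/
structure EPath (G : SerreGraph) where
  first : G.V
  last : G.V
  edges : List G.E
  isPath : G.IsPath first edges last

/-- An elementary move rel endpoints: one subpath is replaced according to the rule `R`. -/
def Move (G : SerreGraph) (R : List G.E → List G.E → Prop) (p q : G.EPath) : Prop :=
  p.first = q.first ∧ p.last = q.last ∧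
    ∃ A s t B, R s t ∧ p.edges = A ++ s ++ B ∧ q.edges = A ++ t ++ B

/-- Homotopy rel endpoints of edge paths, generated by the moves with rule `R`. -/
def Homotopic (G : SerreGraph) (R : List G.E → List G.E → Prop) (l l' : List G.E) : Prop :=
  ∃ p q : G.EPath, p.edges = l ∧ q.edges = l' ∧ Relation.EqvGen (G.Move R) p q

/-- The rule `e e⁻¹ → trivial`; it generates homotopy rel endpoints in the graph itself. -/
def Cancel (G : SerreGraph) (s t : List G.E) : Prop :=
  ∃ e, s = [e, G.inv e] ∧ t = []

theorem isPath_append (G : SerreGraph) {u v w : G.V} {l l' : List G.E}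
    (h : G.IsPath u l v) (h' : G.IsPath v l' w) : G.IsPath u (l ++ l') w := by
  induction l generalizing u with
  | nil => cases h; exact h'
  | cons e l ih => exact ⟨h.1, ih h.2⟩

theorem tgt_inv (G : SerreGraph) (e : G.E) : G.tgt (G.inv e) = G.src e := by
  simp [tgt, G.inv_inv]

/-! ### Points of the geometric realization, paths with partially traversed end edges, lengths -/

/-- A vertex, or the point with parameter `s` on an oriented edge. -/
inductive RawPt (G : SerreGraph) where
  | vert (v : G.V)
  | onEdge (e : G.E) (s : unitInterval)

/-- The identifications made in the geometric realization of a graph. -/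
inductive Glue (G : SerreGraph) : G.RawPt → G.RawPt → Prop
  | zero (e : G.E) : Glue G (.onEdge e 0) (.vert (G.src e))
  | flip (e : G.E) (s : unitInterval) :
      Glue G (.onEdge e s) (.onEdge (G.inv e) (unitInterval.symm s))

/-- The points of the geometric realization of a graph. -/
def Pt (G : SerreGraph) : Type := Quot G.Glue

/-- A path which is an edge path except that an initial piece of length `a` of the first edge and
a terminal piece of length `b` of the last edge may be missing. -/
structure Arc (G : SerreGraph) extends EPath G where
  a : unitInterval
  b : unitInterval
  of_nil : edges = [] → a = 0 ∧ b = 0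
  of_single : edges.length = 1 → (a : ℝ) + b ≤ 1

namespace Arc

/-- Initial point of a path. -/
def source {G : SerreGraph} (A : G.Arc) : G.Pt :=
  match A.edges.head? with
  | none => Quot.mk _ (.vert A.first)
  | some e => Quot.mk _ (.onEdge e A.a)

/-- Terminal point of a path. -/
def target {G : SerreGraph} (A : G.Arc) : G.Pt :=
  match A.edges.getLast? with
  | none => Quot.mk _ (.vert A.last)
  | some e => Quot.mk _ (.onEdge e (unitInterval.symm A.b))

/-- Length of a path with respect to edge lengths `L`. -/
noncomputable def length {G : SerreGraph} (L : G.E → ℝ) (A : G.Arc) : ℝ :=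
  (A.edges.map L).sum - A.a * (A.edges.head?.elim 0 L) - A.b * (A.edges.getLast?.elim 0 L)

/-- `A'` is a subpath of `A` (its endpoints may be interior points of edges). -/
def IsSubArc {G : SerreGraph} (A' A : G.Arc) : Prop :=
  ∃ l₁ l₂, A.edges = l₁ ++ A'.edges ++ l₂ ∧ (l₁ = [] → A.a ≤ A'.a) ∧ (l₂ = [] → A.b ≤ A'.b)

end Arc

/-- The path (pseudo-)metric on the realization of a graph defined by edge lengths `L`. -/
noncomputable def pathDist (G : SerreGraph) (L : G.E → ℝ) (P Q : G.Pt) : ℝ :=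
  sInf {x | ∃ A : G.Arc, A.source = P ∧ A.target = Q ∧ A.length L = x}

/-- A `(lam, mu)`-quasi-geodesic with respect to the path metric defined by `L`. -/
def IsQuasiGeodesic (G : SerreGraph) (L : G.E → ℝ) (lam mu : ℝ) (A : G.Arc) : Prop :=
  ∀ A' : G.Arc, A'.IsSubArc A →
    A'.length L ≤ lam * G.pathDist L A'.source A'.target + mu

/-! ### Relative train track maps in the sense of Bestvina and Handel -/

/-- The derivative of a graph map: the first edge of the image of an edge. -/
def deriv (G : SerreGraph) (g : G.E → List G.E) (e : G.E) : G.E := (g e).head?.getD e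

/-- The (possibly degenerate) turn passed by the edge path `e e'` is legal: the two directions
are never identified by an iterate of the derivative. -/
def DirectionsLegal (G : SerreGraph) (g : G.E → List G.E) (e e' : G.E) : Prop :=
  ∀ t : ℕ, (G.deriv g)^[t] (G.inv e) ≠ (G.deriv g)^[t] e'

/-- The stratum `k` of the filtration given by `ht` on the subgraph `S` is mapped to
lower strata (zero transition matrix). -/
def ZeroStratum (G : SerreGraph) (S : Set G.E) (g : G.E → List G.E) (ht : G.E → ℕ)
    (k : ℕ) : Prop :=
  ∀ e ∈ S, ht e = k → ∀ e' ∈ g e, ht e' < k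

/-- The transition matrix of the stratum `k` is irreducible. -/
def IrreducibleStratum (G : SerreGraph) (S : Set G.E) (g : G.E → List G.E) (ht : G.E → ℕ)
    (k : ℕ) : Prop :=
  ∀ e ∈ S, ht e = k → ∀ e' ∈ S, ht e' = k →
    ∃ t : ℕ, 1 ≤ t ∧ (e' ∈ (List.flatMap g)^[t] [e] ∨ G.inv e' ∈ (List.flatMap g)^[t] [e])

open Classical in
/-- The transition matrix of the stratum `k` is irreducible, and it is not a permutation matrix,
i.e. its Perron-Frobenius eigenvalue is greater than 1. -/
def ExponentialStratum (G : SerreGraph) (S : Set G.E) (g : G.E → List G.E) (ht : G.E → ℕ)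
    (k : ℕ) : Prop :=
  G.IrreducibleStratum S g ht k ∧
    ∃ e ∈ S, ht e = k ∧ 2 ≤ (g e).countP (fun e' => decide (ht e' = k))

/-- The graph map given by `g` on the subgraph with edge set `S` is a relative train track map:
edges are mapped to non-trivial reduced paths, and there is an invariant filtration (edges of
height `≤ k`) each of whose strata is zero or irreducible, such that in each exponentially growing
stratum (i) directions are mapped to directions of the stratum, (ii) non-trivial connecting paths
in lower strata have non-trivial image, (iii) legal paths of the stratum have images without
illegal turns in the stratum. -/
def IsRelativeTrainTrack (G : SerreGraph) (S : Set G.E) (g : G.E → List G.E) : Prop :=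
  (∀ e ∈ S, g e ≠ [] ∧ G.Reduced (g e) ∧ ∀ e' ∈ g e, e' ∈ S) ∧
  ∃ ht : G.E → ℕ, (∀ e, ht (G.inv e) = ht e) ∧ (∀ e ∈ S, ∀ e' ∈ g e, ht e' ≤ ht e) ∧
    ∀ k : ℕ, (G.ZeroStratum S g ht k ∨ G.IrreducibleStratum S g ht k) ∧
      (G.ExponentialStratum S g ht k →
        (∀ e ∈ S, ht e = k → ht (G.deriv g e) = k) ∧
        (∀ u v l, G.IsPath u l v → l ≠ [] → G.Reduced l → (∀ e ∈ l, e ∈ S ∧ ht e < k) →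
          (∃ e ∈ S, ht e = k ∧ G.src e = u) → (∃ e ∈ S, ht e = k ∧ G.src e = v) →
          ¬ G.Homotopic G.Cancel (l.flatMap g) []) ∧
        (∀ u v l, G.IsPath u l v → (∀ e ∈ l, e ∈ S ∧ ht e = k) →
          l.IsChain (G.DirectionsLegal g) →
          (l.flatMap g).IsChain
            (fun e e' => ht e = k → ht e' = k → G.DirectionsLegal g e e')))

end SerreGraph

/-- The raw data of a self-map `f` of a graph-of-spaces with Nielsen faces `𝒢²`.

`G` is the 1-skeleton `𝒢¹`. The relative part `X` consists of all vertices and of the edges with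
`IsRel`; the other edges form the train track part `Γ̂`. The edges incident to an auxiliary vertex
are the auxiliary half-edges; two different half-edges which meet at an auxiliary vertex form an
auxiliary edge `h h'`, whose associated path is `eta h h'`. The 2-cells (Nielsen faces) are, one
for each auxiliary edge `h h'`, attached along `(h h')⁻¹ ∘ eta h h'`.
The map `f` is given by a map `fV` of vertices and by the edge paths `fE e`. -/
structure TrackData where
  G : SerreGraph
  base : G.V
  IsRel : G.E → Prop
  IsAuxV : G.V → Prop
  eta : G.E → G.E → List G.E
  /-- the number of times the retraction `rhat` is iterated to get `retr` -/
  depth : ℕ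
  fV : G.V → G.V
  fE : G.E → List G.E

namespace TrackData

/-- Auxiliary half-edges (with either orientation). -/
def IsAux (D : TrackData) (e : D.G.E) : Prop := D.IsAuxV (D.G.src e) ∨ D.IsAuxV (D.G.tgt e)

/-- The edge path `h h'` is an auxiliary edge. -/
def IsAuxEdge (D : TrackData) (h h' : D.G.E) : Prop :=
  D.IsAuxV (D.G.tgt h) ∧ D.G.src h' = D.G.tgt h ∧ h' ≠ D.G.inv h

/-- The path lies in the relative part `X`. -/
def InX (D : TrackData) (l : List D.G.E) : Prop := ∀ e ∈ l, D.IsRel e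

/-- The rule generating homotopy rel endpoints within the graph `X`. -/
def CancelX (D : TrackData) (s t : List D.G.E) : Prop :=
  ∃ e, D.IsRel e ∧ s = [e, D.G.inv e] ∧ t = []

/-- The rule generating homotopy rel endpoints in the 2-complex `𝒢²`. -/
def Rule (D : TrackData) (s t : List D.G.E) : Prop :=
  D.G.Cancel s t ∨ ∃ h h', D.IsAuxEdge h h' ∧ s = [h, h'] ∧ t = D.eta h h'

/-- Homotopy rel endpoints in the graph `𝒢¹`. -/
def Htpy1 (D : TrackData) : List D.G.E → List D.G.E → Prop := D.G.Homotopic D.G.Cancel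

/-- Homotopy rel endpoints in the 2-complex `𝒢²`. -/
def Htpy2 (D : TrackData) : List D.G.E → List D.G.E → Prop := D.G.Homotopic D.Rule

/-- Homotopy rel endpoints which only changes subpaths in `X`, within `X`. -/
def HtpyX (D : TrackData) : List D.G.E → List D.G.E → Prop := D.G.Homotopic D.CancelX

open Classical in
/-- The map `r̂` on edge paths: each passage `h h'` through an auxiliary vertex is replaced by the
associated path `eta h h'` (by the trivial path if `h' = h⁻¹`). -/
noncomputable def rhat (D : TrackData) : List D.G.E → List D.G.E
  | [] => []
  | [e] => [e]
  | e :: e' :: l =>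
    if D.IsAuxV (D.G.tgt e) then
      (if e' = D.G.inv e then [] else D.eta e e') ++ rhat D l
    else e :: rhat D (e' :: l)

/-- The retraction `r` to `Γ` on edge paths, a power of `r̂`. -/
noncomputable def retr (D : TrackData) (l : List D.G.E) : List D.G.E := D.rhat^[D.depth] l

/-- The image path `f(l)`. -/
def map (D : TrackData) (l : List D.G.E) : List D.G.E := l.flatMap D.fE

/-- Every subpath which is homotopic in `𝒢²` to a path in `X` lies in `X`. -/
def RelReduced (D : TrackData) (l : List D.G.E) : Prop :=
  ∀ m x, m <:+: l → D.InX x → D.Htpy2 m x → D.InX m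

/-- All forward images of the path are relatively reduced. -/
def Legal (D : TrackData) (l : List D.G.E) : Prop :=
  ∀ t : ℕ, 1 ≤ t → D.RelReduced (D.map^[t] l)

/-- `l` is decomposed as `A ∘ (e ∘ c ∘ e') ∘ B` at the turn `e ∘ c ∘ e'`. -/
def TurnAt (D : TrackData) (l A : List D.G.E) (e : D.G.E) (c : List D.G.E) (e' : D.G.E)
    (B : List D.G.E) : Prop :=
  l = A ++ ([e] ++ c ++ [e']) ++ B ∧ ¬ D.IsRel e ∧ D.InX c ∧ ¬ D.IsRel e'

/-- A strongly legal path: it is reduced and legal, and in the path obtained by replacing every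
auxiliary edge by its associated INP each turn which is not legal is a turn (necessarily the tip)
of one of the INPs that were put in. -/
def StronglyLegal (D : TrackData) (l : List D.G.E) : Prop :=
  D.G.Reduced l ∧ D.Legal l ∧
  ∀ A e c e' B, D.TurnAt (D.rhat l) A e c e' B →
    D.Legal ([e] ++ c ++ [e']) ∨
    ∃ l₁ h h' l₂ A₀ B₀, D.IsAuxEdge h h' ∧ l = l₁ ++ [h, h'] ++ l₂ ∧
      D.TurnAt (D.eta h h') A₀ e c e' B₀ ∧ A = D.rhat l₁ ++ A₀ ∧ B = B₀ ++ D.rhat l₂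

/-- An illegal turn: not legal, or one of its half turns is not strongly legal. -/
def IllegalTurn (D : TrackData) (e : D.G.E) (c : List D.G.E) (e' : D.G.E) : Prop :=
  ¬ D.Legal ([e] ++ c ++ [e']) ∨ ¬ D.StronglyLegal ([e] ++ c) ∨ ¬ D.StronglyLegal (c ++ [e'])

/-- The number of illegal turns of a path. -/
noncomputable def ILT (D : TrackData) (l : List D.G.E) : ℕ :=
  Set.ncard {τ : List D.G.E × D.G.E × List D.G.E × D.G.E × List D.G.E |
    D.TurnAt l τ.1 τ.2.1 τ.2.2.1 τ.2.2.2.1 τ.2.2.2.2 ∧ D.IllegalTurn τ.2.1 τ.2.2.1 τ.2.2.2.1}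

/-- An INP: a reduced path which starts and ends with edges of the train track part, is the
concatenation of two legal branches, has no legal forward image (itself included), and is
homotopic in `𝒢¹` to one of its images under positive iterates of `f`. -/
def IsINP (D : TrackData) (l : List D.G.E) : Prop :=
  (∃ u v, D.G.IsPath u l v) ∧ D.G.Reduced l ∧
  (∃ e ∈ l.head?, ¬ D.IsRel e) ∧ (∃ e ∈ l.getLast?, ¬ D.IsRel e) ∧
  (∃ l₁ l₂, l = l₁ ++ l₂ ∧ D.Legal l₁ ∧ D.Legal l₂) ∧
  (∀ t : ℕ, ¬ D.Legal (D.map^[t] l)) ∧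
  ∃ t : ℕ, 1 ≤ t ∧ D.Htpy1 (D.map^[t] l) l

/-- A marking isomorphism `π₁(𝒢², base) → Fₙ`, as a function on loops. -/
def IsMarking (D : TrackData) {n : ℕ} (θ : List D.G.E → FreeGroup (Fin n)) : Prop :=
  (∀ l l', D.G.IsPath D.base l D.base → D.G.IsPath D.base l' D.base →
    θ (l ++ l') = θ l * θ l' ∧ (θ l = θ l' ↔ D.Htpy2 l l')) ∧
  ∀ w, ∃ l, D.G.IsPath D.base l D.base ∧ θ l = w

/-- The marking conjugates `f_*` to the outer automorphism given by `α` (the path `c` connects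
the base point to its image). -/
def Represents (D : TrackData) {n : ℕ} (θ : List D.G.E → FreeGroup (Fin n))
    (α : MulAut (FreeGroup (Fin n))) : Prop :=
  ∃ c, D.G.IsPath D.base c (D.fV D.base) ∧
    ∀ l, D.G.IsPath D.base l D.base → θ (c ++ D.map l ++ D.G.rev c) = α (θ l)

end TrackData

/-- Cyclic length: minimal word length in the conjugacy class. -/
noncomputable def cyclicLength {n : ℕ} (w : FreeGroup (Fin n)) : ℕ :=
  sInf (Set.range fun g : FreeGroup (Fin n) => (g * w * g⁻¹).norm)

/-- The element `w` is of polynomial `α`-growth. -/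
def PolynomialGrowth {n : ℕ} (α : MulAut (FreeGroup (Fin n))) (w : FreeGroup (Fin n)) : Prop :=
  ∃ (C : ℝ) (d : ℕ), ∀ t : ℕ, 1 ≤ t → (cyclicLength ((α ^ t) w) : ℝ) ≤ C * (t : ℝ) ^ d

/-- `D` is a graph-of-spaces with Nielsen faces, together with a self-map of it: these are the
combinatorial compatibility conditions which make the data into a 2-complex `𝒢²`, a continuous
map `f : 𝒢² → 𝒢²` with `f(X) ⊆ X`, and a retraction `r : 𝒢² → Γ` onto the graph `Γ` of all
non-auxiliary edges. -/
structure IsTrackMap (D : TrackData) : Prop where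
  finite_V : Finite D.G.V
  finite_E : Finite D.G.E
  connected : ∀ v, ∃ l, D.G.IsPath D.base l v
  rel_inv : ∀ e, D.IsRel e → D.IsRel (D.G.inv e)
  aux_rel : ∀ e, D.IsAux e → D.IsRel e
  /-- an auxiliary half-edge has exactly one auxiliary endpoint -/
  aux_ends : ∀ e, D.IsAuxV (D.G.src e) → ¬ D.IsAuxV (D.G.tgt e)
  eta_isPath : ∀ h h', D.IsAuxEdge h h' → D.G.IsPath (D.G.src h) (D.eta h h') (D.G.tgt h')
  eta_rev : ∀ h h', D.IsAuxEdge h h' → D.eta (D.G.inv h') (D.G.inv h) = D.G.rev (D.eta h h')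
  /-- `r` maps auxiliary edges to reduced paths of `Γ` (the pre-INPs) -/
  retr_aux : ∀ h h', D.IsAuxEdge h h' →
    D.G.Reduced (D.retr [h, h']) ∧ ∀ e ∈ D.retr [h, h'], ¬ D.IsAux e
  /-- `r` is defined on auxiliary stars with three or more half-edges -/
  retr_star : ∀ h₁ h₂ h₃, D.IsAuxEdge h₁ (D.G.inv h₂) → D.IsAuxEdge h₂ (D.G.inv h₃) →
    D.IsAuxEdge h₁ (D.G.inv h₃) →
    D.Htpy1 (D.retr [h₁, D.G.inv h₂] ++ D.retr [h₂, D.G.inv h₃]) (D.retr [h₁, D.G.inv h₃])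
  map_isPath : ∀ e, D.G.IsPath (D.fV (D.G.src e)) (D.fE e) (D.fV (D.G.tgt e))
  map_inv : ∀ e, D.fE (D.G.inv e) = D.G.rev (D.fE e)
  map_rel : ∀ e, D.IsRel e → D.InX (D.fE e)
  /-- vertices of `Γ` are mapped to vertices of `Γ` -/
  map_vertex : ∀ v, ¬ D.IsAuxV v → ¬ D.IsAuxV (D.fV v)
  /-- `f` extends over the Nielsen faces -/
  map_face : ∀ h h', D.IsAuxEdge h h' → D.Htpy2 (D.map [h, h']) (D.map (D.eta h h'))

open Classical in
/-- `D` is a β-train track map which represents the automorphism `α` of the free group `Fₙ`. -/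
structure IsBetaTrainTrack (D : TrackData) {n : ℕ} (α : MulAut (FreeGroup (Fin n))) : Prop
    extends IsTrackMap D where
  /-- the INPs are precisely the paths associated to the auxiliary edges -/
  eta_INP : ∀ h h', D.IsAuxEdge h h' → D.IsINP (D.eta h h')
  INP_eta : ∀ l, D.IsINP l → ∃ h h', D.IsAuxEdge h h' ∧ D.eta h h' = l
  /-- `f` represents `α`, and conjugacy classes given by loops in `X` grow polynomially -/
  marking : ∃ θ : List D.G.E → FreeGroup (Fin n), D.IsMarking θ ∧ D.Represents θ α ∧
    ∀ v c x, D.G.IsPath D.base c v → D.G.IsPath v x v → D.InX x →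
      PolynomialGrowth α (θ (c ++ x ++ D.G.rev c))
  /-- each component of `X` is `π₁`-injective -/
  rel_injective : ∀ v x, D.G.IsPath v x v → D.InX x → D.Htpy2 x [] → D.HtpyX x []
  /-- `r ∘ f` is a relative train track map of `Γ` -/
  relative : D.G.IsRelativeTrainTrack {e | ¬ D.IsAux e} (fun e => D.retr (D.fE e))
  /-- edges of the train track part are strongly legal -/
  edge_legal : ∀ e, ¬ D.IsRel e → D.StronglyLegal [e]
  /-- strongly legal paths are mapped to strongly legal paths (after reduction in `X`) -/
  map_legal : ∀ u v l, ¬ D.IsAuxV u → ¬ D.IsAuxV v → D.G.IsPath u l v → D.StronglyLegal l →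
    ∃ l', D.StronglyLegal l' ∧ D.HtpyX (D.map l) l'
  /-- edges of the train track part are expanding -/
  expanding : ∀ e, ¬ D.IsRel e →
    ∃ t : ℕ, 1 ≤ t ∧ 2 ≤ (D.map^[t] [e]).countP (fun e' => decide (¬ D.IsRel e'))
  /-- paths become strongly legal, after a number of iterations of `f` which depends only on the
  number of illegal turns -/
  eventually_legal : ∃ T : ℕ → ℕ, ∀ u v l, ¬ D.IsAuxV u → ¬ D.IsAuxV v → D.G.IsPath u l v →
    l.IsChain (fun e e' => D.IsRel e → e' ≠ D.G.inv e) →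
    ∃ l', D.StronglyLegal l' ∧ D.Htpy2 (D.map^[T (D.ILT l)] l) l'
  /-- loops become legal, up to free homotopy -/
  loop_eventually_legal : ∀ v l, ¬ D.IsAuxV v → D.G.IsPath v l v →
    ∃ (t : ℕ) (w : D.G.V) (c l' : List D.G.E), D.G.IsPath (D.fV^[t] v) c w ∧ D.G.IsPath w l' w ∧
      D.Htpy2 (D.map^[t] l) (c ++ l' ++ D.G.rev c) ∧
      ∀ k : ℕ, D.Legal (List.replicate k l').flatten

namespace TrackData

/-! ### Normalized paths -/

/-- In the path `ρ` of `Γ` (with pieces `a`, `b` of its first and last edge missing) the pre-INP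
of the auxiliary edge `h h'` occurs as subpath, starting with the edge number `i`. -/
def Occurs (D : TrackData) (ρ : List D.G.E) (a b : unitInterval) (i : ℕ) (h h' : D.G.E) : Prop :=
  D.IsAuxEdge h h' ∧ ∃ A B, ρ = A ++ D.retr [h, h'] ++ B ∧ A.length = i ∧
    (A = [] → a = 0) ∧ (B = [] → b = 0)

/-- This occurrence of a pre-INP is isolated: each occurrence of a pre-INP which meets it in more
than a point is contained in it. -/
def Isolated (D : TrackData) (ρ : List D.G.E) (a b : unitInterval) (i : ℕ) (h h' : D.G.E) :
    Prop :=
  D.Occurs ρ a b i h h' ∧ ∀ j k k', D.Occurs ρ a b j k k' →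
    max i j < min (i + (D.retr [h, h']).length) (j + (D.retr [k, k']).length) →
    i ≤ j ∧ j + (D.retr [k, k']).length ≤ i + (D.retr [h, h']).length

/-- `l` is obtained from `ρ` through replacing every isolated pre-INP by the associated auxiliary
edge: the list `ps` consists of the edges that are kept and of the auxiliary edges put in. -/
def IsReplacement (D : TrackData) (ρ : List D.G.E) (a b : unitInterval) (l : List D.G.E) : Prop :=
  ∃ ps : List (D.G.E ⊕ D.G.E × D.G.E),
    l = ps.flatMap (Sum.elim (fun e => [e]) (fun p => [p.1, p.2])) ∧
    ρ = ps.flatMap (Sum.elim (fun e => [e]) (fun p => D.retr [p.1, p.2])) ∧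
    ∀ i h h', D.Isolated ρ a b i h h' ↔
      ∃ ps₁ ps₂, ps = ps₁ ++ [Sum.inr (h, h')] ++ ps₂ ∧
        (ps₁.flatMap (Sum.elim (fun e => [e]) (fun p => D.retr [p.1, p.2]))).length = i

/-- A path of `𝒢¹` between points of `Γ`: an edge path, except that the first and the last edge
may be partially traversed if they belong to the train track part. -/
def IsAdmissible (D : TrackData) (γ : D.G.Arc) : Prop :=
  ¬ D.IsAuxV γ.first ∧ ¬ D.IsAuxV γ.last ∧ γ.a < 1 ∧ γ.b < 1 ∧
  (γ.edges.length = 1 → (γ.a : ℝ) + γ.b < 1) ∧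
  (0 < γ.a → ∀ e ∈ γ.edges.head?, ¬ D.IsRel e) ∧
  (0 < γ.b → ∀ e ∈ γ.edges.getLast?, ¬ D.IsRel e)

/-- Normalized paths: `r(γ)` is reduced, and `γ` is obtained from `r(γ)` through replacing every
isolated pre-INP by the associated auxiliary edge. -/
def IsNormalized (D : TrackData) (γ : D.G.Arc) : Prop :=
  D.IsAdmissible γ ∧ D.G.Reduced (D.retr γ.edges) ∧
    D.IsReplacement (D.retr γ.edges) γ.a γ.b γ.edges

/-! ### The 1-skeleton of the universal covering of `𝒢²` -/

/-- Vertices of the universal covering: homotopy classes in `𝒢²` rel endpoints of edge paths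
which start at the base point. -/
def CoverV (D : TrackData) : Type :=
  Quot (fun p q : {p : D.G.EPath // p.first = D.base} => D.G.Move D.Rule p.1 q.1)

/-- The covering map on vertices. -/
def coverProj (D : TrackData) : D.CoverV → D.G.V :=
  Quot.lift (fun p => p.1.last) (fun _ _ h => h.2.1)

open Classical in
/-- Extend a path by an edge (if this edge starts at the end of the path). -/
noncomputable def snoc (D : TrackData) (e : D.G.E) (p : {p : D.G.EPath // p.first = D.base}) :
    {p : D.G.EPath // p.first = D.base} :=
  if h : p.1.last = D.G.src e then
    ⟨⟨p.1.first, D.G.tgt e, p.1.edges ++ [e], D.G.isPath_append p.1.isPath ⟨h.symm, rfl⟩⟩, p.2⟩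
  else p

/-- The end of the lift of the edge `e` which starts at a given vertex above `src e`. -/
noncomputable def coverStep (D : TrackData) (e : D.G.E) : D.CoverV → D.CoverV :=
  Quot.map (D.snoc e) (by
    rintro p q ⟨h1, h2, A, s, t, B, hR, hp, hq⟩
    by_cases h : p.1.last = D.G.src e
    · have h' : q.1.last = D.G.src e := h2 ▸ h
      refine ⟨?_, ?_, A, s, t, B ++ [e], hR, ?_, ?_⟩ <;> simp [snoc, h, h', h1, hp, hq]
    · have h' : ¬ q.1.last = D.G.src e := h2 ▸ h
      refine ⟨?_, ?_, A, s, t, B, hR, ?_, ?_⟩ <;> simp [snoc, h', h1, h2, hp, hq])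

theorem coverProj_coverStep (D : TrackData) (e : D.G.E) (x : D.CoverV)
    (h : D.coverProj x = D.G.src e) : D.coverProj (D.coverStep e x) = D.G.tgt e := by
  induction x using Quot.ind with
  | mk p =>
    have h' : p.1.last = D.G.src e := h
    simp [coverProj, coverStep, Quot.map, snoc, h']

theorem coverStep_inv (D : TrackData) (e : D.G.E) (x : D.CoverV)
    (h : D.coverProj x = D.G.src e) : D.coverStep (D.G.inv e) (D.coverStep e x) = x := by
  induction x using Quot.ind with
  | mk p =>
    have h' : p.1.last = D.G.src e := h
    refine Quot.sound ?_
    have h3 : (D.snoc e p).1.last = D.G.src (D.G.inv e) := by simp [snoc, h', SerreGraph.tgt]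
    refine ⟨?_, ?_, p.1.edges, [e, D.G.inv e], [], [], Or.inl ⟨e, rfl, rfl⟩, ?_, ?_⟩
    · rw [snoc, dif_pos h3]; simp [snoc, h']
    · rw [snoc, dif_pos h3]; simp [h', SerreGraph.tgt_inv]
    · rw [snoc, dif_pos h3]; simp [snoc, h']
    · simp

/-- The 1-skeleton of the universal covering of `𝒢²`: its edges are the pairs of a vertex `x` of
the covering and an edge of `𝒢¹` which starts at the image of `x`. -/
noncomputable def cover (D : TrackData) : SerreGraph where
  V := D.CoverV
  E := {y : D.CoverV × D.G.E // D.coverProj y.1 = D.G.src y.2}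
  src y := y.1.1
  inv y := ⟨(D.coverStep y.1.2 y.1.1, D.G.inv y.1.2), D.coverProj_coverStep _ _ y.2⟩
  inv_inv y := by
    apply Subtype.ext
    exact Prod.ext (D.coverStep_inv _ _ y.2) (D.G.inv_inv _)
  inv_ne y h := D.G.inv_ne y.1.2 (congrArg (fun z => z.1.2) h)

open Classical in
/-- The relative edge lengths, lifted to the universal covering: edges of the relative part have
length 0 and edges of the train track part have length 1. -/
noncomputable def relLength (D : TrackData) (y : D.cover.E) : ℝ := if D.IsRel y.1.2 then 0 else 1

/-- The path `γ` in the universal covering is a lift of the path `γ₀` in `𝒢¹`. -/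
def IsLift (D : TrackData) (γ : D.cover.Arc) (γ₀ : D.G.Arc) : Prop :=
  D.coverProj γ.first = γ₀.first ∧ γ.edges.map (fun y => y.1.2) = γ₀.edges ∧
    γ.a = γ₀.a ∧ γ.b = γ₀.b

end TrackData

/-!
The universal covering of `𝒢²` is seen through its retraction to the tree which covers `Γ`: two
edge paths with non-auxiliary endpoints are homotopic in `𝒢²` if and only if the reduced forms
`geod` of their retractions to `Γ` agree (`pathHomotopic_iff_geod`). Thus a subpath `lA` of a
normalized path and any competitor `lB` with the same endpoints have the same image `geod lA =
geod lB` in that tree, and it suffices to bound the number `cnt lA` of train track edges of `lA` in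
terms of `cnt lB`.

A reduced path in `X` retracts to a *reduced* path of `Γ` (`retract_reduced_of_inX`), since two
consecutive auxiliary edges are fixed by a power of `f` and therefore form a strongly legal path
(`sl_two_auxEdges`), and strongly legal paths have reduced retractions. Cutting `lB` at its train track edges therefore presents `geod lB` as a concatenation of at most `2 cnt lB + 1`
blocks, each of which is a single edge or a subpath of the retraction of a reduced path in `X`
(`blockCover_geod`). It remains to see that the normalized path has a bounded number of train track
edges in each block. A train track edge of the retraction `r(y)` of a reduced path `y` in `X`
belongs to the pre-INP `r(h h')` of an auxiliary edge `h h'` of `y`, and each pre-INP which occurs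
in `r(y)` and overlaps `r(h h')` is contained in it (`contains_of_overlap`). So, apart from a
bounded number of edges near its ends, the train track edges of a block lie in isolated pre-INPs,
and the normalized path runs over the auxiliary edges instead (`not_marked_of_deep`). This gives the
estimate `exists_cnt_le_of_isNormalized`.

The statement on overlaps is where the dynamics of `f` enters. Passing to a power of `f` which fixes
all INPs up to homotopy (`exists_isPeriod`), the first edge of an INP spans a longer and longer ray
under iteration. This first edge depends only on the first half of the auxiliary edge
(`IsAuxEdge.dir_eq`), so that there is one ray for each half-edge at an auxiliary vertex. The images
of a proper initial part of a pre-INP follow the ray of the first half-edge, and, by symmetry, those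
of the inverse of a proper terminal part follow the ray at the other end (`properPartsGrow`). Now
suppose that a pre-INP in the retraction of a reduced path in `X` has the form `S r(y) Q`, where `S`
and `Q` are proper parts of the pre-INPs of two different auxiliary edges. It is fixed up to homotopy although
the images of `S` and `Q` grow, so that these cancel almost completely: the image of `y` connects
two half-edges with a common ray. Then it is homotopic in `X` to a trivial path or to an auxiliary
edge of one star (`exists_star_of_dir`). As `f` represents an automorphism, it is injective on
homotopy classes of paths (`pathHomotopic_of_map`), and the same holds for `y`, a contradiction
(`retr_ne_of_two_auxEdges`).
-/

/-! ### Cancellation of backtracking -/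

namespace SerreGraph

open Classical in
/-- Put the edge `e` in front of a path, cancelling it if the path starts with `e⁻¹` and `e`
satisfies `p`. -/
noncomputable def push (G : SerreGraph) (p : G.E → Prop) (e : G.E) : List G.E → List G.E
  | [] => [e]
  | e' :: t => if p e ∧ e' = G.inv e then t else e :: e' :: t

/-- Cancel all backtracking at edges which satisfy `p`. -/
noncomputable def red (G : SerreGraph) (p : G.E → Prop) (l : List G.E) : List G.E :=
  l.foldr (G.push p) []

/-- There is no backtracking at edges which satisfy `p`. -/
def RedOn (G : SerreGraph) (p : G.E → Prop) (l : List G.E) : Prop :=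
  l.IsChain (fun e e' => p e → e' ≠ G.inv e)

/-- The reduced path homotopic to `l` in the graph. -/
noncomputable def nf (G : SerreGraph) (l : List G.E) : List G.E := G.red (fun _ => True) l

theorem reduced_iff_redOn (G : SerreGraph) {l : List G.E} :
    G.Reduced l ↔ G.RedOn (fun _ => True) l := by
  simp [Reduced, RedOn]

@[simp] theorem red_nil (G : SerreGraph) (p : G.E → Prop) : G.red p [] = [] := rfl

theorem red_cons (G : SerreGraph) (p : G.E → Prop) (e : G.E) (l : List G.E) :
    G.red p (e :: l) = G.push p e (G.red p l) := rfl

theorem Reduced.redOn {G : SerreGraph} {l : List G.E} (h : G.Reduced l) (p : G.E → Prop) :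
    G.RedOn p l :=
  List.IsChain.imp (fun _ _ h _ => h) h

theorem RedOn.infix {G : SerreGraph} {p : G.E → Prop} {l m : List G.E} (h : G.RedOn p l)
    (hm : m <:+: l) : G.RedOn p m :=
  List.IsChain.infix h hm

theorem Reduced.infix {G : SerreGraph} {l m : List G.E} (h : G.Reduced l)
    (hm : m <:+: l) : G.Reduced m :=
  List.IsChain.infix h hm

theorem push_push_inv (G : SerreGraph) {p : G.E → Prop} (hp : ∀ e, p e → p (G.inv e)) {e : G.E}
    (he : p e) {l : List G.E} (hl : G.RedOn p l) : G.push p e (G.push p (G.inv e) l) = l := by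
  cases l with
  | nil => simp [push, he]
  | cons x t =>
    by_cases hx : x = e
    · subst hx
      cases t with
      | nil => simp [push, hp _ he, G.inv_inv]
      | cons y t =>
        have hy : y ≠ G.inv x := by
          have := (List.isChain_cons_cons.1 hl).1
          exact this he
        simp [push, hp _ he, G.inv_inv, hy]
    · simp [push, hp _ he, G.inv_inv, hx, he]

theorem redOn_push (G : SerreGraph) {p : G.E → Prop} {e : G.E} {l : List G.E}
    (hl : G.RedOn p l) : G.RedOn p (G.push p e l) := by
  cases l with
  | nil => simp [push, RedOn]
  | cons x t =>
    by_cases hx : p e ∧ x = G.inv e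
    · simp only [push, hx, and_self, if_true]
      exact hl.infix (List.suffix_cons _ _).isInfix
    · simp only [push, hx, if_false]
      exact List.isChain_cons_cons.2 ⟨fun h h' => hx ⟨h, h'⟩, hl⟩

theorem redOn_red (G : SerreGraph) (p : G.E → Prop) (l : List G.E) : G.RedOn p (G.red p l) := by
  induction l with
  | nil => simp [RedOn]
  | cons e l ih => exact G.redOn_push ih

theorem red_eq_self (G : SerreGraph) {p : G.E → Prop} {l : List G.E} (hl : G.RedOn p l) :
    G.red p l = l := by
  induction l with
  | nil => rfl
  | cons e l ih =>
    rw [red_cons, ih (hl.infix (List.suffix_cons _ _).isInfix)]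
    cases l with
    | nil => rfl
    | cons x t =>
      have := (List.isChain_cons_cons.1 hl).1
      have hx : ¬ (p e ∧ x = G.inv e) := fun h => this h.1 h.2
      simp only [push, hx, if_false]

theorem red_append (G : SerreGraph) (p : G.E → Prop) (A B : List G.E) :
    G.red p (A ++ B) = A.foldr (G.push p) (G.red p B) := by
  simp [red]

theorem red_append_red (G : SerreGraph) (p : G.E → Prop) (A B : List G.E) :
    G.red p (A ++ G.red p B) = G.red p (A ++ B) := by
  rw [red_append, red_append, G.red_eq_self (G.redOn_red p B)]

theorem foldr_push_push (G : SerreGraph) {p : G.E → Prop} (hp : ∀ e, p e → p (G.inv e)) (e : G.E)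
    (A : List G.E) {L : List G.E} (hL : G.RedOn p L) :
    (G.push p e A).foldr (G.push p) L = G.push p e (A.foldr (G.push p) L) := by
  cases A with
  | nil => rfl
  | cons x t =>
    by_cases hx : p e ∧ x = G.inv e
    · obtain ⟨he, rfl⟩ := hx
      have : G.RedOn p (t.foldr (G.push p) L) := by
        clear * - hL
        induction t with
        | nil => exact hL
        | cons y t ih => exact G.redOn_push ih
      simp only [push, he, and_self, if_true, List.foldr_cons]
      exact (G.push_push_inv hp he this).symm
    · simp only [push, hx, if_false, List.foldr_cons]

theorem red_red_append (G : SerreGraph) {p : G.E → Prop} (hp : ∀ e, p e → p (G.inv e))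
    (A B : List G.E) : G.red p (G.red p A ++ B) = G.red p (A ++ B) := by
  induction A with
  | nil => rfl
  | cons e A ih =>
    rw [List.cons_append, red_cons, red_cons, ← ih, red_append, red_append,
      G.foldr_push_push hp e _ (G.redOn_red p B)]

theorem red_congr (G : SerreGraph) {p : G.E → Prop} (hp : ∀ e, p e → p (G.inv e))
    {A A' B B' : List G.E} (hA : G.red p A = G.red p A') (hB : G.red p B = G.red p B') :
    G.red p (A ++ B) = G.red p (A' ++ B') := by
  rw [← G.red_red_append hp, hA, G.red_red_append hp, ← red_append_red, hB, red_append_red]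

theorem red_cancel (G : SerreGraph) {p : G.E → Prop} (hp : ∀ e, p e → p (G.inv e)) {e : G.E}
    (he : p e) (A B : List G.E) : G.red p (A ++ [e, G.inv e] ++ B) = G.red p (A ++ B) := by
  rw [List.append_assoc]
  refine G.red_congr hp rfl ?_
  exact G.push_push_inv hp he (G.redOn_red p B)

theorem red_red (G : SerreGraph) (p : G.E → Prop) (l : List G.E) :
    G.red p (G.red p l) = G.red p l :=
  G.red_eq_self (G.redOn_red p l)

/-! #### Inverse paths -/

@[simp] theorem rev_nil (G : SerreGraph) : G.rev [] = [] := rfl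

@[simp] theorem rev_append (G : SerreGraph) (A B : List G.E) :
    G.rev (A ++ B) = G.rev B ++ G.rev A := by
  simp [rev]

theorem rev_cons (G : SerreGraph) (e : G.E) (B : List G.E) :
    G.rev (e :: B) = G.rev B ++ [G.inv e] := by
  simp [rev]

@[simp] theorem rev_singleton (G : SerreGraph) (e : G.E) : G.rev [e] = [G.inv e] := rfl

theorem rev_pair (G : SerreGraph) (e e' : G.E) : G.rev [e, e'] = [G.inv e', G.inv e] := rfl

@[simp] theorem rev_rev (G : SerreGraph) (A : List G.E) : G.rev (G.rev A) = A := by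
  simp [rev, List.map_reverse, Function.comp_def, G.inv_inv]

@[simp] theorem rev_length (G : SerreGraph) (A : List G.E) : (G.rev A).length = A.length := by
  simp [rev]

theorem rev_eq_nil (G : SerreGraph) {A : List G.E} : G.rev A = [] ↔ A = [] := by
  simp [rev]

theorem mem_rev (G : SerreGraph) {A : List G.E} {e : G.E} : e ∈ G.rev A ↔ G.inv e ∈ A := by
  simp only [rev, List.mem_reverse, List.mem_map]
  constructor
  · rintro ⟨a, ha, rfl⟩; rwa [G.inv_inv]
  · intro h; exact ⟨_, h, G.inv_inv _⟩

theorem redOn_rev (G : SerreGraph) {p : G.E → Prop}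
    {l : List G.E} (hl : G.RedOn p l) : G.RedOn p (G.rev l) := by
  rw [RedOn, rev, List.isChain_reverse, List.isChain_map]
  refine List.IsChain.imp ?_ hl
  intro a b h hb hab
  rw [G.inv_inv] at hab
  refine h ?_ hab.symm
  rwa [← hab, G.inv_inv] at hb

theorem reduced_rev (G : SerreGraph) {l : List G.E} (hl : G.Reduced l) : G.Reduced (G.rev l) := by
  rw [reduced_iff_redOn] at *
  exact G.redOn_rev hl

theorem red_rev (G : SerreGraph) {p : G.E → Prop} (hp : ∀ e, p e → p (G.inv e))
    (l : List G.E) : G.red p (G.rev l) = G.rev (G.red p l) := by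
  have key : G.red p (G.rev (G.red p l)) = G.red p (G.rev l) := by
    induction l with
    | nil => rfl
    | cons e l ih =>
      rw [red_cons, rev_cons, ← G.red_congr hp ih rfl, ← rev_cons]
      cases G.red p l with
      | nil => rfl
      | cons x t =>
        by_cases hx : p e ∧ x = G.inv e
        · obtain ⟨he, rfl⟩ := hx
          have := G.red_cancel hp he (G.rev t) []
          simp only [List.append_nil] at this
          simp only [push, he, and_self, if_true]
          rw [← this, rev_cons, rev_cons, G.inv_inv]
          simp
        · simp only [push, hx, if_false]
  rw [← key, G.red_eq_self (G.redOn_rev (G.redOn_red p l))]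

theorem red_append_rev (G : SerreGraph) {p : G.E → Prop} (hp : ∀ e, p e → p (G.inv e))
    {l : List G.E} (hl : ∀ e ∈ l, p e) : G.red p (l ++ G.rev l) = [] := by
  induction l with
  | nil => rfl
  | cons e l ih =>
    have h1 := ih (fun e he => hl e (List.mem_cons_of_mem _ he))
    have h2 : G.red p ([e] ++ (l ++ G.rev l) ++ [G.inv e]) = G.red p ([e] ++ [] ++ [G.inv e]) :=
      G.red_congr hp (G.red_congr hp rfl h1) rfl
    have h3 := G.red_cancel hp (hl e List.mem_cons_self) [] []
    rw [rev_cons]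
    simpa using h2.trans (by simpa using h3)

theorem red_rev_append (G : SerreGraph) {p : G.E → Prop} (hp : ∀ e, p e → p (G.inv e))
    {l : List G.E} (hl : ∀ e ∈ l, p e) : G.red p (G.rev l ++ l) = [] := by
  have := G.red_append_rev hp (l := G.rev l) (fun e he => by
    have := hp _ (hl _ (G.mem_rev.1 he)); rwa [G.inv_inv] at this)
  rwa [rev_rev] at this

theorem mem_of_mem_red (G : SerreGraph) {p : G.E → Prop} {l : List G.E} {e : G.E}
    (h : e ∈ G.red p l) : e ∈ l := by
  induction l with
  | nil => exact h
  | cons x l ih =>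
    rw [red_cons] at h
    cases hl : G.red p l with
    | nil => rw [hl] at h; simp [push] at h; simp [h]
    | cons y t =>
      rw [hl] at h ih
      by_cases hx : p x ∧ y = G.inv x
      · simp only [push, hx, and_self, if_true] at h
        exact List.mem_cons_of_mem _ (ih (List.mem_cons_of_mem _ h))
      · simp only [push, hx, if_false] at h
        rcases List.mem_cons.1 h with h | h
        · simp [h]
        · exact List.mem_cons_of_mem _ (ih h)

theorem true_inv (G : SerreGraph) : ∀ e : G.E, (fun _ => True) e → (fun _ : G.E => True) (G.inv e) :=
  fun _ _ => trivial

theorem nf_reduced (G : SerreGraph) (l : List G.E) : G.Reduced (G.nf l) :=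
  G.reduced_iff_redOn.2 (G.redOn_red _ l)

theorem nf_eq_self (G : SerreGraph) {l : List G.E} (hl : G.Reduced l) : G.nf l = l :=
  G.red_eq_self (G.reduced_iff_redOn.1 hl)

theorem nf_congr (G : SerreGraph) {A A' B B' : List G.E} (hA : G.nf A = G.nf A')
    (hB : G.nf B = G.nf B') : G.nf (A ++ B) = G.nf (A' ++ B') :=
  G.red_congr G.true_inv hA hB

theorem nf_nf (G : SerreGraph) (l : List G.E) : G.nf (G.nf l) = G.nf l := G.red_red _ l

theorem nf_rev (G : SerreGraph) (l : List G.E) : G.nf (G.rev l) = G.rev (G.nf l) :=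
  G.red_rev G.true_inv l

theorem nf_append_rev (G : SerreGraph) (l : List G.E) : G.nf (l ++ G.rev l) = [] :=
  G.red_append_rev G.true_inv (fun _ _ => trivial)

theorem nf_rev_append (G : SerreGraph) (l : List G.E) : G.nf (G.rev l ++ l) = [] :=
  G.red_rev_append G.true_inv (fun _ _ => trivial)

theorem nf_append_nf (G : SerreGraph) (A B : List G.E) : G.nf (A ++ G.nf B) = G.nf (A ++ B) :=
  G.red_append_red _ A B

theorem nf_nf_append (G : SerreGraph) (A B : List G.E) : G.nf (G.nf A ++ B) = G.nf (A ++ B) :=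
  G.red_red_append G.true_inv A B

theorem reduced_append_iff (G : SerreGraph) {A B : List G.E} :
    G.Reduced (A ++ B) ↔ G.Reduced A ∧ G.Reduced B ∧
      ∀ x ∈ A.getLast?, ∀ y ∈ B.head?, y ≠ G.inv x :=
  List.isChain_append

theorem redOn_append_iff (G : SerreGraph) {p : G.E → Prop} {A B : List G.E} :
    G.RedOn p (A ++ B) ↔ G.RedOn p A ∧ G.RedOn p B ∧
      ∀ x ∈ A.getLast?, ∀ y ∈ B.head?, p x → y ≠ G.inv x :=
  List.isChain_append

/-- The product of two reduced paths: a terminal piece of the first is cancelled against an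
initial piece of the second one. -/
theorem exists_cancellation (G : SerreGraph) {A B : List G.E} (hA : G.Reduced A)
    (hB : G.Reduced B) :
    ∃ α c β, A = α ++ c ∧ B = G.rev c ++ β ∧ G.nf (A ++ B) = α ++ β := by
  induction A using List.reverseRecOn generalizing B with
  | nil => exact ⟨[], [], B, rfl, rfl, G.nf_eq_self hB⟩
  | append_singleton A x ih =>
    by_cases hx : B.head? = some (G.inv x)
    · obtain ⟨B', rfl⟩ : ∃ B', B = G.inv x :: B' := by
        cases B with
        | nil => simp at hx
        | cons b B' => simp at hx; exact ⟨B', by rw [hx]⟩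
      obtain ⟨α, c, β, h1, h2, h3⟩ := ih (hA.infix (List.prefix_append _ _).isInfix)
        (hB.infix (List.suffix_cons _ _).isInfix)
      refine ⟨α, c ++ [x], β, by simp [h1], by simp [h2], ?_⟩
      rw [← h3]
      have := G.red_cancel G.true_inv (e := x) trivial A B'
      simpa [nf] using this
    · refine ⟨A ++ [x], [], B, by simp, by simp, G.nf_eq_self ?_⟩
      rw [reduced_append_iff]
      refine ⟨hA, hB, ?_⟩
      intro y hy z hz hzy
      simp at hy
      subst hy
      rw [hzy] at hz
      exact hx hz

/-! #### Edge paths -/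

theorem isPath_append_iff (G : SerreGraph) {u v : G.V} {l l' : List G.E} :
    G.IsPath u (l ++ l') v ↔ ∃ w, G.IsPath u l w ∧ G.IsPath w l' v := by
  constructor
  · intro h
    induction l generalizing u with
    | nil => exact ⟨u, rfl, h⟩
    | cons e l ih =>
      obtain ⟨w, h1, h2⟩ := ih h.2
      exact ⟨w, ⟨h.1, h1⟩, h2⟩
  · rintro ⟨w, h1, h2⟩
    exact G.isPath_append h1 h2

theorem IsPath.end_unique {G : SerreGraph} {u v w : G.V} {l : List G.E} (h : G.IsPath u l v)
    (h' : G.IsPath u l w) : v = w := by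
  induction l generalizing u with
  | nil => exact h.symm.trans h'
  | cons e l ih => exact ih h.2 h'.2

theorem IsPath.src_unique {G : SerreGraph} {u u' v v' : G.V} {l : List G.E} (h : G.IsPath u l v)
    (h' : G.IsPath u' l v') (hl : l ≠ []) : u = u' := by
  cases l with
  | nil => exact absurd rfl hl
  | cons e l => exact h.1.symm.trans h'.1

theorem isPath_singleton (G : SerreGraph) (e : G.E) : G.IsPath (G.src e) [e] (G.tgt e) :=
  ⟨rfl, rfl⟩

theorem IsPath.rev {G : SerreGraph} {u v : G.V} {l : List G.E} (h : G.IsPath u l v) :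
    G.IsPath v (G.rev l) u := by
  induction l generalizing u with
  | nil => exact h.symm
  | cons e l ih =>
    rw [rev_cons]
    refine G.isPath_append (ih h.2) ⟨rfl, ?_⟩
    rw [tgt_inv]; exact h.1

theorem IsPath.tgt_last {G : SerreGraph} {u v : G.V} {l : List G.E} {e : G.E}
    (h : G.IsPath u (l ++ [e]) v) : G.tgt e = v := by
  obtain ⟨w, _, h2⟩ := G.isPath_append_iff.1 h
  exact h2.2

/-- Homotopy of lists of edges rel the endpoints `u` and `v`. -/
def PathHomotopic (G : SerreGraph) (R : List G.E → List G.E → Prop) (u v : G.V) :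
    List G.E → List G.E → Prop :=
  Relation.EqvGen fun l l' => G.IsPath u l v ∧ G.IsPath u l' v ∧
    ∃ A s t B, R s t ∧ l = A ++ s ++ B ∧ l' = A ++ t ++ B

/-- Homotopy of edge paths, with the common endpoints made explicit. The endpoints matter, since the
empty list is an edge path at every vertex. -/
theorem homotopic_iff (G : SerreGraph) {R : List G.E → List G.E → Prop} {l l' : List G.E} :
    G.Homotopic R l l' ↔
      ∃ u v, G.IsPath u l v ∧ G.IsPath u l' v ∧ G.PathHomotopic R u v l l' := by
  constructor
  · rintro ⟨p, q, rfl, rfl, h⟩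
    have key : p.first = q.first ∧ p.last = q.last ∧
        ∀ u v, u = p.first → v = p.last → G.PathHomotopic R u v p.edges q.edges := by
      induction h with
      | rel p q h =>
        refine ⟨h.1, h.2.1, ?_⟩
        rintro u v rfl rfl
        exact .rel _ _ ⟨p.isPath, by rw [h.1, h.2.1]; exact q.isPath, h.2.2⟩
      | refl p => exact ⟨rfl, rfl, fun _ _ _ _ => .refl _⟩
      | symm p q _ ih =>
        refine ⟨ih.1.symm, ih.2.1.symm, fun u v hu hv => .symm _ _ (ih.2.2 u v ?_ ?_)⟩
        · rw [hu, ih.1]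
        · rw [hv, ih.2.1]
      | trans p q r _ _ ih1 ih2 =>
        refine ⟨ih1.1.trans ih2.1, ih1.2.1.trans ih2.2.1, fun u v hu hv =>
          .trans _ _ _ (ih1.2.2 u v hu hv) (ih2.2.2 u v ?_ ?_)⟩
        · rw [hu, ih1.1]
        · rw [hv, ih1.2.1]
    exact ⟨p.first, p.last, p.isPath, by rw [key.1, key.2.1]; exact q.isPath, key.2.2 _ _ rfl rfl⟩
  · rintro ⟨u, v, h, h', H⟩
    have key : (G.IsPath u l v ↔ G.IsPath u l' v) ∧
        ∀ hp hq, Relation.EqvGen (G.Move R) ⟨u, v, l, hp⟩ ⟨u, v, l', hq⟩ := by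
      clear h h'
      induction H with
      | rel l l' h => exact ⟨⟨fun _ => h.2.1, fun _ => h.1⟩, fun hp hq => .rel _ _ ⟨rfl, rfl, h.2.2⟩⟩
      | refl l => exact ⟨Iff.rfl, fun _ _ => .refl _⟩
      | symm _ _ _ ih => exact ⟨ih.1.symm, fun hp hq => .symm _ _ (ih.2 hq hp)⟩
      | trans _ _ _ _ _ ih1 ih2 =>
        exact ⟨ih1.1.trans ih2.1, fun hp hq =>
          .trans _ ⟨u, v, _, ih1.1.1 hp⟩ _ (ih1.2 hp _) (ih2.2 _ hq)⟩
    exact ⟨⟨u, v, l, h⟩, ⟨u, v, l', h'⟩, rfl, rfl, key.2 h h'⟩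

theorem PathHomotopic.symm {G : SerreGraph} {R : List G.E → List G.E → Prop} {u v : G.V}
    {l l' : List G.E} (h : G.PathHomotopic R u v l l') : G.PathHomotopic R u v l' l :=
  Relation.EqvGen.symm _ _ h

theorem PathHomotopic.trans {G : SerreGraph} {R : List G.E → List G.E → Prop} {u v : G.V}
    {l l' l'' : List G.E} (h : G.PathHomotopic R u v l l') (h' : G.PathHomotopic R u v l' l'') :
    G.PathHomotopic R u v l l'' :=
  Relation.EqvGen.trans _ _ _ h h'

theorem PathHomotopic.refl (G : SerreGraph) (R : List G.E → List G.E → Prop) (u v : G.V)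
    (l : List G.E) : G.PathHomotopic R u v l l :=
  Relation.EqvGen.refl _

theorem PathHomotopic.isPath_iff {G : SerreGraph} {R : List G.E → List G.E → Prop} {u v : G.V}
    {l l' : List G.E} (h : G.PathHomotopic R u v l l') : G.IsPath u l v ↔ G.IsPath u l' v := by
  induction h with
  | rel _ _ h => exact ⟨fun _ => h.2.1, fun _ => h.1⟩
  | refl => rfl
  | symm _ _ _ ih => exact ih.symm
  | trans _ _ _ _ _ ih1 ih2 => exact ih1.trans ih2

theorem PathHomotopic.append {G : SerreGraph} {R : List G.E → List G.E → Prop} {u v x y : G.V}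
    {l l' A B : List G.E} (hA : G.IsPath u A x) (h : G.PathHomotopic R x y l l')
    (hB : G.IsPath y B v) : G.PathHomotopic R u v (A ++ l ++ B) (A ++ l' ++ B) := by
  induction h with
  | rel l l' h =>
    obtain ⟨h1, h2, A', s, t, B', hR, rfl, rfl⟩ := h
    exact .rel _ _ ⟨G.isPath_append (G.isPath_append hA h1) hB,
      G.isPath_append (G.isPath_append hA h2) hB, A ++ A', s, t, B' ++ B, hR, by simp, by simp⟩
  | refl => exact .refl _ _ _ _ _
  | symm _ _ _ ih => exact ih.symm
  | trans _ _ _ _ _ ih1 ih2 => exact ih1.trans ih2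

theorem PathHomotopic.red_eq {G : SerreGraph} {R : List G.E → List G.E → Prop} {p : G.E → Prop}
    (hp : ∀ e, p e → p (G.inv e))
    (hR : ∀ s t, R s t → ∃ e, p e ∧ s = [e, G.inv e] ∧ t = []) {u v : G.V}
    {l l' : List G.E} (h : G.PathHomotopic R u v l l') : G.red p l = G.red p l' := by
  induction h with
  | rel l l' h =>
    obtain ⟨-, -, A, s, t, B, h, rfl, rfl⟩ := h
    obtain ⟨e, he, rfl, rfl⟩ := hR _ _ h
    rw [G.red_cancel hp he]; simp
  | refl => rfl
  | symm _ _ _ ih => exact ih.symm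
  | trans _ _ _ _ _ ih1 ih2 => exact ih1.trans ih2

theorem pathHomotopic_red (G : SerreGraph) {R : List G.E → List G.E → Prop} {p : G.E → Prop}
    (hR : ∀ e, p e → R [e, G.inv e] []) {u v : G.V} {l : List G.E} (h : G.IsPath u l v) :
    G.PathHomotopic R u v l (G.red p l) := by
  induction l generalizing u with
  | nil => exact .refl _ _ _ _ _
  | cons e l ih =>
    have h1 := ih h.2
    have h2 : G.PathHomotopic R u v (e :: l) (e :: G.red p l) := by
      have := PathHomotopic.append (A := [e]) (B := []) ⟨h.1, rfl⟩ h1 rfl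
      simpa using this
    refine h2.trans ?_
    have h3 := h2.isPath_iff.1 h
    rw [red_cons]
    cases hl : G.red p l with
    | nil => exact .refl _ _ _ _ _
    | cons x t =>
      rw [hl] at h3
      by_cases hx : p e ∧ x = G.inv e
      · obtain ⟨he, rfl⟩ := hx
        simp only [push, he, and_self, if_true]
        refine .rel _ _ ⟨h3, ?_, [], [e, G.inv e], [], t, hR e he, by simp, by simp⟩
        have := h3.2.2
        rw [tgt_inv, h3.1] at this
        exact this
      · simp only [push, hx, if_false]
        exact .refl _ _ _ _ _

theorem IsPath.red {G : SerreGraph} {p : G.E → Prop} {u v : G.V} {l : List G.E}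
    (h : G.IsPath u l v) : G.IsPath u (G.red p l) v :=
  (G.pathHomotopic_red (R := fun s t => ∃ e, p e ∧ s = [e, G.inv e] ∧ t = [])
    (fun e he => ⟨e, he, rfl, rfl⟩) h).isPath_iff.1 h

end SerreGraph

/-! ### The retraction to `Γ` -/

namespace TrackData

/-- An edge path whose endpoints are not auxiliary. -/
def Seg (D : TrackData) (u : D.G.V) (l : List D.G.E) (v : D.G.V) : Prop :=
  ¬ D.IsAuxV u ∧ ¬ D.IsAuxV v ∧ D.G.IsPath u l v

/-- The path runs over non-auxiliary edges only. -/
def NoAux (D : TrackData) (l : List D.G.E) : Prop := ∀ e ∈ l, ¬ D.IsAux e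

theorem isAux_inv (D : TrackData) {e : D.G.E} : D.IsAux (D.G.inv e) ↔ D.IsAux e := by
  simp only [IsAux, D.G.tgt_inv]
  exact or_comm

theorem NoAux.append {D : TrackData} {l l' : List D.G.E} (h : D.NoAux l) (h' : D.NoAux l') :
    D.NoAux (l ++ l') := fun e he => (List.mem_append.1 he).elim (h e) (h' e)

theorem Seg.append {D : TrackData} {u v w : D.G.V} {l l' : List D.G.E} (h : D.Seg u l v)
    (h' : D.Seg v l' w) : D.Seg u (l ++ l') w :=
  ⟨h.1, h'.2.1, D.G.isPath_append h.2.2 h'.2.2⟩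

theorem Seg.rev {D : TrackData} {u v : D.G.V} {l : List D.G.E} (h : D.Seg u l v) :
    D.Seg v (D.G.rev l) u := ⟨h.2.1, h.1, h.2.2.rev⟩

theorem Seg.nil {D : TrackData} {u : D.G.V} (h : ¬ D.IsAuxV u) : D.Seg u [] u := ⟨h, h, rfl⟩

theorem Seg.split {D : TrackData} {u v : D.G.V} {l l' : List D.G.E} (h : D.Seg u (l ++ l') v) :
    ∃ w, D.G.IsPath u l w ∧ D.G.IsPath w l' v ∧ (¬ D.IsAuxV w → D.Seg u l w ∧ D.Seg w l' v) := by
  obtain ⟨w, h1, h2⟩ := D.G.isPath_append_iff.1 h.2.2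
  exact ⟨w, h1, h2, fun hw => ⟨⟨h.1, hw, h1⟩, ⟨hw, h.2.1, h2⟩⟩⟩

theorem Seg.of_append_left {D : TrackData} {u v w : D.G.V} {l l' : List D.G.E}
    (h : D.Seg u (l ++ l') v) (hl : D.Seg u l w) : D.Seg w l' v := by
  obtain ⟨w', h1, h2, -⟩ := h.split
  obtain rfl := hl.2.2.end_unique h1
  exact ⟨hl.2.1, h.2.1, h2⟩

theorem NoAux.seg {D : TrackData} {u v : D.G.V} {l : List D.G.E} (h : D.NoAux l) (hu : ¬ D.IsAuxV u)
    (hl : D.G.IsPath u l v) : D.Seg u l v := by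
  refine ⟨hu, ?_, hl⟩
  induction l generalizing u with
  | nil => cases hl; exact hu
  | cons e l ih =>
    exact ih (fun x hx => h x (List.mem_cons_of_mem _ hx))
      (fun hx => h e List.mem_cons_self (Or.inr hx)) hl.2

theorem seg_singleton (D : TrackData) {e : D.G.E} (he : ¬ D.IsAux e) :
    D.Seg (D.G.src e) [e] (D.G.tgt e) :=
  ⟨fun h => he (Or.inl h), fun h => he (Or.inr h), D.G.isPath_singleton e⟩

/-- A path with non-auxiliary endpoints is composed of non-auxiliary edges and of pairs of
half-edges which meet at an auxiliary vertex. -/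
@[elab_as_elim]
theorem Seg.induction {D : TrackData} (hD : IsTrackMap D) {v : D.G.V}
    {motive : ∀ (u : D.G.V) (l : List D.G.E), D.Seg u l v → Prop}
    (nil : ∀ hv : ¬ D.IsAuxV v, motive v [] (Seg.nil hv))
    (edge : ∀ e l (he : ¬ D.IsAux e) (hs : D.Seg (D.G.tgt e) l v), motive (D.G.tgt e) l hs →
      motive (D.G.src e) (e :: l) ((D.seg_singleton he).append hs))
    (aux : ∀ h h' l (_ : D.IsAuxV (D.G.tgt h)) (_ : D.G.src h' = D.G.tgt h)
      (hs : D.Seg (D.G.src h) [h, h'] (D.G.tgt h')) (hs' : D.Seg (D.G.tgt h') l v),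
      motive (D.G.tgt h') l hs' → motive (D.G.src h) (h :: h' :: l) (hs.append hs'))
    {u : D.G.V} {l : List D.G.E} (h : D.Seg u l v) : motive u l h := by
  obtain ⟨n, hn⟩ : ∃ n, l.length ≤ n := ⟨_, le_rfl⟩
  induction n generalizing u l with
  | zero =>
    obtain rfl : l = [] := by simpa using hn
    obtain rfl : u = v := h.2.2
    exact nil h.1
  | succ n ih =>
    match l, h, hn with
    | [], h, _ =>
      obtain rfl : u = v := h.2.2
      exact nil h.1
    | e :: l, h, hn =>
      obtain ⟨hu, hv, rfl, hl⟩ := h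
      by_cases he : D.IsAuxV (D.G.tgt e)
      · match l, hl, hn with
        | [], hl, _ => exact absurd (by rwa [← show D.G.tgt e = v from hl]) hv
        | e' :: l, hl, hn =>
          obtain ⟨h1, h2⟩ := hl
          have h3 : ¬ D.IsAuxV (D.G.tgt e') := hD.aux_ends e' (h1 ▸ he)
          exact aux e e' l he h1 ⟨hu, h3, rfl, h1, rfl⟩ ⟨h3, hv, h2⟩
            (ih ⟨h3, hv, h2⟩ (by simp at hn; omega))
      · exact edge e l (fun h => h.elim hu he) ⟨he, hv, hl⟩ (ih ⟨he, hv, hl⟩ (by simpa using hn))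

open Classical in
/-- The piece of a path of `Γ` by which the retraction replaces the passage `h h'` through an
auxiliary vertex. -/
noncomputable def piece (D : TrackData) (h h' : D.G.E) : List D.G.E :=
  if h' = D.G.inv h then [] else D.retr [h, h']

open Classical in
/-- The retraction to `Γ`, computed in one step: every passage through an auxiliary vertex is
replaced by its image in `Γ`. It agrees with `retr` on paths with non-auxiliary endpoints as
soon as there are auxiliary edges. -/
noncomputable def retract (D : TrackData) : List D.G.E → List D.G.E
  | [] => []
  | [e] => [e]
  | e :: e' :: l =>
    if D.IsAuxV (D.G.tgt e) then D.piece e e' ++ retract D l else e :: retract D (e' :: l)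

theorem retract_edge (D : TrackData) {e : D.G.E} (he : ¬ D.IsAux e) (l : List D.G.E) :
    D.retract (e :: l) = e :: D.retract l := by
  cases l with
  | nil => rfl
  | cons e' l => rw [retract, if_neg (fun h => he (Or.inr h))]

theorem retract_aux (D : TrackData) {h : D.G.E} (hh : D.IsAuxV (D.G.tgt h)) (h' : D.G.E)
    (l : List D.G.E) : D.retract (h :: h' :: l) = D.piece h h' ++ D.retract l := by
  rw [retract, if_pos hh]

@[simp] theorem retract_nil (D : TrackData) : D.retract [] = [] := rfl

theorem rhat_edge (D : TrackData) {e : D.G.E} (he : ¬ D.IsAux e) (l : List D.G.E) :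
    D.rhat (e :: l) = e :: D.rhat l := by
  cases l with
  | nil => rfl
  | cons e' l => rw [rhat, if_neg (fun h => he (Or.inr h))]

theorem rhat_auxEdge (D : TrackData) {h h' : D.G.E} (hh : D.IsAuxEdge h h') (l : List D.G.E) :
    D.rhat (h :: h' :: l) = D.eta h h' ++ D.rhat l := by
  rw [rhat, if_pos hh.1, if_neg hh.2.2]

theorem rhat_back (D : TrackData) {h : D.G.E} (hh : D.IsAuxV (D.G.tgt h)) (l : List D.G.E) :
    D.rhat (h :: D.G.inv h :: l) = D.rhat l := by
  rw [rhat, if_pos hh, if_pos rfl]; rfl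

theorem rhat_append {D : TrackData} (hD : IsTrackMap D) {u v : D.G.V} {l : List D.G.E}
    (hl : D.Seg u l v) (l' : List D.G.E) : D.rhat (l ++ l') = D.rhat l ++ D.rhat l' := by
  induction hl using Seg.induction hD with
  | nil => rfl
  | edge e l he _ ih => rw [List.cons_append, D.rhat_edge he, D.rhat_edge he, ih]; rfl
  | aux h h' l hh hh' _ _ ih =>
    rw [List.cons_append, List.cons_append]
    by_cases hb : h' = D.G.inv h
    · subst hb; rw [D.rhat_back hh, D.rhat_back hh, ih]
    · rw [D.rhat_auxEdge ⟨hh, hh', hb⟩, D.rhat_auxEdge ⟨hh, hh', hb⟩, ih, List.append_assoc]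

theorem retract_append {D : TrackData} (hD : IsTrackMap D) {u v : D.G.V} {l : List D.G.E}
    (hl : D.Seg u l v) (l' : List D.G.E) :
    D.retract (l ++ l') = D.retract l ++ D.retract l' := by
  induction hl using Seg.induction hD with
  | nil => rfl
  | edge e l he _ ih => rw [List.cons_append, D.retract_edge he, D.retract_edge he, ih]; rfl
  | aux h h' l hh hh' _ _ ih =>
    rw [List.cons_append, List.cons_append, D.retract_aux hh, D.retract_aux hh, ih,
      List.append_assoc]

theorem retract_noAux (D : TrackData) {l : List D.G.E} (hl : D.NoAux l) : D.retract l = l := by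
  induction l with
  | nil => rfl
  | cons e l ih =>
    rw [D.retract_edge (hl e List.mem_cons_self),
      ih (fun x hx => hl x (List.mem_cons_of_mem _ hx))]

theorem rhat_noAux (D : TrackData) {l : List D.G.E} (hl : D.NoAux l) : D.rhat l = l := by
  induction l with
  | nil => rfl
  | cons e l ih =>
    rw [D.rhat_edge (hl e List.mem_cons_self),
      ih (fun x hx => hl x (List.mem_cons_of_mem _ hx))]

theorem IsAuxEdge.seg {D : TrackData} (hD : IsTrackMap D) {h h' : D.G.E} (hh : D.IsAuxEdge h h') :
    D.Seg (D.G.src h) [h, h'] (D.G.tgt h') := by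
  refine ⟨fun hx => hD.aux_ends h hx hh.1, hD.aux_ends h' (hh.2.1 ▸ hh.1), rfl, hh.2.1, rfl⟩

theorem IsAuxEdge.isRel {D : TrackData} (hD : IsTrackMap D) {h h' : D.G.E}
    (hh : D.IsAuxEdge h h') : D.IsRel h ∧ D.IsRel h' :=
  ⟨hD.aux_rel _ (Or.inr hh.1), hD.aux_rel _ (Or.inl (hh.2.1 ▸ hh.1))⟩

theorem IsAuxEdge.inX {D : TrackData} (hD : IsTrackMap D) {h h' : D.G.E}
    (hh : D.IsAuxEdge h h') : D.InX [h, h'] := by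
  intro e he
  rcases List.mem_pair.1 he with rfl | rfl
  exacts [(hh.isRel hD).1, (hh.isRel hD).2]

theorem IsAuxEdge.rev {D : TrackData} {h h' : D.G.E} (hh : D.IsAuxEdge h h') :
    D.IsAuxEdge (D.G.inv h') (D.G.inv h) := by
  refine ⟨?_, ?_, fun hx => hh.2.2 ?_⟩
  · rw [D.G.tgt_inv, hh.2.1]; exact hh.1
  · rw [D.G.tgt_inv, hh.2.1]; rfl
  · rw [hx, D.G.inv_inv]

theorem IsAuxEdge.eta_seg {D : TrackData} (hD : IsTrackMap D) {h h' : D.G.E}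
    (hh : D.IsAuxEdge h h') : D.Seg (D.G.src h) (D.eta h h') (D.G.tgt h') :=
  ⟨(hh.seg hD).1, (hh.seg hD).2.1, hD.eta_isPath h h' hh⟩

theorem Seg.rhat {D : TrackData} (hD : IsTrackMap D) {u v : D.G.V} {l : List D.G.E}
    (hl : D.Seg u l v) : D.Seg u (D.rhat l) v := by
  induction hl using Seg.induction hD with
  | nil hv => exact Seg.nil hv
  | edge e l he _ ih => rw [D.rhat_edge he]; exact (D.seg_singleton he).append ih
  | aux h h' l hh hh' hs _ ih =>
    by_cases hb : h' = D.G.inv h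
    · subst hb; rw [D.rhat_back hh]; rwa [D.G.tgt_inv] at ih
    · have ha : D.IsAuxEdge h h' := ⟨hh, hh', hb⟩
      rw [D.rhat_auxEdge ha]; exact (ha.eta_seg hD).append ih

theorem Seg.rhat_iterate {D : TrackData} (hD : IsTrackMap D) {u v : D.G.V} {l : List D.G.E}
    (hl : D.Seg u l v) (n : ℕ) : D.Seg u (D.rhat^[n] l) v := by
  induction n with
  | zero => exact hl
  | succ n ih => rw [Function.iterate_succ_apply']; exact ih.rhat hD

theorem rhat_iterate_append {D : TrackData} (hD : IsTrackMap D) {u v : D.G.V} {l : List D.G.E}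
    (hl : D.Seg u l v) (l' : List D.G.E) (n : ℕ) :
    D.rhat^[n] (l ++ l') = D.rhat^[n] l ++ D.rhat^[n] l' := by
  induction n with
  | zero => rfl
  | succ n ih =>
    rw [Function.iterate_succ_apply', ih, rhat_append hD (hl.rhat_iterate hD n),
      Function.iterate_succ_apply', Function.iterate_succ_apply']

theorem rhat_rev {D : TrackData} (hD : IsTrackMap D) {u v : D.G.V} {l : List D.G.E}
    (hl : D.Seg u l v) : D.rhat (D.G.rev l) = D.G.rev (D.rhat l) := by
  induction hl using Seg.induction hD with
  | nil => rfl
  | edge e l he hs ih =>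
    rw [D.G.rev_cons, rhat_append hD hs.rev, D.rhat_edge he, ih, D.G.rev_cons]; rfl
  | aux h h' l hh hh' hs hs' ih =>
    rw [show h :: h' :: l = [h, h'] ++ l from rfl, D.G.rev_append, rhat_append hD hs'.rev, ih,
      rhat_append hD hs, D.G.rev_append]
    congr 1
    rw [D.G.rev_pair]
    by_cases hb : h' = D.G.inv h
    · subst hb
      rw [D.rhat_back hh, D.G.inv_inv, D.rhat_back hh]; rfl
    · have ha : D.IsAuxEdge h h' := ⟨hh, hh', hb⟩
      rw [D.rhat_auxEdge ha, D.rhat_auxEdge ha.rev, D.G.rev_append, hD.eta_rev _ _ ha]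
      simp [rhat]

theorem rhat_iterate_rev {D : TrackData} (hD : IsTrackMap D) {u v : D.G.V} {l : List D.G.E}
    (hl : D.Seg u l v) (n : ℕ) : D.rhat^[n] (D.G.rev l) = D.G.rev (D.rhat^[n] l) := by
  induction n with
  | zero => rfl
  | succ n ih =>
    rw [Function.iterate_succ_apply', ih, rhat_rev hD (hl.rhat_iterate hD n),
      Function.iterate_succ_apply']

theorem IsAuxEdge.retr_seg {D : TrackData} (hD : IsTrackMap D) {h h' : D.G.E}
    (hh : D.IsAuxEdge h h') : D.Seg (D.G.src h) (D.retr [h, h']) (D.G.tgt h') :=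
  (hh.seg hD).rhat_iterate hD _

theorem IsAuxEdge.retr_rev {D : TrackData} (hD : IsTrackMap D) {h h' : D.G.E}
    (hh : D.IsAuxEdge h h') :
    D.retr [D.G.inv h', D.G.inv h] = D.G.rev (D.retr [h, h']) :=
  rhat_iterate_rev hD (hh.seg hD) _

theorem IsAuxEdge.piece_eq {D : TrackData} {h h' : D.G.E} (hh : D.IsAuxEdge h h') :
    D.piece h h' = D.retr [h, h'] := if_neg hh.2.2

theorem IsAuxEdge.depth_ne {D : TrackData} (hD : IsTrackMap D) {h h' : D.G.E}
    (hh : D.IsAuxEdge h h') : D.depth ≠ 0 := by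
  intro h0
  have := (hD.retr_aux h h' hh).2 h
  rw [retr, h0] at this
  exact this (by simp) (Or.inr hh.1)

/-- One step of `retract` has the effect of all iterations of `r̂`: an inserted path `eta h h'` is
retracted to `retr [h, h']`. -/
theorem retract_eq_iterate {D : TrackData} (hD : IsTrackMap D) (h0 : D.depth ≠ 0) {u v : D.G.V}
    {l : List D.G.E} (hl : D.Seg u l v) : D.retract l = D.retr l := by
  rw [retr]
  induction hl using Seg.induction hD with
  | nil => exact (Function.iterate_fixed rfl _).symm
  | edge e l he hs ih =>
    rw [D.retract_edge he, show e :: l = [e] ++ l from rfl,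
      rhat_iterate_append hD (D.seg_singleton he), ih,
      Function.iterate_fixed (show D.rhat [e] = [e] from rfl)]; rfl
  | aux h h' l hh hh' hs hs' ih =>
    rw [D.retract_aux hh, show h :: h' :: l = [h, h'] ++ l from rfl,
      rhat_iterate_append hD hs, ih]
    congr 1
    rw [piece]
    split_ifs with hb
    · subst hb
      obtain ⟨n, hn⟩ := Nat.exists_eq_succ_of_ne_zero h0
      rw [hn, Function.iterate_succ_apply, D.rhat_back hh]
      exact (Function.iterate_fixed rfl _).symm
    · rfl

theorem IsAuxEdge.retract_eta {D : TrackData} (hD : IsTrackMap D) {h h' : D.G.E}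
    (hh : D.IsAuxEdge h h') : D.retract (D.eta h h') = D.retr [h, h'] := by
  have h1 : D.rhat [h, h'] = D.eta h h' := by
    rw [D.rhat_auxEdge hh]; simp [rhat]
  rw [retract_eq_iterate hD (hh.depth_ne hD) (hh.eta_seg hD), ← h1, retr, retr,
    ← Function.iterate_succ_apply, Function.iterate_succ_apply']
  exact D.rhat_noAux (hD.retr_aux h h' hh).2

theorem noAux_piece {D : TrackData} (hD : IsTrackMap D) {h h' : D.G.E}
    (hh : D.IsAuxV (D.G.tgt h)) (hh' : D.G.src h' = D.G.tgt h) : D.NoAux (D.piece h h') := by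
  rw [piece]
  split_ifs with hb
  · intro e he; simp at he
  · exact (hD.retr_aux h h' ⟨hh, hh', hb⟩).2

theorem Seg.noAux_retract {D : TrackData} (hD : IsTrackMap D) {u v : D.G.V} {l : List D.G.E}
    (hl : D.Seg u l v) : D.NoAux (D.retract l) := by
  induction hl using Seg.induction hD with
  | nil => intro e he; simp at he
  | edge e l he hs ih =>
    rw [D.retract_edge he]
    exact NoAux.append (l := [e]) (by intro x hx; rw [List.mem_singleton.1 hx]; exact he) ih
  | aux h h' l hh hh' hs hs' ih =>
    rw [D.retract_aux hh]
    exact (noAux_piece hD hh hh').append ih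

theorem seg_piece {D : TrackData} (hD : IsTrackMap D) {h h' : D.G.E}
    (hh : D.IsAuxV (D.G.tgt h)) (hh' : D.G.src h' = D.G.tgt h) :
    D.Seg (D.G.src h) (D.piece h h') (D.G.tgt h') := by
  rw [piece]
  split_ifs with hb
  · subst hb; rw [D.G.tgt_inv]; exact Seg.nil (fun hx => hD.aux_ends h hx hh)
  · exact IsAuxEdge.retr_seg hD ⟨hh, hh', hb⟩

theorem Seg.retract {D : TrackData} (hD : IsTrackMap D) {u v : D.G.V} {l : List D.G.E}
    (hl : D.Seg u l v) : D.Seg u (D.retract l) v := by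
  induction hl using Seg.induction hD with
  | nil hv => exact Seg.nil hv
  | edge e l he hs ih => rw [D.retract_edge he]; exact (D.seg_singleton he).append ih
  | aux h h' l hh hh' hs hs' ih =>
    rw [D.retract_aux hh]
    exact (seg_piece hD hh hh').append ih

theorem piece_rev {D : TrackData} (hD : IsTrackMap D) {h h' : D.G.E}
    (hh : D.IsAuxV (D.G.tgt h)) (hh' : D.G.src h' = D.G.tgt h) :
    D.piece (D.G.inv h') (D.G.inv h) = D.G.rev (D.piece h h') := by
  by_cases hb : h' = D.G.inv h
  · subst hb; simp [piece, D.G.inv_inv]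
  · have ha : D.IsAuxEdge h h' := ⟨hh, hh', hb⟩
    rw [ha.piece_eq, ha.rev.piece_eq, ha.retr_rev hD]

theorem retract_rev {D : TrackData} (hD : IsTrackMap D) {u v : D.G.V} {l : List D.G.E}
    (hl : D.Seg u l v) : D.retract (D.G.rev l) = D.G.rev (D.retract l) := by
  induction hl using Seg.induction hD with
  | nil => rfl
  | edge e l he hs ih =>
    rw [D.G.rev_cons, retract_append hD hs.rev, D.retract_edge he, ih, D.G.rev_cons]; rfl
  | aux h h' l hh hh' hs hs' ih =>
    rw [show h :: h' :: l = [h, h'] ++ l from rfl, D.G.rev_append, retract_append hD hs'.rev, ih,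
      retract_append hD hs, D.G.rev_append, D.G.rev_pair]
    congr 1
    have h1 : D.IsAuxV (D.G.tgt (D.G.inv h')) := by rw [D.G.tgt_inv, hh']; exact hh
    rw [D.retract_aux h1, D.retract_aux hh, piece_rev hD hh hh']
    simp

/-- The reduced path of `Γ` which is homotopic to `l` in `𝒢²`: the geodesic, in the universal
covering of `Γ`, between the endpoints of the lifts of `l`. -/
noncomputable def geod (D : TrackData) (l : List D.G.E) : List D.G.E := D.G.nf (D.retract l)

theorem geod_append {D : TrackData} (hD : IsTrackMap D) {u v : D.G.V} {l : List D.G.E}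
    (hl : D.Seg u l v) (l' : List D.G.E) :
    D.geod (l ++ l') = D.G.nf (D.geod l ++ D.geod l') := by
  rw [geod, retract_append hD hl, geod, geod, D.G.nf_nf_append, D.G.nf_append_nf]

theorem geod_congr {D : TrackData} (hD : IsTrackMap D) {u v u' v' : D.G.V}
    {l m l' m' : List D.G.E} (hl : D.Seg u l v) (hm : D.Seg u' m v') (h : D.geod l = D.geod m)
    (h' : D.geod l' = D.geod m') : D.geod (l ++ l') = D.geod (m ++ m') := by
  rw [geod_append hD hl, geod_append hD hm, h, h']

theorem geod_rev {D : TrackData} (hD : IsTrackMap D) {u v : D.G.V} {l : List D.G.E}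
    (hl : D.Seg u l v) : D.geod (D.G.rev l) = D.G.rev (D.geod l) := by
  rw [geod, retract_rev hD hl, D.G.nf_rev, geod]

theorem geod_retract {D : TrackData} (hD : IsTrackMap D) {u v : D.G.V} {l : List D.G.E}
    (hl : D.Seg u l v) : D.geod (D.retract l) = D.geod l := by
  rw [geod, D.retract_noAux (hl.noAux_retract hD), geod]

theorem IsAuxEdge.retract_pair {D : TrackData} {h h' : D.G.E} (hh : D.IsAuxEdge h h') :
    D.retract [h, h'] = D.retr [h, h'] := by
  rw [D.retract_aux hh.1, hh.piece_eq]; simp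

theorem IsAuxEdge.geod_pair {D : TrackData} (hD : IsTrackMap D) {h h' : D.G.E}
    (hh : D.IsAuxEdge h h') : D.geod [h, h'] = D.retr [h, h'] := by
  rw [geod, hh.retract_pair, D.G.nf_eq_self (hD.retr_aux h h' hh).1]

/-- The retractions of the passages through one auxiliary vertex are compatible. -/
theorem nf_piece_append {D : TrackData} (hD : IsTrackMap D) {g e g' : D.G.E}
    (hg : D.IsAuxV (D.G.tgt g)) (he : D.G.src e = D.G.tgt g) (hg' : D.G.src g' = D.G.tgt g) :
    D.G.nf (D.piece g e ++ D.piece (D.G.inv e) g') = D.G.nf (D.piece g g') := by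
  have hte : D.IsAuxV (D.G.tgt (D.G.inv e)) := by rw [D.G.tgt_inv, he]; exact hg
  by_cases h1 : e = D.G.inv g
  · subst h1; rw [D.G.inv_inv]; simp [piece]
  by_cases h2 : g' = e
  · subst h2
    simp [piece, D.G.inv_inv]
  have a1 : D.IsAuxEdge g e := ⟨hg, he, h1⟩
  have a2 : D.IsAuxEdge (D.G.inv e) g' :=
    ⟨hte, by rw [hg', D.G.tgt_inv, he], by rw [D.G.inv_inv]; exact h2⟩
  by_cases h3 : g' = D.G.inv g
  · subst h3
    rw [piece_rev hD hg he, D.G.nf_append_rev]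
    simp [piece, SerreGraph.nf]
  · have a3 : D.IsAuxEdge g g' := ⟨hg, hg', h3⟩
    have := hD.retr_star g (D.G.inv e) (D.G.inv g') (by rwa [D.G.inv_inv])
      (by rwa [D.G.inv_inv]) (by rwa [D.G.inv_inv])
    rw [D.G.inv_inv, D.G.inv_inv] at this
    obtain ⟨u, v, -, -, H⟩ := D.G.homotopic_iff.1 this
    rw [a1.piece_eq, a2.piece_eq, a3.piece_eq]
    exact H.red_eq D.G.true_inv (fun s t ⟨e, h, h'⟩ => ⟨e, trivial, h, h'⟩)

/-- Cancelling `e e⁻¹` does not change the geodesic. If `e` is an auxiliary half-edge, then the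
backtracking may happen at either end of `e`, and the compatibility of the retractions at a star is
needed. -/
theorem geod_cancel {D : TrackData} (hD : IsTrackMap D) {u v : D.G.V} {A B : List D.G.E}
    {e : D.G.E} (h : D.Seg u (A ++ [e, D.G.inv e] ++ B) v) :
    D.geod (A ++ [e, D.G.inv e] ++ B) = D.geod (A ++ B) := by
  obtain ⟨w, hw1, hw2, hw3⟩ := h.split
  obtain ⟨x, hx1, hx2⟩ := D.G.isPath_append_iff.1 hw1
  obtain ⟨hx3, -, hx4⟩ := hx2
  rw [D.G.tgt_inv] at hx4
  obtain rfl : D.G.src e = w := hx4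
  subst hx3
  by_cases hs : D.IsAuxV (D.G.src e)
  · -- the path passes through an auxiliary vertex before and after the backtracking edge
    rcases List.eq_nil_or_concat A with rfl | ⟨A, g, rfl⟩
    · exact absurd hs (by rw [show D.G.src e = u from hx1.symm]; exact h.1)
    cases B with
    | nil => exact absurd hs (by rw [show D.G.src e = v from hw2]; exact h.2.1)
    | cons g' B =>
      obtain ⟨hg1, hg2⟩ := hw2
      rw [List.concat_eq_append] at *
      obtain ⟨y, hy1, hy2⟩ := D.G.isPath_append_iff.1 hx1
      obtain ⟨rfl, hy3⟩ := hy2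
      replace hy3 : D.G.tgt g = D.G.src e := hy3
      have hg : D.IsAuxV (D.G.tgt g) := hy3 ▸ hs
      have hA : D.Seg u A (D.G.src g) := ⟨h.1, fun hx => hD.aux_ends g hx hg, hy1⟩
      have hte : D.IsAuxV (D.G.tgt (D.G.inv e)) := by rw [D.G.tgt_inv]; exact hs
      have e1 : A ++ [g] ++ [e, D.G.inv e] ++ g' :: B =
          A ++ (g :: e :: (D.G.inv e :: g' :: B)) := by simp
      have e2 : A ++ [g] ++ g' :: B = A ++ (g :: g' :: B) := by simp
      rw [e1, e2, geod, geod, retract_append hD hA, retract_append hD hA, D.retract_aux hg,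
        D.retract_aux hte, D.retract_aux hg, ← List.append_assoc (D.piece g e)]
      exact D.G.nf_congr rfl (D.G.nf_congr (nf_piece_append hD hg hy3.symm (by rw [hg1, hy3])) rfl)
  · have hA : D.Seg u A (D.G.src e) := ⟨h.1, hs, hx1⟩
    rw [List.append_assoc, geod, geod, retract_append hD hA, retract_append hD hA]
    by_cases ht : D.IsAuxV (D.G.tgt e)
    · rw [show [e, D.G.inv e] ++ B = e :: D.G.inv e :: B from rfl, D.retract_aux ht]
      simp [piece]
    · have he : ¬ D.IsAux e := fun h => h.elim hs ht
      rw [show [e, D.G.inv e] ++ B = e :: D.G.inv e :: B from rfl, D.retract_edge he,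
        D.retract_edge (fun h => he (D.isAux_inv.1 h))]
      have := D.G.red_cancel D.G.true_inv (e := e) trivial (D.retract A) (D.retract B)
      simpa [SerreGraph.nf] using this

/-- The geodesic is invariant under homotopy in `𝒢²`: the attaching path of a Nielsen face retracts
to the pre-INP of the auxiliary edge. -/
theorem PathHtpy2.geod_eq {D : TrackData} (hD : IsTrackMap D) {u v : D.G.V} (hu : ¬ D.IsAuxV u)
    (hv : ¬ D.IsAuxV v) {l l' : List D.G.E} (h : D.G.PathHomotopic D.Rule u v l l') :
    D.geod l = D.geod l' := by
  induction h with
  | rel l l' h =>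
    obtain ⟨h1, h2, A, s, t, B, hR, rfl, rfl⟩ := h
    rcases hR with ⟨e, rfl, rfl⟩ | ⟨h, h', ha, rfl, rfl⟩
    · rw [geod_cancel hD ⟨hu, hv, h1⟩]; simp
    · obtain ⟨w, hw1, hw2⟩ := D.G.isPath_append_iff.1 h1
      obtain ⟨x, hx1, hx2⟩ := D.G.isPath_append_iff.1 hw1
      obtain rfl : D.G.src h = x := hx2.1
      have hA : D.Seg u A (D.G.src h) := ⟨hu, (ha.seg hD).1, hx1⟩
      rw [List.append_assoc, List.append_assoc]
      refine geod_congr hD hA hA rfl (geod_congr hD (ha.seg hD) (ha.eta_seg hD) ?_ rfl)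
      rw [ha.geod_pair hD, geod, ha.retract_eta hD, D.G.nf_eq_self (hD.retr_aux h h' ha).1]
  | refl => rfl
  | symm _ _ _ ih => exact ih.symm
  | trans _ _ _ _ _ ih1 ih2 => exact ih1.trans ih2

theorem pathHomotopic_retract {D : TrackData} (hD : IsTrackMap D) {u v : D.G.V} {l : List D.G.E}
    (hl : D.Seg u l v) : D.G.PathHomotopic D.Rule u v l (D.retract l) := by
  have hpair : ∀ h h', D.IsAuxEdge h h' →
      D.G.PathHomotopic D.Rule (D.G.src h) (D.G.tgt h') [h, h'] (D.retr [h, h']) := by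
    intro h h' ha
    have hone : ∀ {u v : D.G.V} {l : List D.G.E}, D.Seg u l v →
        D.G.PathHomotopic D.Rule u v l (D.rhat l) := by
      intro u v l hl
      induction hl using Seg.induction hD with
      | nil => exact .refl _ _ _ _ _
      | edge e l he hs ih =>
        rw [D.rhat_edge he]
        simpa using ih.append (A := [e]) (B := []) (D.G.isPath_singleton e) rfl
      | aux h h' l hh hh' hs hs' ih =>
        have h1 : D.G.PathHomotopic D.Rule (D.G.src h) v (h :: h' :: l) (h :: h' :: D.rhat l) := by
          simpa using ih.append (A := [h, h']) (B := []) hs.2.2 rfl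
        refine h1.trans ?_
        have h2 := (hs'.rhat hD).2.2
        have h3 := D.G.isPath_append hs.2.2 h2
        by_cases hb : h' = D.G.inv h
        · subst hb
          rw [D.rhat_back hh]
          rw [D.G.tgt_inv] at h2
          exact .rel _ _ ⟨h3, h2, [], _, [], D.rhat l, Or.inl ⟨h, rfl, rfl⟩, by simp, by simp⟩
        · have ha : D.IsAuxEdge h h' := ⟨hh, hh', hb⟩
          rw [D.rhat_auxEdge ha]
          exact .rel _ _ ⟨h3, D.G.isPath_append (ha.eta_seg hD).2.2 h2, [], _, _, D.rhat l,
            Or.inr ⟨h, h', ha, rfl, rfl⟩, by simp, by simp⟩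
    rw [retr]
    generalize D.depth = n
    induction n with
    | zero => exact .refl _ _ _ _ _
    | succ n ih =>
      rw [Function.iterate_succ_apply']
      exact ih.trans (hone ((ha.seg hD).rhat_iterate hD n))
  induction hl using Seg.induction hD with
  | nil => exact .refl _ _ _ _ _
  | edge e l he hs ih =>
    rw [D.retract_edge he]
    simpa using ih.append (A := [e]) (B := []) (D.G.isPath_singleton e) rfl
  | aux h h' l hh hh' hs hs' ih =>
    have h1 : D.G.PathHomotopic D.Rule (D.G.src h) v (h :: h' :: l) (h :: h' :: D.retract l) := by
      simpa using ih.append (A := [h, h']) (B := []) hs.2.2 rfl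
    refine h1.trans ?_
    have h2 := (hs'.retract hD).2.2
    rw [D.retract_aux hh, piece]
    split_ifs with hb
    · subst hb
      have h3 := D.G.isPath_append hs.2.2 h2
      rw [D.G.tgt_inv] at h2
      exact .rel _ _ ⟨h3, h2, [], _, [], D.retract l, Or.inl ⟨h, rfl, rfl⟩, by simp, by simp⟩
    · simpa using (hpair h h' ⟨hh, hh', hb⟩).append (A := []) rfl h2

/-- Paths of `𝒢¹` are homotopic rel endpoints in `𝒢²` if and only if they have the same
geodesic in `Γ`. -/
theorem pathHomotopic_iff_geod {D : TrackData} (hD : IsTrackMap D) {u v : D.G.V}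
    {l l' : List D.G.E} (hl : D.Seg u l v) (hl' : D.Seg u l' v) :
    D.G.PathHomotopic D.Rule u v l l' ↔ D.geod l = D.geod l' := by
  refine ⟨PathHtpy2.geod_eq hD hl.1 hl.2.1, fun h => ?_⟩
  have key : ∀ l, D.Seg u l v → D.G.PathHomotopic D.Rule u v l (D.geod l) := fun l hl =>
    (pathHomotopic_retract hD hl).trans
      (D.G.pathHomotopic_red (fun e _ => Or.inl ⟨e, rfl, rfl⟩) (hl.retract hD).2.2)
  exact (key l hl).trans (h ▸ (key l' hl').symm)

theorem htpy2_of_geod {D : TrackData} (hD : IsTrackMap D) {u v : D.G.V}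
    {l l' : List D.G.E} (hl : D.Seg u l v) (hl' : D.Seg u l' v) (h : D.geod l = D.geod l') :
    D.Htpy2 l l' :=
  D.G.homotopic_iff.2 ⟨u, v, hl.2.2, hl'.2.2, (pathHomotopic_iff_geod hD hl hl').2 h⟩

theorem geod_of_htpy2 {D : TrackData} (hD : IsTrackMap D) {u v : D.G.V}
    {l l' : List D.G.E} (hl : D.Seg u l v) (hne : l ≠ []) (h : D.Htpy2 l l') :
    D.Seg u l' v ∧ D.geod l = D.geod l' := by
  obtain ⟨u', v', h1, h2, H⟩ := D.G.homotopic_iff.1 h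
  obtain rfl := hl.2.2.src_unique h1 hne
  obtain rfl := hl.2.2.end_unique h1
  exact ⟨⟨hl.1, hl.2.1, h2⟩, PathHtpy2.geod_eq hD hl.1 hl.2.1 H⟩

end TrackData

/-! ### Images of paths -/

namespace SerreGraph

theorem Homotopic.pathHomotopic {G : SerreGraph} {R : List G.E → List G.E → Prop} {u v : G.V}
    {l l' : List G.E} (h : G.Homotopic R l l') (hl : G.IsPath u l v) (hl' : G.IsPath u l' v) :
    G.PathHomotopic R u v l l' := by
  obtain ⟨u', v', h1, h2, H⟩ := G.homotopic_iff.1 h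
  by_cases hne : l = []
  · by_cases hne' : l' = []
    · subst hne; subst hne'; exact .refl _ _ _ _ _
    · obtain rfl := hl'.src_unique h2 hne'
      obtain rfl := hl'.end_unique h2
      exact H
  · obtain rfl := hl.src_unique h1 hne
    obtain rfl := hl.end_unique h1
    exact H

/-- Replacing the continuation of a reduced path by one with the same first edge. -/
theorem reduced_append_cons (G : SerreGraph) {A B C : List G.E} {x : G.E}
    (h : G.Reduced (A ++ x :: B)) (h' : G.Reduced (x :: C)) : G.Reduced (A ++ x :: C) := by
  rw [reduced_append_iff] at *
  exact ⟨h.1, h', fun y hy z hz => h.2.2 y hy z (by simpa using hz)⟩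

end SerreGraph

theorem List.infix_append_cases {α : Type*} {m A B : List α} (h : m <:+: A ++ B) :
    m <:+: A ∨ m <:+: B ∨ ∃ m₁ m₂, m = m₁ ++ m₂ ∧ m₁ <:+ A ∧ m₂ <+: B := by
  obtain ⟨s, t, h⟩ := h
  rw [List.append_assoc, List.append_eq_append_iff] at h
  rcases h with ⟨a, h1, h2⟩ | ⟨a, h1, h2⟩
  · rw [List.append_eq_append_iff] at h2
    rcases h2 with ⟨b, h3, h4⟩ | ⟨b, h3, h4⟩
    · exact Or.inl ⟨s, b, by rw [h1, h3, List.append_assoc]⟩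
    · exact Or.inr (Or.inr ⟨a, b, h3, ⟨s, h1.symm⟩, ⟨t, h4.symm⟩⟩)
  · exact Or.inr (Or.inl ⟨a, t, by rw [h2, List.append_assoc]⟩)

namespace TrackData

theorem map_append (D : TrackData) (A B : List D.G.E) : D.map (A ++ B) = D.map A ++ D.map B := by
  simp [map]

theorem map_iterate_append (D : TrackData) (n : ℕ) (A B : List D.G.E) :
    D.map^[n] (A ++ B) = D.map^[n] A ++ D.map^[n] B := by
  induction n with
  | zero => rfl
  | succ n ih => simp only [Function.iterate_succ_apply', ih, map_append]

theorem map_iterate_nil (D : TrackData) (n : ℕ) : D.map^[n] [] = [] :=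
  Function.iterate_fixed rfl n

theorem map_rev {D : TrackData} (hD : IsTrackMap D) (l : List D.G.E) :
    D.map (D.G.rev l) = D.G.rev (D.map l) := by
  induction l with
  | nil => rfl
  | cons e l ih =>
    rw [D.G.rev_cons, map_append, ih, show e :: l = [e] ++ l from rfl, map_append, D.G.rev_append]
    simp [map, hD.map_inv]

theorem map_iterate_rev {D : TrackData} (hD : IsTrackMap D) (n : ℕ) (l : List D.G.E) :
    D.map^[n] (D.G.rev l) = D.G.rev (D.map^[n] l) := by
  induction n with
  | zero => rfl
  | succ n ih => rw [Function.iterate_succ_apply', ih, map_rev hD, Function.iterate_succ_apply']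

theorem isPath_map {D : TrackData} (hD : IsTrackMap D) {u v : D.G.V} {l : List D.G.E}
    (h : D.G.IsPath u l v) : D.G.IsPath (D.fV u) (D.map l) (D.fV v) := by
  induction l generalizing u with
  | nil => exact congrArg _ h
  | cons e l ih =>
    rw [show e :: l = [e] ++ l from rfl, map_append]
    refine D.G.isPath_append (v := D.fV (D.G.tgt e)) ?_ (ih h.2)
    have := hD.map_isPath e
    rw [h.1] at this
    simpa [map] using this

theorem isPath_map_iterate {D : TrackData} (hD : IsTrackMap D) {u v : D.G.V} {l : List D.G.E}
    (h : D.G.IsPath u l v) (n : ℕ) : D.G.IsPath (D.fV^[n] u) (D.map^[n] l) (D.fV^[n] v) := by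
  induction n with
  | zero => exact h
  | succ n ih => simp only [Function.iterate_succ_apply']; exact isPath_map hD ih

theorem Seg.map {D : TrackData} (hD : IsTrackMap D) {u v : D.G.V} {l : List D.G.E}
    (h : D.Seg u l v) : D.Seg (D.fV u) (D.map l) (D.fV v) :=
  ⟨hD.map_vertex _ h.1, hD.map_vertex _ h.2.1, isPath_map hD h.2.2⟩

theorem Seg.map_iterate {D : TrackData} (hD : IsTrackMap D) {u v : D.G.V} {l : List D.G.E}
    (h : D.Seg u l v) (n : ℕ) : D.Seg (D.fV^[n] u) (D.map^[n] l) (D.fV^[n] v) := by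
  induction n with
  | zero => exact h
  | succ n ih => simp only [Function.iterate_succ_apply']; exact ih.map hD

theorem InX.map {D : TrackData} (hD : IsTrackMap D) {l : List D.G.E} (h : D.InX l) :
    D.InX (D.map l) := by
  intro e he
  obtain ⟨x, hx, hex⟩ := List.mem_flatMap.1 he
  exact hD.map_rel x (h x hx) e hex

theorem InX.map_iterate {D : TrackData} (hD : IsTrackMap D) {l : List D.G.E} (h : D.InX l)
    (n : ℕ) : D.InX (D.map^[n] l) := by
  induction n with
  | zero => exact h
  | succ n ih => rw [Function.iterate_succ_apply']; exact ih.map hD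

theorem InX.append {D : TrackData} {l l' : List D.G.E} (h : D.InX l) (h' : D.InX l') :
    D.InX (l ++ l') := fun e he => (List.mem_append.1 he).elim (h e) (h' e)

theorem InX.rev {D : TrackData} (hD : IsTrackMap D) {l : List D.G.E} (h : D.InX l) :
    D.InX (D.G.rev l) := by
  intro e he
  have := hD.rel_inv _ (h _ (D.G.mem_rev.1 he))
  rwa [D.G.inv_inv] at this

theorem InX.subset {D : TrackData} {l l' : List D.G.E} (h : D.InX l) (h' : l' ⊆ l) :
    D.InX l' := fun e he => h e (h' he)

theorem red_map_red {D : TrackData} (hD : IsTrackMap D) {p : D.G.E → Prop}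
    (hp : ∀ e, p e → p (D.G.inv e)) (hf : ∀ e, p e → ∀ x ∈ D.fE e, p x) (l : List D.G.E) :
    D.G.red p (D.map (D.G.red p l)) = D.G.red p (D.map l) := by
  induction l with
  | nil => rfl
  | cons e l ih =>
    have h1 : D.G.red p (D.map (e :: l)) = D.G.red p (D.map (e :: D.G.red p l)) := by
      rw [show e :: l = [e] ++ l from rfl, map_append,
        show e :: D.G.red p l = [e] ++ D.G.red p l from rfl, map_append]
      exact D.G.red_congr hp rfl ih.symm
    rw [h1, D.G.red_cons]
    cases D.G.red p l with
    | nil => rfl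
    | cons x t =>
      by_cases hx : p e ∧ x = D.G.inv e
      · obtain ⟨he, rfl⟩ := hx
        simp only [SerreGraph.push, he, and_self, if_true]
        rw [show e :: D.G.inv e :: t = [e, D.G.inv e] ++ t from rfl, map_append]
        have : D.G.red p (D.map [e, D.G.inv e]) = D.G.red p [] := by
          have := D.G.red_append_rev hp (hf e he)
          simpa [map, hD.map_inv] using this
        rw [D.G.red_congr hp this rfl]; rfl
      · simp only [SerreGraph.push, hx, if_false]

/-- Cancel all backtracking in the relative part. -/
noncomputable def xred (D : TrackData) (l : List D.G.E) : List D.G.E := D.G.red D.IsRel l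

theorem xred_congr {D : TrackData} (hD : IsTrackMap D) {A A' B B' : List D.G.E}
    (hA : D.xred A = D.xred A') (hB : D.xred B = D.xred B') :
    D.xred (A ++ B) = D.xred (A' ++ B') := D.G.red_congr hD.rel_inv hA hB

theorem xred_xred (D : TrackData) (l : List D.G.E) : D.xred (D.xred l) = D.xred l :=
  D.G.red_red _ l

theorem xred_of_reduced (D : TrackData) {l : List D.G.E} (hl : D.G.Reduced l) : D.xred l = l :=
  D.G.red_eq_self (hl.redOn _)

theorem xred_rev {D : TrackData} (hD : IsTrackMap D) (l : List D.G.E) :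
    D.xred (D.G.rev l) = D.G.rev (D.xred l) := D.G.red_rev hD.rel_inv l

theorem nf_xred (D : TrackData) (l : List D.G.E) : D.G.nf (D.xred l) = D.G.nf l := by
  induction l with
  | nil => rfl
  | cons e l ih =>
    rw [xred, D.G.red_cons, show e :: l = [e] ++ l from rfl, ← D.G.nf_append_nf [e] l, ← ih,
      D.G.nf_append_nf, xred]
    cases D.G.red D.IsRel l with
    | nil => rfl
    | cons x t =>
      by_cases hx : D.IsRel e ∧ x = D.G.inv e
      · obtain ⟨he, rfl⟩ := hx
        simp only [SerreGraph.push, he, and_self, if_true]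
        exact (D.G.red_cancel D.G.true_inv (e := e) trivial [] t).symm
      · simp only [SerreGraph.push, hx, if_false]; rfl

theorem xred_map_iterate_xred {D : TrackData} (hD : IsTrackMap D) (n : ℕ) (l : List D.G.E) :
    D.xred (D.map^[n] (D.xred l)) = D.xred (D.map^[n] l) := by
  induction n with
  | zero => exact D.xred_xred l
  | succ n ih =>
    rw [Function.iterate_succ_apply', Function.iterate_succ_apply']
    have h := fun l => red_map_red hD (p := D.IsRel) hD.rel_inv hD.map_rel l
    simp only [xred] at *
    rw [← h, ih, h]

theorem nf_map_iterate_nf {D : TrackData} (hD : IsTrackMap D) (n : ℕ) (l : List D.G.E) :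
    D.G.nf (D.map^[n] (D.G.nf l)) = D.G.nf (D.map^[n] l) := by
  induction n with
  | zero => exact D.G.nf_nf l
  | succ n ih =>
    rw [Function.iterate_succ_apply', Function.iterate_succ_apply']
    have h := fun l => red_map_red hD (p := fun _ => True) D.G.true_inv (fun _ _ _ _ => trivial) l
    simp only [SerreGraph.nf] at *
    rw [← h, ih, h]

theorem Seg.xred {D : TrackData} {u v : D.G.V} {l : List D.G.E} (h : D.Seg u l v) :
    D.Seg u (D.xred l) v := ⟨h.1, h.2.1, h.2.2.red⟩

theorem InX.xred {D : TrackData} {l : List D.G.E} (h : D.InX l) : D.InX (D.xred l) :=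
  fun e he => h e (D.G.mem_of_mem_red he)

theorem geod_xred {D : TrackData} (hD : IsTrackMap D) {u v : D.G.V} {l : List D.G.E}
    (h : D.Seg u l v) : D.geod (D.xred l) = D.geod l :=
  (PathHtpy2.geod_eq hD h.1 h.2.1
    (D.G.pathHomotopic_red (fun e _ => Or.inl ⟨e, rfl, rfl⟩) h.2.2)).symm

theorem geod_nf {D : TrackData} (hD : IsTrackMap D) {u v : D.G.V} {l : List D.G.E}
    (h : D.Seg u l v) : D.geod (D.G.nf l) = D.geod l :=
  (PathHtpy2.geod_eq hD h.1 h.2.1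
    (D.G.pathHomotopic_red (fun e _ => Or.inl ⟨e, rfl, rfl⟩) h.2.2)).symm

theorem geod_eq_of_nf_eq {D : TrackData} (hD : IsTrackMap D) {u v u' v' : D.G.V} {l l' : List D.G.E}
    (h : D.Seg u l v) (h' : D.Seg u' l' v') (hn : D.G.nf l = D.G.nf l') :
    D.geod l = D.geod l' := by
  rw [← geod_nf hD h, ← geod_nf hD h', hn]

theorem pathHomotopic_map {D : TrackData} (hD : IsTrackMap D) {u v : D.G.V} {l l' : List D.G.E}
    (h : D.G.PathHomotopic D.Rule u v l l') :
    D.G.PathHomotopic D.Rule (D.fV u) (D.fV v) (D.map l) (D.map l') := by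
  induction h with
  | rel l l' h =>
    obtain ⟨h1, h2, A, s, t, B, hR, rfl, rfl⟩ := h
    obtain ⟨w, hw1, hw2⟩ := D.G.isPath_append_iff.1 h1
    obtain ⟨x, hx1, hx2⟩ := D.G.isPath_append_iff.1 hw1
    rw [map_append, map_append, map_append, map_append]
    refine SerreGraph.PathHomotopic.append (isPath_map hD hx1) ?_ (isPath_map hD hw2)
    rcases hR with ⟨e, rfl, rfl⟩ | ⟨h, h', ha, rfl, rfl⟩
    · have h3 : D.G.red (fun _ => True) (D.map [e, D.G.inv e]) = [] := by
        have := D.G.nf_append_rev (D.fE e)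
        simpa [map, hD.map_inv, SerreGraph.nf] using this
      have := D.G.pathHomotopic_red (R := D.Rule) (p := fun _ => True)
        (fun e _ => Or.inl ⟨e, rfl, rfl⟩) (isPath_map hD hx2)
      rwa [h3] at this
    · obtain rfl : D.G.src h = x := hx2.1
      obtain rfl : D.G.tgt h' = w := hx2.2.2
      exact (hD.map_face h h' ha).pathHomotopic (isPath_map hD hx2)
        (isPath_map hD (hD.eta_isPath h h' ha))
  | refl => exact .refl _ _ _ _ _
  | symm _ _ _ ih => exact ih.symm
  | trans _ _ _ _ _ ih1 ih2 => exact ih1.trans ih2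

theorem geod_map_iterate {D : TrackData} (hD : IsTrackMap D) {u v : D.G.V} {l l' : List D.G.E}
    (hl : D.Seg u l v) (hl' : D.Seg u l' v) (h : D.geod l = D.geod l') (n : ℕ) :
    D.geod (D.map^[n] l) = D.geod (D.map^[n] l') := by
  have key : D.G.PathHomotopic D.Rule (D.fV^[n] u) (D.fV^[n] v) (D.map^[n] l) (D.map^[n] l') := by
    induction n with
    | zero => exact (pathHomotopic_iff_geod hD hl hl').2 h
    | succ n ih => simp only [Function.iterate_succ_apply']; exact pathHomotopic_map hD ih
  exact PathHtpy2.geod_eq hD (hl.map_iterate hD n).1 (hl.map_iterate hD n).2.1 key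

/-! ### Relative length -/

open Classical in
/-- Number of edges of the train track part on a path. -/
noncomputable def cnt (D : TrackData) (l : List D.G.E) : ℕ :=
  l.countP (fun e => decide (¬ D.IsRel e))

@[simp] theorem cnt_nil (D : TrackData) : D.cnt [] = 0 := rfl

theorem cnt_append (D : TrackData) (A B : List D.G.E) : D.cnt (A ++ B) = D.cnt A + D.cnt B := by
  simp [cnt]

theorem cnt_cons_of_rel (D : TrackData) {e : D.G.E} (he : D.IsRel e) (l : List D.G.E) :
    D.cnt (e :: l) = D.cnt l := by
  simp [cnt, he]

theorem cnt_cons_of_not_rel (D : TrackData) {e : D.G.E} (he : ¬ D.IsRel e) (l : List D.G.E) :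
    D.cnt (e :: l) = D.cnt l + 1 := by
  simp [cnt, he]

theorem cnt_eq_zero (D : TrackData) {l : List D.G.E} : D.cnt l = 0 ↔ D.InX l := by
  simp [cnt, List.countP_eq_zero, InX]

theorem cnt_le_length (D : TrackData) (l : List D.G.E) : D.cnt l ≤ l.length :=
  List.countP_le_length

theorem cnt_le_of_prefix {D : TrackData} {A B : List D.G.E} (h : A <+: B) : D.cnt A ≤ D.cnt B := by
  obtain ⟨C, rfl⟩ := h
  rw [cnt_append]; omega

theorem rel_inv_iff {D : TrackData} (hD : IsTrackMap D) {e : D.G.E} :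
    D.IsRel (D.G.inv e) ↔ D.IsRel e :=
  ⟨fun h => by have := hD.rel_inv _ h; rwa [D.G.inv_inv] at this, hD.rel_inv e⟩

theorem cnt_rev {D : TrackData} (hD : IsTrackMap D) (l : List D.G.E) :
    D.cnt (D.G.rev l) = D.cnt l := by
  induction l with
  | nil => rfl
  | cons e l ih =>
    rw [D.G.rev_cons, cnt_append, ih]
    by_cases he : D.IsRel e
    · rw [D.cnt_cons_of_rel he, D.cnt_cons_of_rel (hD.rel_inv _ he)]; rfl
    · rw [D.cnt_cons_of_not_rel he, D.cnt_cons_of_not_rel (fun h => he ((rel_inv_iff hD).1 h))]; rfl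

theorem cnt_xred {D : TrackData} (hD : IsTrackMap D) (l : List D.G.E) :
    D.cnt (D.xred l) = D.cnt l := by
  induction l with
  | nil => rfl
  | cons e l ih =>
    have h1 : D.cnt (e :: l) = D.cnt (e :: D.xred l) := by
      rw [show e :: l = [e] ++ l from rfl, show e :: D.xred l = [e] ++ D.xred l from rfl,
        cnt_append, cnt_append, ih]
    rw [h1, xred, xred, D.G.red_cons]
    cases D.G.red D.IsRel l with
    | nil => rfl
    | cons x t =>
      by_cases hx : D.IsRel e ∧ x = D.G.inv e
      · obtain ⟨he, rfl⟩ := hx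
        simp only [SerreGraph.push, he, and_self, if_true]
        rw [D.cnt_cons_of_rel he, D.cnt_cons_of_rel (hD.rel_inv _ he)]
      · simp only [SerreGraph.push, hx, if_false]

/-! ### Legal paths -/

theorem htpy2_rev_append {D : TrackData} {u v w : D.G.V} {A B x : List D.G.E}
    (hA : D.G.IsPath u A w) (hx : D.G.IsPath u x v)
    (h : D.G.PathHomotopic D.Rule u v (A ++ B) x) : D.G.PathHomotopic D.Rule w v B
      (D.G.rev A ++ x) := by
  have hB : D.G.IsPath w B v := by
    obtain ⟨w', h1, h2⟩ := D.G.isPath_append_iff.1 (h.isPath_iff.2 hx)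
    rwa [hA.end_unique h1]
  have h1 := h.append (A := D.G.rev A) (B := []) hA.rev rfl
  have h2 := D.G.pathHomotopic_red (R := D.Rule) (p := fun _ => True)
        (fun e _ => Or.inl ⟨e, rfl, rfl⟩) (D.G.isPath_append hA.rev hA)
  rw [show D.G.red (fun _ => True) (D.G.rev A ++ A) = [] from D.G.nf_rev_append A] at h2
  have h3 := h2.append (A := []) (B := B) rfl hB
  simp only [List.nil_append, List.append_nil, List.append_assoc] at h1 h3
  exact h3.symm.trans h1

theorem htpy2_append_rev {D : TrackData} {u v w : D.G.V} {A B x : List D.G.E}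
    (hB : D.G.IsPath w B v) (hA : D.G.IsPath u A w)
    (h : D.G.PathHomotopic D.Rule u v (A ++ B) x) : D.G.PathHomotopic D.Rule u w A
      (x ++ D.G.rev B) := by
  have h1 := h.append (A := []) (B := D.G.rev B) rfl hB.rev
  have h2 := D.G.pathHomotopic_red (R := D.Rule) (p := fun _ => True)
        (fun e _ => Or.inl ⟨e, rfl, rfl⟩) (D.G.isPath_append hB hB.rev)
  rw [show D.G.red (fun _ => True) (B ++ D.G.rev B) = [] from D.G.nf_append_rev B] at h2
  have h3 := h2.append (A := A) (B := []) hA rfl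
  simp only [List.nil_append, List.append_nil, List.append_assoc] at h1 h3
  exact h3.symm.trans h1

/-- Being relatively reduced is invariant under homotopy within `X`. A subpath which is cut off in
the middle of `e e⁻¹` is completed, or shortened, by an edge of `X`. -/
theorem relReduced_cancel {D : TrackData} (hD : IsTrackMap D) {u v : D.G.V} {A B : List D.G.E}
    {e : D.G.E} (he : D.IsRel e) (hp : D.G.IsPath u (A ++ [e, D.G.inv e] ++ B) v) :
    D.RelReduced (A ++ [e, D.G.inv e] ++ B) ↔ D.RelReduced (A ++ B) := by
  obtain ⟨w, hw1, hw2⟩ := D.G.isPath_append_iff.1 hp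
  obtain ⟨x, hx1, hx2⟩ := D.G.isPath_append_iff.1 hw1
  obtain ⟨hx3, -, hx4⟩ := hx2
  rw [D.G.tgt_inv] at hx4
  obtain rfl : D.G.src e = w := hx4
  subst hx3
  have hee : D.G.IsPath (D.G.src e) [e, D.G.inv e] (D.G.src e) := ⟨rfl, rfl, D.G.tgt_inv e⟩
  have hcan : D.G.PathHomotopic D.Rule (D.G.src e) (D.G.src e) [e, D.G.inv e] [] :=
    .rel _ _ ⟨hee, rfl, [], _, _, [], Or.inl ⟨e, rfl, rfl⟩, by simp, by simp⟩
  have hsuf : ∀ {A₂ : List D.G.E}, A₂ <:+ A → ∃ y, D.G.IsPath y A₂ (D.G.src e) := by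
    rintro A₂ ⟨A₁, rfl⟩
    obtain ⟨y, -, hy⟩ := D.G.isPath_append_iff.1 hx1
    exact ⟨y, hy⟩
  have hpre : ∀ {B₁ : List D.G.E}, B₁ <+: B → ∃ y, D.G.IsPath (D.G.src e) B₁ y := by
    rintro B₁ ⟨B₂, rfl⟩
    obtain ⟨y, hy, -⟩ := D.G.isPath_append_iff.1 hw2
    exact ⟨y, hy⟩
  have hspan : ∀ {A₂ B₁ : List D.G.E}, A₂ <:+ A → B₁ <+: B → ∃ y z,
      D.G.IsPath y (A₂ ++ [e, D.G.inv e] ++ B₁) z ∧ D.G.IsPath y (A₂ ++ B₁) z ∧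
      D.G.PathHomotopic D.Rule y z (A₂ ++ [e, D.G.inv e] ++ B₁) (A₂ ++ B₁) := by
    intro A₂ B₁ h1 h2
    obtain ⟨y, hy⟩ := hsuf h1
    obtain ⟨z, hz⟩ := hpre h2
    refine ⟨y, z, D.G.isPath_append (D.G.isPath_append hy hee) hz, D.G.isPath_append hy hz, ?_⟩
    simpa using hcan.append hy hz
  constructor
  · intro h m x hm hx hmx
    rcases List.infix_append_cases hm with hm | hm | ⟨A₂, B₁, rfl, hA, hB⟩
    · exact h m x (hm.trans ⟨[], [e, D.G.inv e] ++ B, by simp⟩) hx hmx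
    · exact h m x (hm.trans ⟨A ++ [e, D.G.inv e], [], by simp⟩) hx hmx
    · obtain ⟨y, z, h1, h2, h3⟩ := hspan hA hB
      by_cases hne : A₂ ++ B₁ = []
      · rw [hne]; intro e he; simp at he
      have h4 : D.InX (A₂ ++ [e, D.G.inv e] ++ B₁) := by
        refine h _ x ?_ hx ?_
        · obtain ⟨A₁, rfl⟩ := hA
          obtain ⟨B₂, rfl⟩ := hB
          exact ⟨A₁, B₂, by simp⟩
        · obtain ⟨y', z', h5, h6, h7⟩ := D.G.homotopic_iff.1 hmx
          obtain rfl := h5.src_unique h2 hne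
          obtain rfl := h5.end_unique h2
          exact D.G.homotopic_iff.2 ⟨y', z', h1, h6, h3.trans h7⟩
      exact h4.subset (by intro a ha; simp at ha ⊢; tauto)
  · intro h m x hm hx hmx
    obtain ⟨p, q, hm1, hx1', hH⟩ := D.G.homotopic_iff.1 hmx
    rw [List.append_assoc] at hm
    have hAB : A <:+: A ++ B := ⟨[], B, by simp⟩
    have hBA : B <:+: A ++ B := ⟨A, [], by simp⟩
    have hei := hD.rel_inv _ he
    -- the subpath starts in `A` (or right after it) and contains an initial piece of the rest
    have hstart : ∀ A₂ B₁, m = A₂ ++ B₁ → A₂ <:+ A → B₁ <+: [e, D.G.inv e] ++ B → D.InX m := by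
      rintro A₂ B₁ rfl hA hB
      match B₁, hB with
      | [], _ =>
        rw [List.append_nil] at *
        exact h _ x (hA.isInfix.trans hAB) hx hmx
      | [b], hB =>
        obtain rfl : b = e := by obtain ⟨t, ht⟩ := hB; simp at ht; exact ht.1
        obtain ⟨y, hy1, hy2⟩ := D.G.isPath_append_iff.1 hm1
        have := htpy2_append_rev hy2 hy1 hH
        refine InX.append (h A₂ (x ++ D.G.rev [b]) (hA.isInfix.trans hAB)
          (hx.append (InX.rev hD (by simpa [InX] using he)))
          (D.G.homotopic_iff.2 ⟨p, y, hy1, this.isPath_iff.1 hy1, this⟩)) (by simpa [InX] using he)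
      | b :: b' :: B₂, hB =>
        obtain ⟨t, ht⟩ := hB
        simp at ht
        obtain ⟨rfl, rfl, ht⟩ := ht
        have hB2 : B₂ <+: B := ⟨t, ht⟩
        obtain ⟨y, z, h1, h2, h3⟩ := hspan hA hB2
        have h1' : D.G.IsPath y (A₂ ++ b :: D.G.inv b :: B₂) z := by simpa using h1
        obtain rfl := h1'.src_unique hm1 (by simp)
        obtain rfl := h1'.end_unique hm1
        have h4 : D.InX (A₂ ++ B₂) := by
          refine h _ x ?_ hx (D.G.homotopic_iff.2 ⟨_, _, h2, hx1', ?_⟩)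
          · obtain ⟨A₁, rfl⟩ := hA
            subst ht
            exact ⟨A₁, t, by simp⟩
          · refine h3.symm.trans ?_
            simpa using hH
        intro a ha
        simp at ha
        rcases ha with ha | rfl | rfl | ha
        · exact h4 _ (by simp [ha])
        · exact he
        · exact hei
        · exact h4 _ (by simp [ha])
    rcases List.infix_append_cases hm with hm | hm | ⟨A₂, B₁, hm, hA, hB⟩
    · exact h m x (hm.trans hAB) hx hmx
    · rcases List.infix_cons_iff.1 hm with hm | hm
      · exact hstart [] m rfl (List.nil_suffix) hm
      · rcases List.infix_cons_iff.1 hm with hm | hm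
        · match m, hm with
          | [], _ => intro a ha; simp at ha
          | b :: B₁, hm =>
            obtain ⟨t, ht⟩ := hm
            simp at ht
            obtain ⟨rfl, ht⟩ := ht
            have hB1 : B₁ <+: B := ⟨t, ht⟩
            have hy1 : D.G.IsPath p [D.G.inv e] (D.G.tgt (D.G.inv e)) := ⟨hm1.1, rfl⟩
            have := htpy2_rev_append hy1 hx1' (B := B₁) hH
            have h5 := h B₁ _ (hB1.isInfix.trans hBA)
              ((InX.rev hD (by simpa [InX] using hei)).append hx)
              (D.G.homotopic_iff.2 ⟨_, _, hm1.2, this.isPath_iff.1 hm1.2, this⟩)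
            intro a ha
            rcases List.mem_cons.1 ha with rfl | ha
            exacts [hei, h5 a ha]
        · exact h m x (hm.trans hBA) hx hmx
    · exact hstart A₂ B₁ hm hA hB

theorem relReduced_xred {D : TrackData} (hD : IsTrackMap D) {u v : D.G.V} {l : List D.G.E}
    (hl : D.G.IsPath u l v) : D.RelReduced (D.xred l) ↔ D.RelReduced l := by
  have H := D.G.pathHomotopic_red (R := D.CancelX) (p := D.IsRel)
    (fun e he => ⟨e, he, rfl, rfl⟩) hl
  have : ∀ l l', D.G.PathHomotopic D.CancelX u v l l' → (D.RelReduced l' ↔ D.RelReduced l) := by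
    intro l l' H
    induction H with
    | rel l l' h =>
      obtain ⟨h1, h2, A, s, t, B, ⟨e, he, rfl, rfl⟩, rfl, rfl⟩ := h
      rw [relReduced_cancel hD he h1]; simp
    | refl => rfl
    | symm _ _ _ ih => exact ih.symm
    | trans _ _ _ _ _ ih1 ih2 => exact ih2.trans ih1
  exact this _ _ H

theorem RelReduced.infix {D : TrackData} {l m : List D.G.E} (h : D.RelReduced l)
    (hm : m <:+: l) : D.RelReduced m := fun m' x hm' => h m' x (hm'.trans hm)

theorem map_iterate_infix {D : TrackData} {l m : List D.G.E} (hm : m <:+: l) (n : ℕ) :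
    D.map^[n] m <:+: D.map^[n] l := by
  obtain ⟨A, B, rfl⟩ := hm
  rw [map_iterate_append, map_iterate_append]
  exact ⟨_, _, rfl⟩

theorem Legal.infix {D : TrackData} {l m : List D.G.E} (h : D.Legal l) (hm : m <:+: l) :
    D.Legal m := fun t ht => (h t ht).infix (map_iterate_infix hm t)

theorem Legal.map_iterate {D : TrackData} {l : List D.G.E} (h : D.Legal l) (n : ℕ) :
    D.Legal (D.map^[n] l) := by
  intro t ht
  rw [← Function.iterate_add_apply]
  exact h _ (by omega)

theorem Legal.xred {D : TrackData} (hD : IsTrackMap D) {u v : D.G.V} {l : List D.G.E}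
    (hl : D.G.IsPath u l v) (h : D.Legal l) : D.Legal (D.xred l) := by
  intro t ht
  have hl' : D.G.IsPath u (D.xred l) v := hl.red
  rw [← relReduced_xred hD (isPath_map_iterate hD hl' t),
    xred_map_iterate_xred hD, relReduced_xred hD (isPath_map_iterate hD hl t)]
  exact h t ht

/-- A relatively reduced path does not backtrack at an edge `a` of the train track part, since
`a a⁻¹` is homotopic to a trivial path in `X`. -/
theorem RelReduced.xred_reduced {D : TrackData} (hD : IsTrackMap D) {u v : D.G.V} {l : List D.G.E}
    (hl : D.G.IsPath u l v) (h : D.RelReduced l) : D.G.Reduced (D.xred l) := by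
  have h' := (relReduced_xred hD hl).2 h
  have hp : D.G.IsPath u (D.xred l) v := hl.red
  have hr : D.G.RedOn D.IsRel (D.xred l) := D.G.redOn_red _ _
  generalize D.xred l = w at *
  unfold SerreGraph.Reduced
  rw [List.isChain_iff_forall_rel_of_append_cons_cons]
  intro a b A B hw hab
  subst hab
  by_cases ha : D.IsRel a
  · have := hr.infix (m := [a, D.G.inv a]) ⟨A, B, by simp [hw]⟩
    exact (List.isChain_cons_cons.1 this).1 ha rfl
  · refine ha (h' [a, D.G.inv a] [] ⟨A, B, by simp [hw]⟩ (by intro e he; simp at he) ?_ a (by simp))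
    have hp2 : D.G.IsPath (D.G.src a) [a, D.G.inv a] (D.G.src a) := ⟨rfl, rfl, D.G.tgt_inv a⟩
    exact D.G.homotopic_iff.2 ⟨_, _, hp2, rfl, .rel _ _ ⟨hp2, rfl, [], _, _, [],
      Or.inl ⟨a, rfl, rfl⟩, by simp, by simp⟩⟩

/-- Homotopic paths in `X` are homotopic within `X`. -/
theorem xred_eq_of_geod_eq {D : TrackData} {n : ℕ} {α : MulAut (FreeGroup (Fin n))}
    (hB : IsBetaTrainTrack D α) {u v : D.G.V} {l l' : List D.G.E} (hl : D.Seg u l v)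
    (hl' : D.Seg u l' v) (hX : D.InX l) (hX' : D.InX l') (h : D.geod l = D.geod l') :
    D.xred l = D.xred l' := by
  have hD := hB.toIsTrackMap
  have h1 : D.Seg u (l ++ D.G.rev l') u := hl.append hl'.rev
  have h2 : D.geod (l ++ D.G.rev l') = D.geod [] := by
    rw [geod_congr hD hl hl' h rfl]
    refine geod_eq_of_nf_eq hD (hl'.append hl'.rev) (Seg.nil hl.1) ?_
    rw [D.G.nf_append_rev]; rfl
  have h3 := hB.rel_injective u _ h1.2.2 (hX.append (hX'.rev hD))
    (htpy2_of_geod hD h1 (Seg.nil hl.1) h2)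
  obtain ⟨a, b, -, -, H⟩ := D.G.homotopic_iff.1 h3
  have h4 : D.xred (l ++ D.G.rev l') = D.xred [] :=
    H.red_eq hD.rel_inv (fun s t h => h)
  have h5 : D.xred (D.G.rev l' ++ l') = D.xred [] := D.G.red_rev_append hD.rel_inv hX'
  calc D.xred l = D.xred (l ++ []) := by simp
    _ = D.xred (l ++ (D.G.rev l' ++ l')) := xred_congr hD rfl h5.symm
    _ = D.xred ((l ++ D.G.rev l') ++ l') := by simp
    _ = D.xred ([] ++ l') := xred_congr hD h4 rfl
    _ = D.xred l' := by simp

end TrackData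

/-! ### Strongly legal paths -/

namespace TrackData

variable {D : TrackData} {n : ℕ} {α : MulAut (FreeGroup (Fin n))}

theorem one_le_cnt_fE (hB : IsBetaTrainTrack D α) {e : D.G.E} (he : ¬ D.IsRel e) :
    1 ≤ D.cnt (D.fE e) := by
  by_contra h
  have h0 : D.InX (D.fE e) := D.cnt_eq_zero.1 (by omega)
  obtain ⟨t, ht, h2⟩ := hB.expanding e he
  obtain ⟨s, rfl⟩ : ∃ s, t = s + 1 := ⟨t - 1, by omega⟩
  have h1 : D.map^[s + 1] [e] = D.map^[s] (D.fE e) := by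
    rw [Function.iterate_succ_apply]; simp [map]
  have := D.cnt_eq_zero.2 (h0.map_iterate hB.toIsTrackMap s)
  rw [← h1] at this
  have h3 : 2 ≤ D.cnt (D.map^[s + 1] [e]) := h2
  omega

theorem cnt_le_map (hB : IsBetaTrainTrack D α) (l : List D.G.E) : D.cnt l ≤ D.cnt (D.map l) := by
  induction l with
  | nil => simp [map]
  | cons e l ih =>
    have h1 : D.map (e :: l) = D.fE e ++ D.map l := by simp [map]
    rw [h1, cnt_append]
    by_cases he : D.IsRel e
    · rw [D.cnt_cons_of_rel he]; omega
    · rw [D.cnt_cons_of_not_rel he]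
      have := one_le_cnt_fE hB he
      omega

theorem cnt_le_map_iterate (hB : IsBetaTrainTrack D α) (l : List D.G.E) (t : ℕ) :
    D.cnt l ≤ D.cnt (D.map^[t] l) := by
  induction t with
  | zero => rfl
  | succ t ih => rw [Function.iterate_succ_apply']; exact ih.trans (cnt_le_map hB _)

theorem inX_of_map (hB : IsBetaTrainTrack D α) {l : List D.G.E} (h : D.InX (D.map l)) :
    D.InX l := by
  rw [← cnt_eq_zero] at *
  have := cnt_le_map hB l
  omega

theorem not_legal_backtrack (hB : IsBetaTrainTrack D α) {e : D.G.E} (he : ¬ D.IsRel e) :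
    ¬ D.Legal [e, D.G.inv e] := by
  intro h
  have hD := hB.toIsTrackMap
  have hp : D.G.IsPath (D.G.src e) [e, D.G.inv e] (D.G.src e) := ⟨rfl, rfl, D.G.tgt_inv e⟩
  have h1 : D.InX (D.map [e, D.G.inv e]) := by
    refine h 1 le_rfl _ [] (List.infix_rfl) (by intro e he; simp at he) ?_
    refine D.G.homotopic_iff.2 ⟨_, _, isPath_map hD hp, rfl, ?_⟩
    have := pathHomotopic_map hD (u := D.G.src e) (v := D.G.src e) (l := [e, D.G.inv e]) (l' := [])
      (.rel _ _ ⟨hp, rfl, [], _, _, [], Or.inl ⟨e, rfl, rfl⟩, by simp, by simp⟩)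
    simpa [map] using this
  exact he (inX_of_map hB h1 e (by simp))

theorem noAux_of_not_rel (hD : IsTrackMap D) {e : D.G.E} (he : ¬ D.IsRel e) : ¬ D.IsAux e :=
  fun h => he (hD.aux_rel e h)

theorem IsAuxEdge.exists_head (hB : IsBetaTrainTrack D α) {h h' : D.G.E}
    (hh : D.IsAuxEdge h h') :
    ∃ E R R', D.eta h h' = E :: R ∧ D.retr [h, h'] = E :: R' ∧ ¬ D.IsRel E := by
  obtain ⟨-, -, ⟨E, hE, hEr⟩, -⟩ := hB.eta_INP h h' hh
  cases heta : D.eta h h' with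
  | nil => rw [heta] at hE; simp at hE
  | cons x R =>
    rw [heta] at hE
    obtain rfl : x = E := by simpa using hE
    refine ⟨x, R, D.retract R, rfl, ?_, hEr⟩
    rw [← hh.retract_eta hB.toIsTrackMap, heta,
      D.retract_edge (noAux_of_not_rel hB.toIsTrackMap hEr)]

theorem IsAuxEdge.exists_last (hB : IsBetaTrainTrack D α) {h h' : D.G.E}
    (hh : D.IsAuxEdge h h') :
    ∃ E R R', D.eta h h' = R ++ [E] ∧ D.retr [h, h'] = R' ++ [E] ∧ ¬ D.IsRel E := by
  have hD := hB.toIsTrackMap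
  obtain ⟨E, R, R', h1, h2, h3⟩ := hh.rev.exists_head hB
  rw [hD.eta_rev h h' hh] at h1
  rw [hh.retr_rev hD] at h2
  refine ⟨D.G.inv E, D.G.rev R, D.G.rev R', ?_, ?_, fun h => h3 ((rel_inv_iff hD).1 h)⟩
  · rw [← D.G.rev_rev (D.eta h h'), h1, D.G.rev_cons]
  · rw [← D.G.rev_rev (D.retr [h, h']), h2, D.G.rev_cons]

/-- The possible beginnings of a path with non-auxiliary endpoints. -/
theorem Seg.front (hD : IsTrackMap D) {u v : D.G.V} {l : List D.G.E} (hl : D.Seg u l v) :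
    l = [] ∨ (∃ e l', ¬ D.IsAux e ∧ l = e :: l') ∨
      ∃ h h' l', D.IsAuxV (D.G.tgt h) ∧ D.G.src h' = D.G.tgt h ∧ D.G.src h = u ∧
        l = h :: h' :: l' ∧ D.Seg (D.G.tgt h') l' v := by
  induction hl using Seg.induction hD with
  | nil => exact Or.inl rfl
  | edge e l he hs ih => exact Or.inr (Or.inl ⟨e, l, he, rfl⟩)
  | aux h h' l hh hh' hs hs' ih => exact Or.inr (Or.inr ⟨h, h', l, hh, hh', rfl, rfl, hs'⟩)

/-- The first edge of the retraction of a reduced path is either the first edge of the path, or it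
lies in the train track part. -/
theorem head_retract_cases (hB : IsBetaTrainTrack D α) {u v : D.G.V} {l : List D.G.E}
    (hl : D.Seg u l v) (hr : D.G.Reduced l) {y : D.G.E} (hy : y ∈ (D.retract l).head?) :
    y ∈ l.head? ∨ ¬ D.IsRel y ∧ ∃ h h' l', D.IsAuxEdge h h' ∧ D.G.src h = u ∧
      l = h :: h' :: l' := by
  rcases hl.front hB.toIsTrackMap with rfl | ⟨e, l', he, rfl⟩ | ⟨h, h', l', hh, hh', h1, rfl, h2⟩
  · simp at hy
  · rw [D.retract_edge he] at hy
    exact Or.inl hy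
  · have ha : D.IsAuxEdge h h' := ⟨hh, hh', (List.isChain_cons_cons.1 hr).1⟩
    obtain ⟨E, R, R', -, hE, hrel⟩ := ha.exists_head hB
    rw [D.retract_aux hh, ha.piece_eq, hE] at hy
    obtain rfl : E = y := by simpa using hy
    exact Or.inr ⟨hrel, h, h', l', ha, h1, rfl⟩

/-- A strongly legal path between vertices of `Γ`. -/
def SL (D : TrackData) (u : D.G.V) (l : List D.G.E) (v : D.G.V) : Prop :=
  D.Seg u l v ∧ D.StronglyLegal l

theorem SL.reduced {u v : D.G.V} {l : List D.G.E} (h : D.SL u l v) : D.G.Reduced l := h.2.1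

/-- A cut at a non-auxiliary vertex does not separate the two halves of an auxiliary edge. -/
theorem Seg.auxEdge_position {u v : D.G.V} {P Q l₁ l₂ : List D.G.E} {h h' : D.G.E}
    (hP : D.Seg u P v) (hh : D.IsAuxEdge h h') (heq : P ++ Q = l₁ ++ [h, h'] ++ l₂) :
    (∃ m, l₁ = P ++ m ∧ Q = m ++ [h, h'] ++ l₂) ∨ ∃ m, P = l₁ ++ [h, h'] ++ m ∧ l₂ = m ++ Q := by
  rw [List.append_assoc, List.append_eq_append_iff] at heq
  rcases heq with ⟨a, h1, h2⟩ | ⟨a, h1, h2⟩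
  · exact Or.inl ⟨a, h1, by rw [h2, List.append_assoc]⟩
  · match a, h1, h2 with
    | [], h1, h2 => exact Or.inl ⟨[], by simp [h1], by simp at h2 ⊢; exact h2.symm⟩
    | [x], h1, h2 =>
      simp at h2
      obtain ⟨rfl, -⟩ := h2
      have := SerreGraph.IsPath.tgt_last (h1 ▸ hP.2.2)
      exact absurd (this ▸ hh.1) hP.2.1
    | x :: y :: m, h1, h2 =>
      simp at h2
      obtain ⟨rfl, rfl, h2⟩ := h2
      exact Or.inr ⟨m, by simp [h1], h2⟩

theorem Seg.rhat_split (hD : IsTrackMap D) {u v : D.G.V} {l₁ l₂ : List D.G.E} {h h' : D.G.E}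
    (hh : D.IsAuxEdge h h') (hl : D.Seg u (l₁ ++ [h, h'] ++ l₂) v) :
    D.Seg u l₁ (D.G.src h) ∧ D.Seg (D.G.tgt h') l₂ v := by
  obtain ⟨w, hw1, hw2⟩ := D.G.isPath_append_iff.1 hl.2.2
  obtain ⟨x, hx1, hx2⟩ := D.G.isPath_append_iff.1 hw1
  obtain rfl : D.G.src h = x := hx2.1
  obtain rfl : D.G.tgt h' = w := hx2.2.2
  have hs := hh.seg hD
  exact ⟨⟨hl.1, hs.1, hx1⟩, ⟨hs.2.1, hl.2.1, hw2⟩⟩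

theorem rhat_append_auxEdge (hD : IsTrackMap D) {u : D.G.V} {l₁ l₂ : List D.G.E} {h h' : D.G.E}
    (hh : D.IsAuxEdge h h') (hl : D.Seg u l₁ (D.G.src h)) :
    D.rhat (l₁ ++ [h, h'] ++ l₂) = D.rhat l₁ ++ D.eta h h' ++ D.rhat l₂ := by
  rw [List.append_assoc, rhat_append hD hl, List.append_assoc,
    show [h, h'] ++ l₂ = h :: h' :: l₂ from rfl, D.rhat_auxEdge hh]

/-- Subpaths of strongly legal paths between vertices of `Γ` are strongly legal: the cuts do not
separate the halves of an auxiliary edge, so that `r̂` is compatible with the decomposition. -/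
theorem SL.infix (hD : IsTrackMap D) {u v w x : D.G.V} {A l B : List D.G.E}
    (h : D.SL u (A ++ l ++ B) v) (hA : D.Seg u A w) (hl : D.Seg w l x) : D.SL w l x := by
  have hB : D.Seg x B v := h.1.of_append_left (hA.append hl)
  refine ⟨hl, h.2.1.infix ⟨A, B, rfl⟩, h.2.2.1.infix ⟨A, B, rfl⟩, ?_⟩
  rintro A' e c e' B' ⟨hr, he, hc, he'⟩
  have hrh : D.rhat (A ++ l ++ B) = D.rhat A ++ D.rhat l ++ D.rhat B := by
    rw [rhat_append hD (hA.append hl), rhat_append hD hA]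
  rcases h.2.2.2 (D.rhat A ++ A') e c e' (B' ++ D.rhat B)
    ⟨by rw [hrh, hr]; simp, he, hc, he'⟩ with hL | ⟨l₁, k, k', l₂, A₀, B₀, hk, hll, ht, h1, h2⟩
  · exact Or.inl hL
  · right
    rw [List.append_assoc] at hll
    -- the auxiliary edge which gives rise to the turn lies in `l`
    have hsplit := Seg.rhat_split hD hk (by rw [← hll, ← List.append_assoc]; exact h.1)
    rcases hA.auxEdge_position hk hll with ⟨m, rfl, hm⟩ | ⟨m, rfl, hm⟩
    · have hm1 : D.Seg w m (D.G.src k) := hsplit.1.of_append_left hA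
      rcases hl.auxEdge_position hk hm with ⟨m', rfl, hm'⟩ | ⟨m', rfl, rfl⟩
      · exfalso
        have hm'1 : D.Seg x m' (D.G.src k) := hm1.of_append_left hl
        rw [rhat_append hD hA, rhat_append hD hl] at h1
        have := congrArg List.length hr
        have h1' := congrArg List.length h1
        simp at this h1'
        omega
      · have hm'1 : D.Seg (D.G.tgt k') m' x := (Seg.rhat_split hD hk hl).2
        refine ⟨m, k, k', m', A₀, B₀, hk, rfl, ht, ?_, ?_⟩
        · rw [rhat_append hD hA, List.append_assoc] at h1
          exact List.append_cancel_left h1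
        · rw [rhat_append hD hm'1, ← List.append_assoc] at h2
          exact List.append_cancel_right h2
    · exfalso
      have hl1 : D.Seg u l₁ (D.G.src k) := (Seg.rhat_split hD hk hA).1
      rw [rhat_append_auxEdge hD hk hl1, ht.1] at h1
      have := congrArg List.length h1
      simp at this

theorem SL.prefix (hD : IsTrackMap D) {u v x : D.G.V} {l B : List D.G.E}
    (h : D.SL u (l ++ B) v) (hl : D.Seg u l x) : D.SL u l x :=
  SL.infix hD (A := []) (B := B) (by simpa using h) (Seg.nil hl.1) hl

theorem SL.suffix (hD : IsTrackMap D) {u v x : D.G.V} {A l : List D.G.E}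
    (h : D.SL u (A ++ l) v) (hl : D.Seg x l v) (hA : D.Seg u A x) : D.SL x l v :=
  SL.infix hD (A := A) (B := []) (by simpa using h) hA hl

/-- The image of a reduced path under `r` begins with the same edge as its image under `r̂`. -/
theorem head_retract (hB : IsBetaTrainTrack D α) {u v : D.G.V} {l : List D.G.E}
    (hl : D.Seg u l v) (hr : D.G.Reduced l) : (D.retract l).head? = (D.rhat l).head? := by
  have hD := hB.toIsTrackMap
  induction hl using Seg.induction hD with
  | nil => rfl
  | edge e l he hs ih => rw [D.retract_edge he, D.rhat_edge he]; rfl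
  | aux h h' l hh hh' hs hs' ih =>
    have ha : D.IsAuxEdge h h' := ⟨hh, hh', (List.isChain_cons_cons.1 hr).1⟩
    obtain ⟨E, R, R', h1, h2, -⟩ := ha.exists_head hB
    rw [D.retract_aux hh, D.rhat_auxEdge ha, ha.piece_eq, h1, h2]; rfl

/-- A strongly legal path has a reduced retraction. Backtracking could only occur where the pieces of
the retraction are joined, at a turn `E E⁻¹` which is not legal and does not belong to any of the
inserted INPs. -/
theorem SL.retract_reduced (hB : IsBetaTrainTrack D α) {u v : D.G.V} {l : List D.G.E}
    (h : D.SL u l v) : D.G.Reduced (D.retract l) := by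
  have hD := hB.toIsTrackMap
  obtain ⟨hl, hs⟩ := h
  induction hl using Seg.induction hD with
  | nil => exact List.isChain_nil
  | edge e l he hs' ih =>
    have hSL : D.SL (D.G.src e) ([e] ++ l) v := ⟨(D.seg_singleton he).append hs', hs⟩
    have hl := SL.suffix hD hSL hs' (D.seg_singleton he)
    rw [D.retract_edge he, show e :: D.retract l = [e] ++ D.retract l from rfl,
      D.G.reduced_append_iff]
    refine ⟨List.isChain_singleton _, ih hl.2, ?_⟩
    intro x hx y hy hyx
    obtain rfl : e = x := by simpa using hx
    subst hyx
    by_cases hrel : D.IsRel e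
    · rcases head_retract_cases hB hs' hl.2.1 hy with hy | ⟨hy, -⟩
      · exact ((D.G.reduced_append_iff (A := [e])).1 hs.1).2.2 e rfl _ hy rfl
      · exact hy (hD.rel_inv _ hrel)
    · rw [head_retract hB hs' hl.2.1] at hy
      obtain ⟨B, hBB⟩ : ∃ B, D.rhat l = D.G.inv e :: B := by
        cases hrl : D.rhat l with
        | nil => rw [hrl] at hy; simp at hy
        | cons a B => rw [hrl] at hy; simp at hy; exact ⟨B, by rw [hy]⟩
      rcases hs.2.2 [] e [] (D.G.inv e) B ⟨by rw [D.rhat_edge he, hBB]; rfl, hrel,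
        by intro x hx; simp at hx, fun h => hrel ((rel_inv_iff hD).1 h)⟩ with
        hL | ⟨l₁, k, k', l₂, A₀, B₀, hk, hll, ht, h1, h2⟩
      · exact not_legal_backtrack hB hrel hL
      · rcases (D.seg_singleton he).auxEdge_position hk (Q := l) hll with ⟨m, rfl, hm⟩ | ⟨m, hm, -⟩
        · rw [show [e] ++ m = e :: m from rfl, D.rhat_edge he] at h1
          simp at h1
        · have := congrArg List.length hm
          simp at this
          omega
  | aux h h' l hh hh' hs1 hs' ih =>
    have ha : D.IsAuxEdge h h' := ⟨hh, hh', (List.isChain_cons_cons.1 hs.1).1⟩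
    have hSL : D.SL (D.G.src h) ([h, h'] ++ l) v := ⟨hs1.append hs', hs⟩
    have hl := SL.suffix hD hSL hs' hs1
    obtain ⟨E, R, R', he1, he2, hrel⟩ := ha.exists_last hB
    rw [D.retract_aux hh, ha.piece_eq, D.G.reduced_append_iff]
    refine ⟨(hD.retr_aux h h' ha).1, ih hl.2, ?_⟩
    intro x hx y hy hyx
    rw [he2] at hx
    obtain rfl : E = x := by simpa using hx
    subst hyx
    rw [head_retract hB hs' hl.2.1] at hy
    obtain ⟨B, hBB⟩ : ∃ B, D.rhat l = D.G.inv E :: B := by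
      cases hrl : D.rhat l with
      | nil => rw [hrl] at hy; simp at hy
      | cons a B => rw [hrl] at hy; simp at hy; exact ⟨B, by rw [hy]⟩
    rcases hs.2.2 R E [] (D.G.inv E) B ⟨by rw [D.rhat_auxEdge ha, hBB, he1]; simp, hrel,
      by intro x hx; simp at hx, fun h => hrel ((rel_inv_iff hD).1 h)⟩ with
      hL | ⟨l₁, k, k', l₂, A₀, B₀, hk, hll, ht, h1, h2⟩
    · exact not_legal_backtrack hB hrel hL
    · rcases hs1.auxEdge_position hk (Q := l) hll with ⟨m, rfl, hm⟩ | ⟨m, hm, -⟩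
      · rw [show [h, h'] ++ m = h :: h' :: m from rfl, D.rhat_auxEdge ha, he1] at h1
        have := congrArg List.length h1
        simp at this
      · have h4 : l₁ = [] ∧ m = [] := by
          have := congrArg List.length hm
          simp at this
          exact ⟨List.eq_nil_of_length_eq_zero (by omega), List.eq_nil_of_length_eq_zero (by omega)⟩
        obtain ⟨rfl, rfl⟩ := h4
        simp at hm
        obtain ⟨rfl, rfl⟩ := hm
        have h5 := congrArg List.length ht.1
        have h6 := congrArg List.length h1
        rw [he1] at h5
        simp [rhat] at h5 h6
        omega

theorem SL.geod_eq (hB : IsBetaTrainTrack D α) {u v : D.G.V} {l : List D.G.E}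
    (h : D.SL u l v) : D.geod l = D.retract l := D.G.nf_eq_self (h.retract_reduced hB)

/-- Strong legality is inherited by the image after reduction in `X`, since the strongly legal path
provided by the train track property is itself reduced in `X`. -/
theorem SL.map (hB : IsBetaTrainTrack D α) {u v : D.G.V} {l : List D.G.E}
    (h : D.SL u l v) : D.SL (D.fV u) (D.xred (D.map l)) (D.fV v) := by
  obtain ⟨l', h1, h2⟩ := hB.map_legal u v l h.1.1 h.1.2.1 h.1.2.2 h.2
  obtain ⟨_, _, _, _, H⟩ := D.G.homotopic_iff.1 h2
  have h3 : D.xred (D.map l) = D.xred l' := H.red_eq hB.rel_inv (fun s t h => h)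
  rw [D.xred_of_reduced h1.1] at h3
  exact ⟨(h.1.map hB.toIsTrackMap).xred, h3 ▸ h1⟩

theorem SL.map_iterate (hB : IsBetaTrainTrack D α) {u v : D.G.V} {l : List D.G.E}
    (h : D.SL u l v) (t : ℕ) : D.SL (D.fV^[t] u) (D.xred (D.map^[t] l)) (D.fV^[t] v) := by
  induction t with
  | zero => simpa only [Function.iterate_zero, id_eq, D.xred_of_reduced h.2.1] using h
  | succ t ih =>
    simp only [Function.iterate_succ_apply']
    have := ih.map hB
    have h2 := xred_map_iterate_xred hB.toIsTrackMap 1 (D.map^[t] l)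
    simp only [Function.iterate_one] at h2
    rwa [h2] at this

theorem SL.geod_map (hB : IsBetaTrainTrack D α) {u v : D.G.V} {l : List D.G.E}
    (h : D.SL u l v) (t : ℕ) : D.geod (D.map^[t] l) = D.retract (D.xred (D.map^[t] l)) := by
  rw [← (h.map_iterate hB t).geod_eq hB,
    geod_xred hB.toIsTrackMap (h.1.map_iterate hB.toIsTrackMap t)]

theorem sl_singleton (hB : IsBetaTrainTrack D α) {e : D.G.E} (he : ¬ D.IsRel e) :
    D.SL (D.G.src e) [e] (D.G.tgt e) :=
  ⟨D.seg_singleton (noAux_of_not_rel hB.toIsTrackMap he), hB.edge_legal e he⟩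

/-! ### A common period -/

/-- The `t`-th power of the map fixes all INPs and expands all edges of the train track part. -/
def IsPeriod (D : TrackData) (t : ℕ) : Prop :=
  (∀ h h', D.IsAuxEdge h h' → D.G.nf (D.map^[t] (D.eta h h')) = D.eta h h' ∧
    D.fV^[t] (D.G.src h) = D.G.src h ∧ D.fV^[t] (D.G.tgt h') = D.G.tgt h') ∧
  ∀ e, ¬ D.IsRel e → 2 ≤ D.cnt (D.map^[t] [e])

theorem iterate_fixes_eta (hD : IsTrackMap D) {h h' : D.G.E} {t : ℕ}
    (h1 : D.G.nf (D.map^[t] (D.eta h h')) = D.eta h h' ∧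
      D.fV^[t] (D.G.src h) = D.G.src h ∧ D.fV^[t] (D.G.tgt h') = D.G.tgt h') (k : ℕ) :
    D.G.nf (D.map^[t * k] (D.eta h h')) = D.eta h h' ∧
      D.fV^[t * k] (D.G.src h) = D.G.src h ∧ D.fV^[t * k] (D.G.tgt h') = D.G.tgt h' := by
  induction k with
  | zero => simpa using h1.1 ▸ D.G.nf_nf _
  | succ k ih =>
    rw [show t * (k + 1) = t * k + t by ring, Function.iterate_add_apply,
      Function.iterate_add_apply, Function.iterate_add_apply, h1.2.1, h1.2.2]
    refine ⟨?_, ih.2⟩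
    rw [← nf_map_iterate_nf hD, h1.1, ih.1]

/-- There is a common period, since there are only finitely many edges: the product of the periods of
the INPs, multiplied by a number which is large enough for all edges to be expanded. -/
theorem exists_isPeriod (hB : IsBetaTrainTrack D α) : ∃ t, 1 ≤ t ∧ D.IsPeriod t := by
  classical
  have hD := hB.toIsTrackMap
  have := hD.finite_E
  have := Fintype.ofFinite D.G.E
  have h1 : ∀ p : D.G.E × D.G.E, ∃ t : ℕ, 1 ≤ t ∧ (D.IsAuxEdge p.1 p.2 →
      D.G.nf (D.map^[t] (D.eta p.1 p.2)) = D.eta p.1 p.2 ∧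
      D.fV^[t] (D.G.src p.1) = D.G.src p.1 ∧ D.fV^[t] (D.G.tgt p.2) = D.G.tgt p.2) := by
    rintro ⟨h, h'⟩
    by_cases ha : D.IsAuxEdge h h'
    · obtain ⟨-, hred, -, -, -, -, t, ht, hH⟩ := hB.eta_INP h h' ha
      refine ⟨t, ht, fun _ => ?_⟩
      obtain ⟨u, v, hu, hv, H⟩ := D.G.homotopic_iff.1 hH
      have h2 : D.G.nf (D.map^[t] (D.eta h h')) = D.eta h h' :=
        (H.red_eq D.G.true_inv (fun s t ⟨e, h, h'⟩ => ⟨e, trivial, h, h'⟩)).trans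
          (D.G.nf_eq_self hred)
      obtain ⟨E, R, R', hER, -⟩ := ha.exists_head hB
      have hne : D.eta h h' ≠ [] := by simp [hER]
      have hne' : D.map^[t] (D.eta h h') ≠ [] := by
        intro h0; rw [h0] at h2; exact hne h2.symm
      have h3 := (hD.eta_isPath h h' ha)
      have h4 := isPath_map_iterate hD h3 t
      obtain rfl := h3.src_unique hv hne
      obtain rfl := h3.end_unique hv
      have h5 := h4.src_unique hu hne'
      refine ⟨h2, h5, ?_⟩
      rw [h5] at h4
      exact h4.end_unique hu
    · exact ⟨1, le_rfl, fun h => absurd h ha⟩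
  have h2 : ∀ e : D.G.E, ∃ t : ℕ, ¬ D.IsRel e → 2 ≤ D.cnt (D.map^[t] [e]) := by
    intro e
    by_cases he : D.IsRel e
    · exact ⟨0, fun h => absurd he h⟩
    · obtain ⟨t, -, ht⟩ := hB.expanding e he
      exact ⟨t, fun _ => ht⟩
  choose a ha1 ha2 using h1
  choose b hb using h2
  have hpos : 1 ≤ ∏ p, a p := Nat.one_le_iff_ne_zero.2
    (Finset.prod_ne_zero_iff.2 (fun p _ => by have := ha1 p; omega))
  refine ⟨(∏ p, a p) * (1 + ∑ e, b e), Nat.mul_pos hpos (by omega), ?_, ?_⟩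
  · intro h h' hh
    obtain ⟨k, hk⟩ : a (h, h') ∣ ∏ p, a p := Finset.dvd_prod_of_mem a (Finset.mem_univ _)
    rw [hk, mul_assoc]
    exact iterate_fixes_eta hD (ha2 (h, h') hh) _
  · intro e he
    have h3 : b e ≤ ∑ e, b e := Finset.single_le_sum (fun _ _ => Nat.zero_le _) (Finset.mem_univ e)
    have h4 : b e ≤ (∏ p, a p) * (1 + ∑ e, b e) := by nlinarith
    obtain ⟨c, hc⟩ := Nat.exists_eq_add_of_le h4
    rw [hc, add_comm, Function.iterate_add_apply]
    exact (hb e he).trans (cnt_le_map_iterate hB _ _)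

/-- The number of train track edges grows at least exponentially. -/
theorem IsPeriod.pow_le_cnt {t : ℕ} (ht : D.IsPeriod t)
    (l : List D.G.E) (k : ℕ) : 2 ^ k * D.cnt l ≤ D.cnt (D.map^[t * k] l) := by
  have h1 : ∀ l, 2 * D.cnt l ≤ D.cnt (D.map^[t] l) := by
    intro l
    induction l with
    | nil => simp
    | cons e l ih =>
      rw [show e :: l = [e] ++ l from rfl, map_iterate_append, cnt_append, cnt_append]
      by_cases he : D.IsRel e
      · rw [D.cnt_cons_of_rel he, cnt_nil]; omega
      · have := ht.2 e he
        rw [D.cnt_cons_of_not_rel he, cnt_nil]; omega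
  induction k with
  | zero => simp
  | succ k ih =>
    rw [show t * (k + 1) = t + t * k by ring, Function.iterate_add_apply]
    have := h1 (D.map^[t * k] l)
    have h2 : 2 ^ (k + 1) * D.cnt l = 2 * (2 ^ k * D.cnt l) := by ring
    omega

theorem IsPeriod.geod_map_pair (hB : IsBetaTrainTrack D α) {t : ℕ} (ht : D.IsPeriod t)
    {h h' : D.G.E} (hh : D.IsAuxEdge h h') (k : ℕ) :
    D.Seg (D.G.src h) (D.map^[t * k] [h, h']) (D.G.tgt h') ∧
      D.geod (D.map^[t * k] [h, h']) = D.retr [h, h'] := by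
  have hD := hB.toIsTrackMap
  have h1 := iterate_fixes_eta hD (ht.1 h h' hh) k
  have h2 := (hh.seg hD).map_iterate hD (t * k)
  rw [h1.2.1, h1.2.2] at h2
  refine ⟨h2, ?_⟩
  have h3 : D.geod [h, h'] = D.geod (D.eta h h') := by
    rw [hh.geod_pair hD, geod, hh.retract_eta hD, D.G.nf_eq_self (hD.retr_aux h h' hh).1]
  rw [geod_map_iterate hD (hh.seg hD) (hh.eta_seg hD) h3, ← hh.geod_pair hD, h3]
  exact geod_eq_of_nf_eq hD ((hh.eta_seg hD).map_iterate hD _) (hh.eta_seg hD)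
    (by rw [h1.1, D.G.nf_eq_self (hB.eta_INP h h' hh).2.1])

theorem IsAuxEdge.reduced_pair {h h' : D.G.E} (hh : D.IsAuxEdge h h') : D.G.Reduced [h, h'] :=
  List.isChain_cons_cons.2 ⟨hh.2.2, List.isChain_singleton _⟩

/-- Auxiliary edges are fixed up to homotopy in `X`. -/
theorem IsPeriod.xred_map_pair (hB : IsBetaTrainTrack D α) {t : ℕ} (ht : D.IsPeriod t)
    {h h' : D.G.E} (hh : D.IsAuxEdge h h') (k : ℕ) :
    D.xred (D.map^[t * k] [h, h']) = [h, h'] := by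
  have hD := hB.toIsTrackMap
  obtain ⟨h1, h2⟩ := ht.geod_map_pair hB hh k
  rw [← hh.geod_pair hD] at h2
  rw [xred_eq_of_geod_eq hB h1 (hh.seg hD) ((hh.inX hD).map_iterate hD _) (hh.inX hD) h2,
    D.xred_of_reduced hh.reduced_pair]

theorem ilt_eq_zero_of_inX {l : List D.G.E} (hl : D.InX l) : D.ILT l = 0 := by
  have : {τ : List D.G.E × D.G.E × List D.G.E × D.G.E × List D.G.E |
      D.TurnAt l τ.1 τ.2.1 τ.2.2.1 τ.2.2.2.1 τ.2.2.2.2 ∧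
        D.IllegalTurn τ.2.1 τ.2.2.1 τ.2.2.2.1} = ∅ := by
    rw [Set.eq_empty_iff_forall_notMem]
    rintro ⟨A, e, c, e', B⟩ ⟨⟨h1, h2, -⟩, -⟩
    exact h2 (hl e (by simp only at h1; rw [h1]; simp))
  rw [ILT, this, Set.ncard_empty]

/-- Two consecutive auxiliary edges form a strongly legal path, since they are fixed by the
period. -/
theorem sl_two_auxEdges (hB : IsBetaTrainTrack D α) {h h' k k' : D.G.E} (hh : D.IsAuxEdge h h')
    (hk : D.IsAuxEdge k k') (hs : D.G.src k = D.G.tgt h') (hr : k ≠ D.G.inv h') :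
    D.SL (D.G.src h) ([h, h'] ++ [k, k']) (D.G.tgt k') := by
  have hD := hB.toIsTrackMap
  obtain ⟨t, ht1, ht⟩ := exists_isPeriod hB
  have hseg : D.Seg (D.G.src h) ([h, h'] ++ [k, k']) (D.G.tgt k') :=
    (hh.seg hD).append (hs ▸ hk.seg hD)
  have hred : D.G.Reduced ([h, h'] ++ [k, k']) := by
    rw [D.G.reduced_append_iff]
    refine ⟨hh.reduced_pair, hk.reduced_pair, ?_⟩
    intro x hx y hy
    obtain rfl : h' = x := by simpa using hx
    obtain rfl : k = y := by simpa using hy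
    exact hr
  have hX : D.InX ([h, h'] ++ [k, k']) := (hh.inX hD).append (hk.inX hD)
  obtain ⟨T, hT⟩ := hB.eventually_legal
  obtain ⟨l', hl', H⟩ := hT _ _ _ hseg.1 hseg.2.1 hseg.2.2 (hred.redOn D.IsRel)
  rw [ilt_eq_zero_of_inX hX] at H
  set s := T 0 with hs0
  -- apply the map until the number of iterations is a multiple of the period
  have hne : D.map^[s] ([h, h'] ++ [k, k']) ≠ [] := by
    intro h0
    have h1 := (ht.geod_map_pair hB hh s).2
    have hle : s ≤ t * s := Nat.le_mul_of_pos_left _ ht1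
    obtain ⟨c, hc⟩ := Nat.exists_eq_add_of_le hle
    rw [map_iterate_append, List.append_eq_nil_iff] at h0
    rw [hc, add_comm, Function.iterate_add_apply, h0.1, map_iterate_nil] at h1
    obtain ⟨E, R, R', -, hER, -⟩ := hh.exists_head hB
    rw [hER] at h1
    simp [geod, SerreGraph.nf] at h1
  obtain ⟨hl1, hl2⟩ := geod_of_htpy2 hD (hseg.map_iterate hD s) hne H
  have hle : s ≤ t * s := Nat.le_mul_of_pos_left _ ht1
  obtain ⟨c, hc⟩ := Nat.exists_eq_add_of_le hle
  have hSL : D.SL _ l' _ := ⟨hl1, hl'⟩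
  have hSL' := hSL.map_iterate hB c
  have hfix : D.Seg (D.G.src h) (D.map^[t * s] ([h, h'] ++ [k, k'])) (D.G.tgt k') ∧
      D.geod (D.map^[t * s] ([h, h'] ++ [k, k'])) = D.geod ([h, h'] ++ [k, k']) := by
    obtain ⟨a1, a2⟩ := ht.geod_map_pair hB hh s
    obtain ⟨b1, b2⟩ := ht.geod_map_pair hB hk s
    rw [map_iterate_append]
    refine ⟨a1.append (hs ▸ b1), geod_congr hD a1 (hh.seg hD) ?_ ?_⟩
    · rw [a2, hh.geod_pair hD]
    · rw [b2, hk.geod_pair hD]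
  have hcomp : D.map^[c] (D.map^[s] ([h, h'] ++ [k, k'])) =
      D.map^[t * s] ([h, h'] ++ [k, k']) := by
    rw [← Function.iterate_add_apply, hc, add_comm]
  have hseg' := hl1.map_iterate hD c
  have hseg'' := (hseg.map_iterate hD s).map_iterate hD c
  rw [hcomp] at hseg''
  have hg : D.geod (D.xred (D.map^[c] l')) = D.geod (D.map^[t * s] ([h, h'] ++ [k, k'])) := by
    rw [geod_xred hD hseg', ← geod_map_iterate hD (hseg.map_iterate hD s) hl1 hl2 c, hcomp]
  -- the strongly legal path lies in `X`
  have hXl : D.InX (D.xred (D.map^[c] l')) := by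
    refine inX_of_map hB (hSL'.2.2.1 1 le_rfl _ (D.map (D.map^[t * s] ([h, h'] ++ [k, k'])))
      List.infix_rfl ((hX.map_iterate hD _).map hD) ?_)
    have := geod_map_iterate hD hseg'.xred hseg'' hg 1
    exact htpy2_of_geod hD (hseg'.xred.map hD) (hseg''.map hD) this
  have e1 := xred_eq_of_geod_eq hB hseg'.xred hseg'' hXl (hX.map_iterate hD _) hg
  have hne2 : D.map^[t * s] ([h, h'] ++ [k, k']) ≠ [] := by
    intro h0
    have := (ht.geod_map_pair hB hh s).2
    rw [map_iterate_append, List.append_eq_nil_iff] at h0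
    rw [h0.1] at this
    obtain ⟨E, R, R', -, hER, -⟩ := hh.exists_head hB
    rw [hER] at this
    simp [geod, SerreGraph.nf] at this
  have e2 := xred_eq_of_geod_eq hB hfix.1 hseg (hX.map_iterate hD _) hX hfix.2
  rw [D.xred_xred, e2, D.xred_of_reduced hred] at e1
  rw [e1] at hSL'
  exact ⟨hseg, hSL'.2⟩

/-- The retraction `r` maps reduced paths in `X` to reduced paths. -/
theorem retract_reduced_of_inX (hB : IsBetaTrainTrack D α) {u v : D.G.V} {l : List D.G.E}
    (hl : D.Seg u l v) (hX : D.InX l) (hr : D.G.Reduced l) : D.G.Reduced (D.retract l) := by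
  have hD := hB.toIsTrackMap
  induction hl using Seg.induction hD with
  | nil => exact List.isChain_nil
  | edge e l he hs ih =>
    have hr' : D.G.Reduced l := hr.infix (List.suffix_cons _ _).isInfix
    have hX' : D.InX l := hX.subset (List.subset_cons_self _ _)
    rw [D.retract_edge he, show e :: D.retract l = [e] ++ D.retract l from rfl,
      D.G.reduced_append_iff]
    refine ⟨List.isChain_singleton _, ih hX' hr', ?_⟩
    intro x hx y hy hyx
    obtain rfl : e = x := by simpa using hx
    subst hyx
    rcases head_retract_cases hB hs hr' hy with hy | ⟨hy, -⟩
    · exact ((D.G.reduced_append_iff (A := [e])).1 hr).2.2 e rfl _ hy rfl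
    · exact hy (hD.rel_inv _ (hX e (by simp)))
  | aux h h' l hh hh' hs hs' ih =>
    have hr' : D.G.Reduced l := hr.infix (List.suffix_append [h, h'] l).isInfix
    have hX' : D.InX l := hX.subset (List.subset_append_right [h, h'] l)
    have ha : D.IsAuxEdge h h' := ⟨hh, hh', (List.isChain_cons_cons.1 hr).1⟩
    obtain ⟨E, R, R', he1, he2, hrel⟩ := ha.exists_last hB
    rw [D.retract_aux hh, ha.piece_eq, D.G.reduced_append_iff]
    refine ⟨(hD.retr_aux h h' ha).1, ih hX' hr', ?_⟩
    intro x hx y hy hyx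
    rw [he2] at hx
    obtain rfl : E = x := by simpa using hx
    subst hyx
    have hrel' : ¬ D.IsRel (D.G.inv E) := fun h => hrel ((rel_inv_iff hD).1 h)
    rcases head_retract_cases hB hs' hr' hy with hy' | ⟨-, k, k', l', hka, hks, rfl⟩
    · exact hrel' (hX' _ (List.mem_of_mem_head? hy'))
    · have hkh := (List.isChain_cons_cons.1 (List.isChain_cons_cons.1 hr).2).1
      have hred := (sl_two_auxEdges hB ha hka hks hkh).retract_reduced hB
      rw [retract_append hD (ha.seg hD), ha.retract_pair, hka.retract_pair,
        D.G.reduced_append_iff] at hred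
      rw [D.retract_aux hka.1, hka.piece_eq] at hy
      obtain ⟨E', R₁, R₂, -, hE', -⟩ := hka.exists_head hB
      rw [hE'] at hy hred
      exact hred.2.2 E (by simp [he2]) _ hy rfl

end TrackData

/-! ### Rays in the universal covering spanned by the images of an edge -/

namespace TrackData

variable {D : TrackData} {n : ℕ} {α : MulAut (FreeGroup (Fin n))}

open Classical in
/-- Remove the final subpath in `X`. -/
noncomputable def trim (D : TrackData) (l : List D.G.E) : List D.G.E :=
  l.rdropWhile (fun e => decide (D.IsRel e))

/-- A path which does not end with an edge in `X`. -/
def EndsOff (D : TrackData) (l : List D.G.E) : Prop := ∀ x ∈ l.getLast?, ¬ D.IsRel x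

theorem trim_endsOff (l : List D.G.E) : D.EndsOff (D.trim l) := by
  classical
  intro x hx
  have h1 : D.trim l ≠ [] := by intro h; rw [h] at hx; simp at hx
  have h2 := List.rdropWhile_last_not (fun e => decide (D.IsRel e)) l h1
  rw [List.getLast?_eq_some_getLast h1] at hx
  obtain rfl : (D.trim l).getLast h1 = x := by simpa using hx
  simpa [trim] using h2

theorem exists_eq_trim_append (l : List D.G.E) : ∃ m, l = D.trim l ++ m ∧ D.InX m := by
  classical
  refine ⟨l.rtakeWhile (fun e => decide (D.IsRel e)), ?_, ?_⟩
  · exact (List.rdropWhile_append_rtakeWhile ..).symm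
  · intro e he
    simpa using List.mem_rtakeWhile_imp he

theorem trim_prefix (l : List D.G.E) : D.trim l <+: l := by
  obtain ⟨m, h, -⟩ := exists_eq_trim_append l
  exact ⟨m, h.symm⟩

theorem cnt_trim (l : List D.G.E) : D.cnt (D.trim l) = D.cnt l := by
  obtain ⟨m, h, hm⟩ := exists_eq_trim_append l
  conv_rhs => rw [h, cnt_append, D.cnt_eq_zero.2 hm, add_zero]

/-- A prefix which does not end in `X` survives the removal of a final subpath in `X`. -/
theorem EndsOff.prefix_of_append {P l m : List D.G.E} (hP : D.EndsOff P) (hm : D.InX m)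
    (h : P <+: l ++ m) : P <+: l := by
  obtain ⟨r, h⟩ := h
  rcases List.append_eq_append_iff.1 h with ⟨a, h1, h2⟩ | ⟨a, h1, h2⟩
  · exact ⟨a, h1.symm⟩
  · rcases List.eq_nil_or_concat a with rfl | ⟨a, x, rfl⟩
    · exact ⟨[], by simpa using h1⟩
    · exact absurd (hm x (by rw [h2]; simp)) (hP x (by rw [h1]; simp))

theorem EndsOff.prefix_trim {P l : List D.G.E} (hP : D.EndsOff P) (h : P <+: l) :
    P <+: D.trim l := by
  obtain ⟨m, h1, hm⟩ := exists_eq_trim_append l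
  exact hP.prefix_of_append hm (h1 ▸ h)

theorem EndsOff.append {P d : List D.G.E} (hd : D.EndsOff d) (hne : d ≠ []) :
    D.EndsOff (P ++ d) := by
  intro x hx
  rw [List.getLast?_append_of_ne_nil _ hne] at hx
  exact hd x hx

theorem EndsOff.xred_append {a : List D.G.E} (ha : D.EndsOff a) (hr : D.G.RedOn D.IsRel a)
    (C : List D.G.E) : D.xred (a ++ C) = a ++ D.xred C := by
  rw [xred, ← D.G.red_append_red, D.G.red_eq_self]
  · rfl
  · exact D.G.redOn_append_iff.2 ⟨hr, D.G.redOn_red _ _, fun x hx _ _ hp => absurd hp (ha x hx)⟩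

theorem trim_xred_prefix (hD : IsTrackMap D) (A B : List D.G.E) :
    D.trim (D.xred A) <+: D.xred (A ++ B) := by
  obtain ⟨m, h, -⟩ := exists_eq_trim_append (D.xred A)
  have h1 : D.xred (A ++ B) = D.xred (D.xred A ++ B) := xred_congr hD (D.xred_xred A).symm rfl
  have h2 : D.G.RedOn D.IsRel (D.trim (D.xred A)) :=
    (D.G.redOn_red _ A).infix (trim_prefix _).isInfix
  have h3 : D.xred A ++ B = D.trim (D.xred A) ++ (m ++ B) := by rw [← List.append_assoc, ← h]
  rw [h1, h3, (trim_endsOff _).xred_append h2]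
  exact List.prefix_append _ _

/-- A path that ends with an edge of the train track part ends at a non-auxiliary vertex. -/
theorem EndsOff.split (hD : IsTrackMap D) {u v : D.G.V} {a b : List D.G.E} (ha : D.EndsOff a)
    (h : D.Seg u (a ++ b) v) : ∃ w, D.Seg u a w ∧ D.Seg w b v := by
  obtain ⟨w, h1, h2, h3⟩ := h.split
  refine ⟨w, h3 fun hw => ?_⟩
  rcases List.eq_nil_or_concat a with rfl | ⟨a, x, rfl⟩
  · exact h.1 (show D.IsAuxV u from (show u = w from h1) ▸ hw)
  · have := ha x (by simp)
    rw [List.concat_eq_append] at h1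
    exact this (hD.aux_rel x (Or.inr (h1.tgt_last ▸ hw)))

theorem EndsOff.retract_append (hD : IsTrackMap D) {u v : D.G.V} {a b : List D.G.E}
    (ha : D.EndsOff a) (h : D.Seg u (a ++ b) v) :
    D.retract (a ++ b) = D.retract a ++ D.retract b := by
  obtain ⟨w, h1, -⟩ := ha.split hD h
  exact TrackData.retract_append hD h1 b

theorem EndsOff.retract_prefix (hD : IsTrackMap D) {u v : D.G.V} {a l : List D.G.E}
    (ha : D.EndsOff a) (h : D.Seg u l v) (hal : a <+: l) : D.retract a <+: D.retract l := by
  obtain ⟨b, rfl⟩ := hal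
  rw [ha.retract_append hD h]
  exact List.prefix_append _ _

theorem EndsOff.sl_prefix (hD : IsTrackMap D) {u v : D.G.V} {a l : List D.G.E}
    (ha : D.EndsOff a) (h : D.SL u l v) (hal : a <+: l) : ∃ w, D.SL u a w := by
  obtain ⟨b, rfl⟩ := hal
  obtain ⟨w, h1, -⟩ := ha.split hD h.1
  exact ⟨w, SL.prefix hD h h1⟩

theorem prefix_of_cnt_lt {P Q l : List D.G.E} (hP : P <+: l) (hQ : Q <+: l)
    (h : D.cnt P < D.cnt Q) : P <+: Q :=
  (List.prefix_or_prefix_of_prefix hP hQ).resolve_right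
    fun h' => by have := cnt_le_of_prefix h'; omega

theorem cnt_le_cnt_retract (hD : IsTrackMap D) {u v : D.G.V} {l : List D.G.E}
    (hl : D.Seg u l v) : D.cnt l ≤ D.cnt (D.retract l) := by
  induction hl using Seg.induction hD with
  | nil => simp
  | edge e l he hs ih =>
    rw [D.retract_edge he]
    by_cases hr : D.IsRel e
    · rw [D.cnt_cons_of_rel hr, D.cnt_cons_of_rel hr]; exact ih
    · rw [D.cnt_cons_of_not_rel hr, D.cnt_cons_of_not_rel hr]; omega
  | aux h h' l hh hh' hs hs' ih =>
    rw [D.retract_aux hh, D.cnt_cons_of_rel (hD.aux_rel _ (Or.inr hh)),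
      D.cnt_cons_of_rel (hD.aux_rel _ (Or.inl (hh' ▸ hh))), cnt_append]
    omega

/-- The part up to the last edge of the train track part of the `k`-th image of the edge `E` under
the `t`-th power of the map. -/
noncomputable def ray (D : TrackData) (t : ℕ) (E : D.G.E) (k : ℕ) : List D.G.E :=
  D.trim (D.xred (D.map^[t * k] [E]))

/-- The edge `E` is the first edge of all its images under the `t`-th power of the map. -/
def IsFixedDir (D : TrackData) (t : ℕ) (E : D.G.E) : Prop :=
  ¬ D.IsRel E ∧ ∀ k, (D.ray t E k).head? = some E

theorem ray_endsOff (t : ℕ) (E : D.G.E) (k : ℕ) : D.EndsOff (D.ray t E k) := trim_endsOff _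

theorem ray_prefix (hD : IsTrackMap D) (t : ℕ) (E : D.G.E) (k : ℕ) (B : List D.G.E) :
    D.ray t E k <+: D.xred (D.map^[t * k] (E :: B)) := by
  rw [show E :: B = [E] ++ B from rfl, map_iterate_append]
  exact trim_xred_prefix hD _ _

theorem pow_le_cnt_ray (hD : IsTrackMap D) {t : ℕ} (ht : D.IsPeriod t) {E : D.G.E}
    (hE : ¬ D.IsRel E) (k : ℕ) : 2 ^ k ≤ D.cnt (D.ray t E k) := by
  rw [ray, cnt_trim, cnt_xred hD]
  have := ht.pow_le_cnt [E] k
  rw [D.cnt_cons_of_not_rel hE, cnt_nil] at this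
  omega

/-- The rays of an edge extend each other, so that they form an infinite path in the limit. -/
theorem ray_mono (hD : IsTrackMap D) {t : ℕ} {E : D.G.E}
    (hE : D.IsFixedDir t E) {i k : ℕ} (hik : i ≤ k) : D.ray t E i <+: D.ray t E k := by
  obtain ⟨j, rfl⟩ := Nat.exists_eq_add_of_le hik
  obtain ⟨B, hB'⟩ : ∃ B, D.xred (D.map^[t * j] [E]) = E :: B := by
    have h1 := hE.2 j
    obtain ⟨r, hr⟩ := trim_prefix (D.xred (D.map^[t * j] [E]))
    rw [← ray] at hr
    cases h : D.ray t E j with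
    | nil => rw [h] at h1; simp at h1
    | cons x l =>
      rw [h] at h1 hr
      obtain rfl : x = E := by simpa using h1
      exact ⟨_, hr.symm⟩
  refine (ray_endsOff t E i).prefix_trim ?_
  have h2 : D.xred (D.map^[t * (i + j)] [E]) = D.xred (D.map^[t * i] (E :: B)) := by
    rw [Nat.mul_add, Function.iterate_add_apply, ← xred_map_iterate_xred hD, hB']
  rw [h2]
  exact ray_prefix hD t E i B

theorem ray_sl (hB : IsBetaTrainTrack D α) {t : ℕ} {E : D.G.E} (hE : D.IsFixedDir t E) (k : ℕ) :
    ∃ v, D.SL (D.G.src E) (D.ray t E k) v := by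
  have hD := hB.toIsTrackMap
  obtain ⟨v, hv⟩ := (ray_endsOff t E k).sl_prefix hD ((sl_singleton hB hE.1).map_iterate hB (t * k))
    (trim_prefix _)
  have h1 := hE.2 k
  cases h : D.ray t E k with
  | nil => rw [h] at h1; simp at h1
  | cons x l =>
    rw [h] at h1 hv
    obtain rfl : x = E := by simpa using h1
    have : D.G.src x = _ := hv.1.2.2.1
    exact ⟨v, by rw [this]; exact hv⟩

/-- The path `W` in `Γ` starts with the retraction of the `i`-th ray of the edge `E`. -/
def Dir (D : TrackData) (t : ℕ) (E : D.G.E) (i : ℕ) (W : List D.G.E) : Prop :=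
  D.retract (D.ray t E i) <+: W

theorem Dir.mono (hB : IsBetaTrainTrack D α) {t : ℕ} {E : D.G.E} (hE : D.IsFixedDir t E)
    {i k : ℕ} (hik : i ≤ k) {W : List D.G.E} (h : D.Dir t E k W) : D.Dir t E i W := by
  obtain ⟨v, hv⟩ := ray_sl hB hE k
  exact ((ray_endsOff t E i).retract_prefix hB.toIsTrackMap hv.1
    (ray_mono hB.toIsTrackMap hE hik)).trans h

theorem Dir.head (hD : IsTrackMap D) {t : ℕ} {E : D.G.E} (hE : D.IsFixedDir t E)
    {i : ℕ} {W : List D.G.E} (h : D.Dir t E i W) : W.head? = some E := by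
  have h1 := hE.2 i
  obtain ⟨r, rfl⟩ := h
  cases h : D.ray t E i with
  | nil => rw [h] at h1; simp at h1
  | cons x l =>
    rw [h] at h1
    obtain rfl : x = E := by simpa using h1
    rw [D.retract_edge (noAux_of_not_rel hD hE.1)]
    rfl

theorem pow_le_length_ray (hB : IsBetaTrainTrack D α) {t : ℕ} (ht : D.IsPeriod t) {E : D.G.E}
    (hE : D.IsFixedDir t E) (k : ℕ) : 2 ^ k ≤ (D.retract (D.ray t E k)).length := by
  obtain ⟨v, hv⟩ := ray_sl hB hE k
  exact (pow_le_cnt_ray hB.toIsTrackMap ht hE.1 k).trans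
    ((cnt_le_cnt_retract hB.toIsTrackMap hv.1).trans (D.cnt_le_length _))

/-! ### The two branches of an INP -/

/-- The initial direction of the INP associated to an auxiliary edge. -/
def dir (D : TrackData) (h h' : D.G.E) : D.G.E := (D.eta h h').headD h

theorem IsAuxEdge.dir_spec (hB : IsBetaTrainTrack D α) {h h' : D.G.E} (hh : D.IsAuxEdge h h') :
    ∃ R R', D.eta h h' = D.dir h h' :: R ∧ D.retr [h, h'] = D.dir h h' :: R' ∧
      ¬ D.IsRel (D.dir h h') := by
  obtain ⟨E, R, R', h1, h2, h3⟩ := hh.exists_head hB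
  have : D.dir h h' = E := by simp [dir, h1]
  exact ⟨R, R', by rw [this, h1], by rw [this, h2], by rwa [this]⟩

theorem IsAuxEdge.retr_last (hB : IsBetaTrainTrack D α) {h h' : D.G.E} (hh : D.IsAuxEdge h h') :
    ∃ R, D.retr [h, h'] = R ++ [D.G.inv (D.dir (D.G.inv h') (D.G.inv h))] := by
  obtain ⟨-, R, -, h2, -⟩ := hh.rev.dir_spec hB
  rw [hh.retr_rev hB.toIsTrackMap] at h2
  exact ⟨D.G.rev R, by rw [← D.G.rev_rev (D.retr [h, h']), h2, D.G.rev_cons]⟩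

/-- The images of the two branches of an INP cancel in a path `c`, and the remaining parts form
the INP again. -/
theorem exists_branches (hB : IsBetaTrainTrack D α) {t : ℕ} (ht1 : 1 ≤ t) (ht : D.IsPeriod t)
    {h h' : D.G.E} (hh : D.IsAuxEdge h h') (k : ℕ) :
    ∃ a c b, D.eta h h' = a ++ b ∧ a ≠ [] ∧ b ≠ [] ∧
      D.ray t (D.dir h h') k <+: a ++ c ∧
      D.ray t (D.dir (D.G.inv h') (D.G.inv h)) k <+: D.G.rev b ++ c := by
  have hD := hB.toIsTrackMap
  obtain ⟨⟨u, v, hp⟩, hred, -, -, ⟨l₁, l₂, hl, hleg₁, hleg₂⟩, hnl, -⟩ := hB.eta_INP h h' hh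
  rw [hl] at hp
  obtain ⟨w, hp₁, hp₂⟩ := D.G.isPath_append_iff.1 hp
  -- the images of the branches are reduced paths
  have hbr : ∀ {u v l}, D.G.IsPath u l v → D.G.Reduced l → D.Legal l →
      D.G.Reduced (D.xred (D.map^[t * k] l)) := by
    intro u v l hpl hrl hll
    rcases Nat.eq_zero_or_pos k with rfl | hk
    · simpa [D.xred_of_reduced hrl] using hrl
    · exact (hll (t * k) (Nat.mul_pos ht1 hk)).xred_reduced hD (isPath_map_iterate hD hpl _)
  have hr₁ := hbr hp₁ (hred.infix ⟨[], l₂, by simp [hl]⟩) hleg₁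
  have hr₂ := hbr hp₂ (hred.infix ⟨l₁, [], by simp [hl]⟩) hleg₂
  obtain ⟨a, c, b, h1, h2, h3⟩ := D.G.exists_cancellation hr₁ hr₂
  have h4 : D.eta h h' = a ++ b := by
    rw [← h3, ← (iterate_fixes_eta hD (ht.1 h h' hh) k).1, hl, map_iterate_append]
    exact (D.G.nf_congr (nf_xred D _) (nf_xred D _)).symm
  have hnl0 : ¬ D.Legal (a ++ b) := by
    have := hnl 0
    rwa [Function.iterate_zero, id, h4] at this
  have hleg : ∀ {u v l}, D.G.IsPath u l v → D.Legal l → D.Legal (D.xred (D.map^[t * k] l)) :=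
    fun hpl hll => (hll.map_iterate _).xred hD (isPath_map_iterate hD hpl _)
  have ha : a ≠ [] := by
    rintro rfl
    exact hnl0 ((hleg hp₂ hleg₂).infix ⟨D.G.rev c, [], by simp [h2]⟩)
  have hb : b ≠ [] := by
    rintro rfl
    exact hnl0 ((hleg hp₁ hleg₁).infix ⟨[], c, by simp [h1]⟩)
  obtain ⟨R, -, heta, -, -⟩ := hh.dir_spec hB
  obtain ⟨R', -, heta', -, -⟩ := hh.rev.dir_spec hB
  rw [hD.eta_rev h h' hh] at heta'
  refine ⟨a, c, b, h4, ha, hb, ?_, ?_⟩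
  · cases l₁ with
    | nil => rw [map_iterate_nil] at h1; simp [xred] at h1; exact absurd h1.1 ha
    | cons x l₁ =>
      rw [hl] at heta
      obtain ⟨rfl, -⟩ : x = D.dir h h' ∧ _ := by simpa using heta
      rw [← h1]
      exact ray_prefix hD t _ k l₁
  · have h5 : D.G.rev b ++ c = D.xred (D.map^[t * k] (D.G.rev l₂)) := by
      rw [map_iterate_rev hD, xred_rev hD, h2]; simp
    rw [h5]
    cases hl₂ : D.G.rev l₂ with
    | nil =>
      rw [D.G.rev_eq_nil.1 hl₂, map_iterate_nil] at h2; simp [xred] at h2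
      exact absurd h2.2 hb
    | cons x l =>
      rw [hl, D.G.rev_append, hl₂] at heta'
      obtain ⟨rfl, -⟩ : x = D.dir (D.G.inv h') (D.G.inv h) ∧ _ := by simpa using heta'
      exact ray_prefix hD t _ k l

/-- The first edge of an INP is fixed as a direction, since the image of the first branch begins with
a non-trivial part of the INP. -/
theorem isFixedDir_dir (hB : IsBetaTrainTrack D α) {t : ℕ} (ht1 : 1 ≤ t) (ht : D.IsPeriod t)
    {h h' : D.G.E} (hh : D.IsAuxEdge h h') : D.IsFixedDir t (D.dir h h') := by
  obtain ⟨R, -, heta, -, hrel⟩ := hh.dir_spec hB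
  refine ⟨hrel, fun k => ?_⟩
  obtain ⟨a, c, b, h1, ha, -, ⟨r, hr⟩, -⟩ := exists_branches hB ht1 ht hh k
  have hc := pow_le_cnt_ray hB.toIsTrackMap ht hrel k
  cases hray : D.ray t (D.dir h h') k with
  | nil =>
    rw [hray, cnt_nil] at hc
    exact absurd hc (by simp)
  | cons x l =>
    cases a with
    | nil => exact absurd rfl ha
    | cons y a =>
      rw [hray] at hr
      rw [heta] at h1
      simp at hr h1
      simp [hr.1, h1.1]

/-- The two rays given by an INP merge: after removal of the parts `a` and `b⁻¹` of the INP they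
have a long initial part `d` in common. -/
theorem exists_common_end (hB : IsBetaTrainTrack D α) {t : ℕ} (ht1 : 1 ≤ t) (ht : D.IsPeriod t)
    {h h' : D.G.E} (hh : D.IsAuxEdge h h') (N : ℕ) :
    ∃ j a b d, N ≤ j ∧ D.eta h h' = a ++ b ∧ a ≠ [] ∧ b ≠ [] ∧ D.EndsOff d ∧ d ≠ [] ∧
      N ≤ D.cnt d ∧ a ++ d <+: D.ray t (D.dir h h') j ∧
      D.G.rev b ++ d <+: D.ray t (D.dir (D.G.inv h') (D.G.inv h)) j := by
  have hD := hB.toIsTrackMap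
  obtain ⟨-, -, -, -, hrel⟩ := hh.dir_spec hB
  obtain ⟨-, -, -, -, hrel'⟩ := hh.rev.dir_spec hB
  set j := N + D.cnt (D.eta h h') + 1 with hj
  obtain ⟨a, c, b, h1, ha, hb, hp, hp'⟩ := exists_branches hB ht1 ht hh j
  have hj2 : j < 2 ^ j := Nat.lt_two_pow_self
  have hc := pow_le_cnt_ray hD ht hrel j
  have hc' := pow_le_cnt_ray hD ht hrel' j
  have hcnt : D.cnt (D.eta h h') = D.cnt a + D.cnt b := by rw [h1, cnt_append]
  have hcb := D.cnt_rev hD b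
  -- each of the two rays is an end of the INP followed by a part of `c`
  have key : ∀ {a r : List D.G.E}, D.EndsOff r → r <+: a ++ c → D.cnt a + N < D.cnt r →
      ∃ d, r = a ++ d ∧ d <+: c ∧ D.EndsOff d ∧ N < D.cnt d := by
    intro a r hro hr hcr
    obtain ⟨d, rfl⟩ := prefix_of_cnt_lt (List.prefix_append a c) hr (by omega)
    rw [cnt_append] at hcr
    have hd : d ≠ [] := by rintro rfl; simp at hcr
    refine ⟨d, rfl, (List.prefix_append_right_inj a).1 hr, fun x hx => hro x ?_, by omega⟩
    rw [List.getLast?_append_of_ne_nil _ hd]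
    exact hx
  obtain ⟨d, hd1, hd2, hd3, hd4⟩ := key (ray_endsOff t _ j) hp (by omega)
  obtain ⟨e, he1, he2, he3, he4⟩ := key (ray_endsOff t _ j) hp' (by omega)
  have hne : ∀ {d : List D.G.E}, N < D.cnt d → d ≠ [] := by rintro d h rfl; simp at h
  rcases List.prefix_or_prefix_of_prefix hd2 he2 with hde | hed
  · exact ⟨j, a, b, d, by omega, h1, ha, hb, hd3, hne hd4, hd4.le, hd1 ▸ List.prefix_rfl,
      he1 ▸ (List.prefix_append_right_inj _).2 hde⟩
  · exact ⟨j, a, b, e, by omega, h1, ha, hb, he3, hne he4, he4.le,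
      hd1 ▸ (List.prefix_append_right_inj _).2 hed, he1 ▸ List.prefix_rfl⟩

/-- If a path `W` follows the ray at the end of the auxiliary edge `h h'` long enough, then the
product of the pre-INP with `W` follows the ray at its beginning: the two rays merge, and the pre-INP
cancels against the part of `W` before the merging point. -/
theorem exists_dir_append (hB : IsBetaTrainTrack D α) {t : ℕ} (ht1 : 1 ≤ t) (ht : D.IsPeriod t)
    {h h' : D.G.E} (hh : D.IsAuxEdge h h') (i : ℕ) :
    ∃ j, ∀ W, D.G.Reduced W → D.Dir t (D.dir (D.G.inv h') (D.G.inv h)) j W →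
      D.Dir t (D.dir h h') i (D.G.nf (D.retr [h, h'] ++ W)) := by
  have hD := hB.toIsTrackMap
  have hf := isFixedDir_dir hB ht1 ht hh
  have hf' := isFixedDir_dir hB ht1 ht hh.rev
  obtain ⟨j, a, b, d, hj, heta, ha, hb, hd, hdne, hcd, hp, hp'⟩ :=
    exists_common_end hB ht1 ht hh (max i (D.cnt (D.ray t (D.dir h h') i) + 1))
  refine ⟨j, fun W hW hdir => ?_⟩
  obtain ⟨v, hv⟩ := ray_sl hB hf j
  obtain ⟨v', hv'⟩ := ray_sl hB hf' j
  obtain ⟨w, hw⟩ := (hd.append hdne).sl_prefix hD hv hp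
  obtain ⟨w', hw'⟩ := (hd.append hdne).sl_prefix hD hv' hp'
  obtain ⟨W', rfl⟩ := ((hd.append hdne).retract_prefix hD hv'.1 hp').trans hdir
  -- the last edge `x` of `d` belongs to the train track part, so that it is seen in the retractions
  obtain ⟨d, x, rfl⟩ := (List.eq_nil_or_concat d).resolve_left hdne
  rw [List.concat_eq_append] at *
  have hx : ¬ D.IsRel x := hd x (by simp)
  have hxs := D.seg_singleton (noAux_of_not_rel hD hx)
  have hsplit : ∀ {u v p}, D.Seg u (p ++ (d ++ [x])) v →
      D.retract (p ++ (d ++ [x])) = D.retract (p ++ d) ++ [x] := by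
    intro u v p hs
    rw [← List.append_assoc] at hs ⊢
    obtain ⟨y, h1, h2, h3⟩ := hs.split
    obtain rfl : D.G.src x = y := h2.1
    rw [retract_append hD (h3 hxs.1).1, D.retract_edge (noAux_of_not_rel hD hx), retract_nil]
  have hred := hw.retract_reduced hB
  have hfull : D.G.nf (D.retr [h, h'] ++ (D.retract (D.G.rev b ++ (d ++ [x])) ++ W')) =
      D.retract (a ++ (d ++ [x])) ++ W' := by
    have hs : D.Seg (D.G.src h) (D.eta h h') (D.G.tgt h') := hh.eta_seg hD
    have hsrc : D.G.src (D.dir (D.G.inv h') (D.G.inv h)) = D.G.tgt h' := by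
      obtain ⟨R, -, h1, -⟩ := hh.rev.dir_spec hB
      have h2 := (hh.rev.eta_seg hD).2.2
      rw [h1] at h2
      exact h2.1
    rw [hsrc] at hw'
    have h1 : D.geod (D.eta h h' ++ (D.G.rev b ++ (d ++ [x]))) = D.geod (a ++ (d ++ [x])) := by
      refine geod_eq_of_nf_eq hD (hs.append hw'.1) hw.1 ?_
      rw [heta, show a ++ b ++ (D.G.rev b ++ (d ++ [x])) = (a ++ (b ++ D.G.rev b)) ++ (d ++ [x]) by
        simp]
      refine D.G.nf_congr ?_ rfl
      rw [← D.G.nf_append_nf, D.G.nf_append_rev, List.append_nil]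
    rw [geod_append hD hs, geod, hh.retract_eta hD, D.G.nf_eq_self (hD.retr_aux h h' hh).1,
      hw.geod_eq hB, hw'.geod_eq hB] at h1
    rw [← List.append_assoc, ← D.G.nf_nf_append, h1, D.G.nf_eq_self]
    rw [hsplit hw'.1] at hW
    rw [hsplit hw.1, List.append_assoc, List.singleton_append] at *
    exact D.G.reduced_append_cons hred (hW.infix ⟨D.retract (D.G.rev b ++ d), [], by simp⟩)
  rw [hfull]
  refine ((ray_endsOff t _ i).retract_prefix hD hw.1 ?_).trans (List.prefix_append _ _)
  refine prefix_of_cnt_lt (ray_mono hD hf ((le_max_left _ _).trans hj)) hp ?_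
  rw [cnt_append]
  have := le_max_right i (D.cnt (D.ray t (D.dir h h') i) + 1)
  omega

/-- A version of `exists_dir_append` with one bound for all of the finitely many auxiliary edges. -/
theorem exists_dir_append_uniform (hB : IsBetaTrainTrack D α) {t : ℕ} (ht1 : 1 ≤ t)
    (ht : D.IsPeriod t) (i : ℕ) :
    ∃ j, ∀ h h', D.IsAuxEdge h h' → ∀ W, D.G.Reduced W →
      D.Dir t (D.dir (D.G.inv h') (D.G.inv h)) j W →
      D.Dir t (D.dir h h') i (D.G.nf (D.retr [h, h'] ++ W)) := by
  classical
  have := hB.finite_E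
  have := Fintype.ofFinite D.G.E
  have h1 : ∀ p : D.G.E × D.G.E, ∃ j, D.IsAuxEdge p.1 p.2 → ∀ W, D.G.Reduced W →
      D.Dir t (D.dir (D.G.inv p.2) (D.G.inv p.1)) j W →
      D.Dir t (D.dir p.1 p.2) i (D.G.nf (D.retr [p.1, p.2] ++ W)) := by
    intro p
    by_cases hp : D.IsAuxEdge p.1 p.2
    · obtain ⟨j, hj⟩ := exists_dir_append hB ht1 ht hp i
      exact ⟨j, fun _ => hj⟩
    · exact ⟨0, fun h => absurd h hp⟩
  choose J hJ using h1
  refine ⟨∑ p, J p, fun h h' hh W hW hdir => hJ (h, h') hh W hW ?_⟩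
  exact hdir.mono hB (isFixedDir_dir hB ht1 ht hh.rev)
    (Finset.single_le_sum (fun _ _ => Nat.zero_le _) (Finset.mem_univ (h, h')))

end TrackData

/-! ### Directions at auxiliary stars -/

namespace SerreGraph

theorem Reduced.replace_right {G : SerreGraph} {A B W : List G.E} (h : G.Reduced (A ++ B))
    (hW : G.Reduced W) (hh : W.head? = B.head?) : G.Reduced (A ++ W) := by
  rw [reduced_append_iff] at *
  exact ⟨h.1, hW, hh ▸ h.2.2⟩

end SerreGraph

namespace TrackData

variable {D : TrackData} {n : ℕ} {α : MulAut (FreeGroup (Fin n))}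

theorem IsAuxEdge.nf_star (hD : IsTrackMap D) {h k k' : D.G.E} (hk : D.IsAuxEdge h k)
    (hk' : D.IsAuxEdge h k') (hkk : D.IsAuxEdge (D.G.inv k) k') :
    D.G.nf (D.retr [h, k] ++ D.retr [D.G.inv k, k']) = D.retr [h, k'] := by
  have := nf_piece_append hD hk.1 hk.2.1 hk'.2.1
  rwa [hk.piece_eq, hk'.piece_eq, hkk.piece_eq, D.G.nf_eq_self (hD.retr_aux _ _ hk').1] at this

theorem IsAuxEdge.retr_reduced (hD : IsTrackMap D) {h h' : D.G.E} (hh : D.IsAuxEdge h h') :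
    D.G.Reduced (D.retr [h, h']) := (hD.retr_aux h h' hh).1

/-- The initial direction of the INP of an auxiliary edge depends only on its first half. Otherwise
the pre-INP of `k⁻¹ k'` would be the product, without cancellation, of those of `k⁻¹ h⁻¹` and
`h k'`. Following the ray of `k'⁻¹` once directly to `h`, and once through `k⁻¹`, would then lead to
both of the directions. -/
theorem IsAuxEdge.dir_eq (hB : IsBetaTrainTrack D α) {h k k' : D.G.E} (hk : D.IsAuxEdge h k)
    (hk' : D.IsAuxEdge h k') : D.dir h k = D.dir h k' := by
  have hD := hB.toIsTrackMap
  obtain ⟨t, ht1, ht⟩ := exists_isPeriod hB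
  by_contra hne
  have hkne : k' ≠ k := by rintro rfl; exact hne rfl
  have hkk : D.IsAuxEdge (D.G.inv k) k' :=
    ⟨by rw [D.G.tgt_inv, hk.2.1]; exact hk.1, by rw [D.G.tgt_inv, hk.2.1, hk'.2.1],
      by rwa [D.G.inv_inv]⟩
  have hkr : D.IsAuxEdge (D.G.inv k) (D.G.inv h) := hk.rev
  obtain ⟨R₁, e₁⟩ := hkr.retr_last hB
  rw [D.G.inv_inv, D.G.inv_inv] at e₁
  obtain ⟨-, R₂, -, e₂, -⟩ := hk'.dir_spec hB
  -- there is no cancellation between the INPs in question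
  have e₃ : D.retr [D.G.inv k, k'] = D.retr [D.G.inv k, D.G.inv h] ++ D.retr [h, k'] := by
    have := hkr.nf_star hD hkk (by rwa [D.G.inv_inv])
    rw [D.G.inv_inv] at this
    rw [← this, D.G.nf_eq_self]
    rw [D.G.reduced_append_iff]
    refine ⟨hkr.retr_reduced hD, hk'.retr_reduced hD, ?_⟩
    rw [e₁, e₂]
    intro x hx y hy
    obtain rfl : D.G.inv (D.dir h k) = x := by simpa using hx
    obtain rfl : D.dir h k' = y := by simpa using hy
    rw [D.G.inv_inv]
    exact Ne.symm hne
  have d₁ : D.dir (D.G.inv k) k' = D.dir (D.G.inv k) (D.G.inv h) := by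
    obtain ⟨-, A, -, a₁, -⟩ := hkk.dir_spec hB
    obtain ⟨-, B, -, b₁, -⟩ := hkr.dir_spec hB
    rw [a₁, b₁] at e₃
    simpa using (List.cons.inj e₃).1
  have d₂ : D.dir (D.G.inv k') (D.G.inv (D.G.inv k)) = D.dir (D.G.inv k') (D.G.inv h) := by
    obtain ⟨A, a₁⟩ := hkk.retr_last hB
    obtain ⟨B, b₁⟩ := hk'.retr_last hB
    rw [a₁, b₁, ← List.append_assoc] at e₃
    have := (List.append_inj' e₃ rfl).2
    simpa [D.G.inv_inv] using congrArg (List.map D.G.inv) this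
  obtain ⟨j₀, hj₀⟩ := exists_dir_append_uniform hB ht1 ht 0
  obtain ⟨j₁, hj₁⟩ := exists_dir_append_uniform hB ht1 ht j₀
  have hf := isFixedDir_dir hB ht1 ht hk'.rev
  obtain ⟨v, hv⟩ := ray_sl hB hf (max j₀ j₁)
  have hWr := hv.retract_reduced hB
  set W := D.retract (D.ray t (D.dir (D.G.inv k') (D.G.inv h)) (max j₀ j₁)) with hW
  have hdir : D.Dir t (D.dir (D.G.inv k') (D.G.inv h)) (max j₀ j₁) W := List.prefix_rfl
  have h₁ := (hj₀ h k' hk' W hWr (hdir.mono hB hf (le_max_left _ _))).head hD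
    (isFixedDir_dir hB ht1 ht hk')
  have h₂ := hj₁ _ k' hkk W hWr (d₂ ▸ hdir.mono hB hf (le_max_right _ _))
  have h₃ := (hj₀ h k hk _ (D.G.nf_reduced _) (d₁ ▸ h₂)).head hD (isFixedDir_dir hB ht1 ht hk)
  rw [D.G.nf_append_nf, ← List.append_assoc, ← D.G.nf_nf_append, hk.nf_star hD hk' hkk, h₁] at h₃
  exact hne (by simpa using h₃.symm)

/-- A version of `exists_dir_append_uniform` for arbitrary half-edges of a star. -/
theorem exists_dir_star (hB : IsBetaTrainTrack D α) {t : ℕ} (ht1 : 1 ≤ t)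
    (ht : D.IsPeriod t) (i : ℕ) :
    ∃ j, ∀ h h' g, D.IsAuxEdge h h' → D.IsAuxEdge (D.G.inv h') g → ∀ W, D.G.Reduced W →
      D.Dir t (D.dir (D.G.inv h') g) j W →
      D.Dir t (D.dir h h') i (D.G.nf (D.retr [h, h'] ++ W)) := by
  obtain ⟨j, hj⟩ := exists_dir_append_uniform hB ht1 ht i
  exact ⟨j, fun h h' g hh hg W hW hdir => hj h h' hh W hW (hh.rev.dir_eq hB hg ▸ hdir)⟩

theorem IsPeriod.seg_map (hB : IsBetaTrainTrack D α) {t : ℕ} (ht : D.IsPeriod t) {h h' : D.G.E}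
    (hh : D.IsAuxEdge h h') (k : ℕ) :
    D.fV^[t * k] (D.G.src h) = D.G.src h ∧ D.fV^[t * k] (D.G.tgt h') = D.G.tgt h' :=
  (iterate_fixes_eta hB.toIsTrackMap (ht.1 h h' hh) k).2

/-- If a path ends with the half-edge `x` whose initial point is auxiliary, it ends with an
auxiliary edge. -/
theorem Seg.ends_auxEdge (hD : IsTrackMap D) {u v : D.G.V} {L : List D.G.E} {x : D.G.E}
    (h : D.Seg u (L ++ [x]) v)
    (hr : D.G.Reduced (L ++ [x])) (hx : D.IsAuxV (D.G.src x)) :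
    ∃ L' g, L = L' ++ [g] ∧ D.IsAuxEdge g x ∧ D.Seg u L' (D.G.src g) := by
  rcases List.eq_nil_or_concat L with rfl | ⟨L', g, rfl⟩
  · exact absurd ((show D.G.src x = u from h.2.2.1) ▸ hx) h.1
  · rw [List.concat_eq_append] at *
    obtain ⟨w, h1, h2⟩ := D.G.isPath_append_iff.1 h.2.2
    have h3 : D.G.tgt g = D.G.src x := h1.tgt_last.trans h2.1.symm
    have h4 := ((D.G.reduced_append_iff).1 hr).2.2 g (by simp) x (by simp)
    have h5 : D.IsAuxEdge g x := ⟨h3 ▸ hx, h3.symm, h4⟩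
    exact ⟨L', g, rfl, h5, (Seg.rhat_split hD h5 (l₂ := []) (by simpa using h)).1⟩

/-- The direction of a path is not changed if an arc which leaves an auxiliary star in the right
direction is attached to the image of a strongly legal path that ends at this star. -/
theorem exists_dir_attach (hB : IsBetaTrainTrack D α) {t : ℕ} (ht1 : 1 ≤ t) (ht : D.IsPeriod t) :
    ∃ J, ∀ E L g g' u v W, D.IsFixedDir t E → D.IsAuxEdge g g' →
      D.SL u (E :: L ++ [g, g']) v → D.G.Reduced W → D.Dir t (D.dir g g') J W →
      ∀ j k, j ≤ k → D.Dir t E j (D.G.nf (D.geod (D.map^[t * k] (E :: L)) ++ W)) := by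
  have hD := hB.toIsTrackMap
  obtain ⟨J, hJ⟩ := exists_dir_star hB ht1 ht 0
  refine ⟨J, fun E L g g' u v W hE hg hSL hW hdir j k hjk => ?_⟩
  have hseg := (Seg.rhat_split hD hg (l₁ := E :: L) (l₂ := []) (by simpa using hSL.1)).1
  have hL := SL.prefix hD hSL hseg
  have hL' := hL.map_iterate hB (t * k)
  rw [hL.geod_map hB, (ht.seg_map hB hg k).1] at *
  set L' := D.xred (D.map^[t * k] (E :: L)) with hLdef
  have hray : D.ray t E k <+: L' := ray_prefix hD t E k L
  suffices h : ∃ L₀ W', D.ray t E k <+: L₀ ∧ L₀ <+: L' ∧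
      (∃ w, D.Seg (D.fV^[t * k] u) L₀ w) ∧
      D.G.nf (D.retract L' ++ W) = D.retract L₀ ++ W' by
    obtain ⟨L₀, W', h1, -, ⟨w, h3⟩, h4⟩ := h
    rw [h4]
    exact ((ray_endsOff t E j).retract_prefix hD h3 ((ray_mono hD hE hjk).trans h1)).trans
      (List.prefix_append _ _)
  by_cases hend : ∃ L₀, L' = L₀ ++ [D.G.inv g]
  · obtain ⟨L₀, h0⟩ := hend
    rw [h0] at hL' hray ⊢
    obtain ⟨L₁, g₁, rfl, hg₁, hs₁⟩ := hL'.1.ends_auxEdge hD hL'.reduced (by exact hg.1)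
    rw [List.append_assoc, List.singleton_append] at *
    refine ⟨L₁, D.G.nf (D.retr [g₁, D.G.inv g] ++ W),
      (ray_endsOff t E k).prefix_of_append (hg₁.inX hD) hray, List.prefix_append _ _,
      ⟨_, hs₁⟩, ?_⟩
    have h1 := hL'.retract_reduced hB
    rw [retract_append hD hs₁, hg₁.retract_pair] at h1 ⊢
    rw [List.append_assoc, ← D.G.nf_append_nf, D.G.nf_eq_self]
    refine h1.replace_right (D.G.nf_reduced _) ?_
    rw [(hJ _ _ g' hg₁ (by rwa [D.G.inv_inv]) W hW (by rwa [D.G.inv_inv])).head hD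
      (isFixedDir_dir hB ht1 ht hg₁)]
    obtain ⟨-, R, -, hR, -⟩ := hg₁.dir_spec hB
    rw [hR]; rfl
  · refine ⟨L', W, hray, List.prefix_rfl, ⟨_, hL'.1⟩, D.G.nf_eq_self ?_⟩
    have h1 : D.G.Reduced (L' ++ [g, g']) := by
      rw [D.G.reduced_append_iff]
      refine ⟨hL'.reduced, hg.reduced_pair, fun x hx y hy hyx => hend ?_⟩
      obtain rfl : g = y := by simpa using hy
      rw [Option.mem_def, List.getLast?_eq_some_iff] at hx
      obtain ⟨L₀, hx⟩ := hx
      exact ⟨L₀, by rw [hx, hyx, D.G.inv_inv]⟩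
    have h2 := hSL.map_iterate hB (t * k)
    have h3 : D.xred (D.map^[t * k] (E :: L ++ [g, g'])) = L' ++ [g, g'] := by
      rw [map_iterate_append, ← D.xred_of_reduced h1]
      refine xred_congr hD (D.xred_xred _).symm ?_
      rw [ht.xred_map_pair hB hg, D.xred_of_reduced hg.reduced_pair]
    rw [h3] at h2
    have h4 := h2.retract_reduced hB
    rw [retract_append hD hL'.1, hg.retract_pair] at h4
    refine h4.replace_right hW ?_
    obtain ⟨-, R, -, hR, -⟩ := hg.dir_spec hB
    rw [hR, hdir.head hD (isFixedDir_dir hB ht1 ht hg)]; rfl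

/-- A cut of the retraction of a path comes from a cut of the path, or from a cut of one of the
inserted paths. -/
theorem Seg.retract_eq_append (hD : IsTrackMap D) {u v : D.G.V} {M : List D.G.E}
    (hM : D.Seg u M v) {P S : List D.G.E} (h : D.retract M = P ++ S) :
    (∃ M₁ M₂ w, M = M₁ ++ M₂ ∧ D.Seg u M₁ w ∧ D.Seg w M₂ v ∧ D.retract M₁ = P ∧
      D.retract M₂ = S) ∨
    ∃ M₁ g g' M₂ P' S', M = M₁ ++ [g, g'] ++ M₂ ∧ D.IsAuxEdge g g' ∧ D.Seg u M₁ (D.G.src g) ∧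
      D.Seg (D.G.tgt g') M₂ v ∧ P = D.retract M₁ ++ P' ∧ S = S' ++ D.retract M₂ ∧
      D.retr [g, g'] = P' ++ S' ∧ P' ≠ [] ∧ S' ≠ [] := by
  induction hM using Seg.induction hD generalizing P with
  | nil hv =>
    simp at h
    obtain ⟨rfl, rfl⟩ := h
    exact Or.inl ⟨[], [], v, rfl, Seg.nil hv, Seg.nil hv, rfl, rfl⟩
  | edge e l he hs ih =>
    rw [D.retract_edge he] at h
    cases P with
    | nil =>
      have hse := D.seg_singleton he
      refine Or.inl ⟨[], e :: l, _, rfl, Seg.nil hse.1, hse.append hs, rfl, ?_⟩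
      rw [D.retract_edge he, h]; rfl
    | cons x P =>
      obtain ⟨rfl, h'⟩ : e = x ∧ D.retract l = P ++ S := by simpa using h
      clear h
      have hse := D.seg_singleton he
      rcases ih h' with ⟨M₁, M₂, w, rfl, h1, h2, rfl, rfl⟩ |
        ⟨M₁, g, g', M₂, P', S', rfl, h1, h2, h3, rfl, rfl, h4⟩
      · exact Or.inl ⟨e :: M₁, M₂, w, rfl, hse.append h1, h2, D.retract_edge he _, rfl⟩
      · exact Or.inr ⟨e :: M₁, g, g', M₂, P', S', rfl, h1, hse.append h2, h3,
          by rw [D.retract_edge he]; rfl, rfl, h4⟩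
  | aux g g' l hg hg' hs hs' ih =>
    rw [D.retract_aux hg] at h
    rcases List.append_eq_append_iff.1 h with ⟨P₁, rfl, h'⟩ | ⟨S₁, hp, rfl⟩
    · clear h
      rcases ih h' with ⟨M₁, M₂, w, rfl, h1, h2, rfl, rfl⟩ |
        ⟨M₁, e, e', M₂, P', S', rfl, h1, h2, h3, rfl, rfl, h4⟩
      · exact Or.inl ⟨g :: g' :: M₁, M₂, w, rfl, hs.append h1, h2, D.retract_aux hg _ _, rfl⟩
      · exact Or.inr ⟨g :: g' :: M₁, e, e', M₂, P', S', rfl, h1, hs.append h2, h3,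
          by rw [D.retract_aux hg, List.append_assoc], rfl, h4⟩
    · by_cases hP : P = []
      · subst hP
        refine Or.inl ⟨[], g :: g' :: l, _, rfl, Seg.nil hs.1, hs.append hs', rfl, ?_⟩
        rw [D.retract_aux hg, hp]; rfl
      · by_cases hS : S₁ = []
        · subst hS
          refine Or.inl ⟨[g, g'], l, _, rfl, hs, hs', ?_, rfl⟩
          rw [D.retract_aux hg, hp]; simp
        · have ha : D.IsAuxEdge g g' := by
            refine ⟨hg, hg', fun hgg => hP ?_⟩
            rw [piece, if_pos hgg] at hp
            simp at hp
            exact hp.1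
          exact Or.inr ⟨[], g, g', l, P, S₁, rfl, ha, Seg.nil hs.1, hs', rfl, rfl,
            by rw [← ha.piece_eq, hp], hP, hS⟩

end TrackData

/-! ### Images of parts of pre-INPs -/

namespace TrackData

variable {D : TrackData} {n : ℕ} {α : MulAut (FreeGroup (Fin n))}

/-- The images of the proper initial parts of the pre-INP of `h h'` become long, and they start in
the direction of the INP. -/
def ProperPartsGrow (D : TrackData) (t : ℕ) (h h' : D.G.E) : Prop :=
  ∀ P S, D.retr [h, h'] = P ++ S → P ≠ [] → S ≠ [] →
    ∀ j, ∃ k₀, ∀ k, k₀ ≤ k → D.Dir t (D.dir h h') j (D.geod (D.map^[t * k] P))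

theorem IsAuxEdge.retr_ne_nil (hB : IsBetaTrainTrack D α) {h h' : D.G.E} (hh : D.IsAuxEdge h h') :
    D.retr [h, h'] ≠ [] := by
  obtain ⟨-, R, -, hR, -⟩ := hh.dir_spec hB
  simp [hR]

/-- Initial parts of the retraction of a strongly legal path have images in the direction of its
first edge, if the proper initial parts of shorter pre-INPs have this property. -/
theorem dir_of_prefix_retract (hB : IsBetaTrainTrack D α) {t : ℕ} (ht1 : 1 ≤ t)
    (ht : D.IsPeriod t) {E : D.G.E} (hE : D.IsFixedDir t E) {u v : D.G.V} {M R : List D.G.E}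
    (hM : D.SL u M v) (hMR : M <+: E :: R)
    (ih : ∀ g g', D.IsAuxEdge g g' → (D.retr [g, g']).length < (D.retract M).length →
      D.ProperPartsGrow t g g')
    {P : List D.G.E} (hP : P <+: D.retract M) (hne : P ≠ []) (j : ℕ) :
    ∃ k₀, ∀ k, k₀ ≤ k → D.Dir t E j (D.geod (D.map^[t * k] P)) := by
  have hD := hB.toIsTrackMap
  have hEa := noAux_of_not_rel hD hE.1
  obtain ⟨S, hS⟩ := hP
  rcases hM.1.retract_eq_append hD hS.symm with ⟨M₁, M₂, w, rfl, h1, h2, rfl, rfl⟩ |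
    ⟨M₁, g, g', M₂, P', S', rfl, hg, h1, h2, rfl, rfl, h3, h4, h5⟩
  · cases M₁ with
    | nil => exact absurd rfl hne
    | cons x M₁ =>
      obtain ⟨rfl, -⟩ := List.cons_prefix_cons.1 ((List.prefix_append _ _).trans hMR)
      have hM₁ := SL.prefix hD hM h1
      refine ⟨j, fun k hk => ?_⟩
      rw [geod_map_iterate hD (h1.retract hD) h1 (geod_retract hD h1), hM₁.geod_map hB]
      exact (ray_endsOff t x j).retract_prefix hD (hM₁.map_iterate hB (t * k)).1
        ((ray_mono hD hE hk).trans (ray_prefix hD t x k M₁))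
  · cases M₁ with
    | nil =>
      obtain ⟨rfl, -⟩ := List.cons_prefix_cons.1 hMR
      exact absurd (hg.isRel hD).1 hE.1
    | cons x M₁ =>
      obtain ⟨rfl, -⟩ := List.cons_prefix_cons.1 (((List.prefix_append _ _).trans
        (List.prefix_append _ _)).trans hMR)
      obtain ⟨J, hJ⟩ := exists_dir_attach hB ht1 ht
      have hlen : (D.retr [g, g']).length < (D.retract (x :: M₁ ++ [g, g'] ++ M₂)).length := by
        rw [List.append_assoc, retract_append hD h1, retract_append hD (hg.seg hD),
          hg.retract_pair, D.retract_edge hEa]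
        simp
        omega
      obtain ⟨k₀, hk₀⟩ := ih g g' hg hlen P' S' h3 h4 h5 J
      refine ⟨max j k₀, fun k hk => ?_⟩
      have h6 := SL.prefix hD hM (h1.append (hg.seg hD))
      have h7 := hJ x M₁ g g' u _ _ hE hg h6 (D.G.nf_reduced _)
        (hk₀ k ((le_max_right _ _).trans hk)) j k ((le_max_left _ _).trans hk)
      rw [map_iterate_append, geod_append hD ((h1.retract hD).map_iterate hD _),
        geod_map_iterate hD (h1.retract hD) h1 (geod_retract hD h1)]
      exact h7

/-- The image of an initial part of a pre-INP, in terms of the image of the final part. -/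
theorem IsPeriod.geod_map_prefix (hB : IsBetaTrainTrack D α) {t : ℕ} (ht : D.IsPeriod t)
    {h h' : D.G.E} (hh : D.IsAuxEdge h h') {P S : List D.G.E} (hPS : D.retr [h, h'] = P ++ S)
    (k : ℕ) :
    D.geod (D.map^[t * k] P) =
      D.G.nf (D.retr [h, h'] ++ D.geod (D.map^[t * k] (D.G.rev S))) := by
  have hD := hB.toIsTrackMap
  have h1 := hh.retr_seg hD
  rw [hPS] at h1
  have hno : D.NoAux (P ++ S) := hPS ▸ (hD.retr_aux h h' hh).2
  obtain ⟨w, h2, h3⟩ := D.G.isPath_append_iff.1 h1.2.2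
  have hP : D.Seg (D.G.src h) P w := NoAux.seg (fun e he => hno e (by simp [he])) h1.1 h2
  have hS : D.Seg w S (D.G.tgt h') := ⟨hP.2.1, h1.2.1, h3⟩
  have h4 : D.geod (D.map^[t * k] (P ++ S)) = D.retr [h, h'] := by
    rw [← hPS]
    refine (geod_map_iterate hD (hh.retr_seg hD) (hh.seg hD) ?_ _).trans
      (ht.geod_map_pair hB hh k).2
    rw [hh.geod_pair hD, geod, retract_noAux _ (hD.retr_aux h h' hh).2,
      D.G.nf_eq_self (hh.retr_reduced hD)]
  rw [map_iterate_append, geod_append hD (hP.map_iterate hD _)] at h4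
  rw [map_iterate_rev hD, geod_rev hD (hS.map_iterate hD _), ← h4, D.G.nf_nf_append,
    List.append_assoc, ← D.G.nf_append_nf, D.G.nf_append_rev, List.append_nil]
  exact (D.G.nf_nf _).symm

/-- The proper initial parts of pre-INPs grow. The INP is cut into two branches, which are initial
parts of rays. If the cut is at an auxiliary vertex, then the auxiliary edge which is cut is
shorter, so that induction applies to it. -/
theorem properPartsGrow (hB : IsBetaTrainTrack D α) {t : ℕ} (ht1 : 1 ≤ t) (ht : D.IsPeriod t)
    {h h' : D.G.E} (hh : D.IsAuxEdge h h') : D.ProperPartsGrow t h h' := by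
  have hD := hB.toIsTrackMap
  induction hm : (D.retr [h, h']).length using Nat.strong_induction_on generalizing h h' with
  | _ m ih =>
    subst hm
    replace ih : ∀ g g', D.IsAuxEdge g g' → (D.retr [g, g']).length < (D.retr [h, h']).length →
      D.ProperPartsGrow t g g' := fun g g' hg hlt => ih _ hlt hg rfl
    intro P S hPS hP hS j
    obtain ⟨J, hJ⟩ := exists_dir_append hB ht1 ht hh j
    obtain ⟨Ja, hJa⟩ := exists_dir_attach hB ht1 ht
    have hf := isFixedDir_dir hB ht1 ht hh
    have hf' := isFixedDir_dir hB ht1 ht hh.rev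
    obtain ⟨R, -, hR, -, -⟩ := hh.dir_spec hB
    obtain ⟨R', -, hR', -, -⟩ := hh.rev.dir_spec hB
    rw [hD.eta_rev h h' hh] at hR'
    obtain ⟨i, a, b, d, -, heta, ha, hb, hd, hdne, -, hp, hp'⟩ := exists_common_end hB ht1 ht hh 0
    obtain ⟨v, hv⟩ := ray_sl hB hf i
    obtain ⟨v', hv'⟩ := ray_sl hB hf' i
    obtain ⟨w, hw⟩ := (hd.append hdne).sl_prefix hD hv hp
    obtain ⟨w', hw'⟩ := (hd.append hdne).sl_prefix hD hv' hp'
    have hseg := hh.eta_seg hD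
    have hretr := hh.retract_eta hD
    have hsrc : D.G.src (D.dir h h') = D.G.src h := by
      have := hseg.2.2; rw [hR] at this; exact this.1
    have hsrc' : D.G.src (D.dir (D.G.inv h') (D.G.inv h)) = D.G.tgt h' := by
      have := hseg.2.2.rev; rw [hR'] at this; exact this.1
    rw [hsrc] at hw
    rw [hsrc'] at hw'
    rw [heta] at hseg hR hretr
    rw [heta, D.G.rev_append] at hR'
    -- the case that `P` is covered by the first branch
    have front : ∀ {M w}, D.SL (D.G.src h) M w → M <+: a → D.retract M <+: D.retr [h, h'] →
        P <+: D.retract M → ∃ k₀, ∀ k, k₀ ≤ k →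
          D.Dir t (D.dir h h') j (D.geod (D.map^[t * k] P)) := by
      intro M w hM hMa hMr hPM
      refine dir_of_prefix_retract hB ht1 ht hf hM (R := R)
        (hR ▸ hMa.trans (List.prefix_append _ _)) (fun g g' hg hlt => ih g g' hg ?_) hPM hP j
      exact hlt.trans_le hMr.length_le
    -- the case that `S` is covered by the second branch, seen from the end of the pre-INP
    have back : ∀ {M w}, D.SL (D.G.tgt h') M w → M <+: D.G.rev b →
        D.retract M <+: D.G.rev (D.retr [h, h']) → D.G.rev S <+: D.retract M →
        ∃ k₀, ∀ k, k₀ ≤ k → D.Dir t (D.dir h h') j (D.geod (D.map^[t * k] P)) := by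
      intro M w hM hMb hMr hSM
      obtain ⟨k₀, hk₀⟩ := dir_of_prefix_retract hB ht1 ht hf' hM (R := R')
        (hR' ▸ hMb.trans (List.prefix_append _ _)) (fun g g' hg hlt => ih g g' hg
          (hlt.trans_le (by simpa using hMr.length_le))) hSM
        (fun h => hS (D.G.rev_eq_nil.1 h)) J
      refine ⟨k₀, fun k hk => ?_⟩
      rw [ht.geod_map_prefix hB hh hPS]
      exact hJ _ (D.G.nf_reduced _) (hk₀ k hk)
    obtain ⟨x, hxa, hxb, hx⟩ := hseg.split
    by_cases hxaux : D.IsAuxV x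
    · obtain ⟨a, h₁, rfl⟩ := (List.eq_nil_or_concat a).resolve_left ha
      obtain ⟨h₂, b, rfl⟩ := List.exists_cons_of_ne_nil hb
      obtain ⟨h₃, d, rfl⟩ := List.exists_cons_of_ne_nil hdne
      simp only [List.concat_eq_append, D.G.rev_cons] at *
      have ht₁ : D.G.tgt h₁ = x := hxa.tgt_last
      have hs₂ : D.G.src h₂ = x := hxb.1
      have hreda := hw.reduced
      have hredb := hw'.reduced
      have hrede := (hB.eta_INP h h' hh).2.1
      rw [heta] at hrede
      have hs₃ : D.G.src h₃ = x := by
        obtain ⟨y, h4, h5⟩ := D.G.isPath_append_iff.1 hw.1.2.2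
        rw [← ht₁, h4.tgt_last]; exact h5.1
      have n₁₂ : D.IsAuxEdge h₁ h₂ := ⟨ht₁ ▸ hxaux, hs₂.trans ht₁.symm,
        ((D.G.reduced_append_iff).1 hrede).2.2 h₁ (by simp) h₂ (by simp)⟩
      have n₁₃ : D.IsAuxEdge h₁ h₃ := ⟨ht₁ ▸ hxaux, hs₃.trans ht₁.symm,
        ((D.G.reduced_append_iff).1 hreda).2.2 h₁ (by simp) h₃ (by simp)⟩
      have n₂₃ : D.IsAuxEdge (D.G.inv h₂) h₃ := ⟨by rw [D.G.tgt_inv, hs₂]; exact hxaux,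
        by rw [D.G.tgt_inv, hs₂, hs₃],
        ((D.G.reduced_append_iff).1 hredb).2.2 (D.G.inv h₂) (by simp) h₃ (by simp)⟩
      have sa := (Seg.rhat_split hD n₁₃ (l₁ := a) (l₂ := d) (by simpa using hw.1)).1
      have sb := (Seg.rhat_split hD n₂₃ (l₁ := D.G.rev b) (l₂ := d) (by simpa using hw'.1)).1
      have sla := SL.prefix hD (B := [h₁] ++ h₃ :: d) (by simpa using hw) sa
      have slb := SL.prefix hD (B := [D.G.inv h₂] ++ h₃ :: d) (by simpa using hw') sb
      have sl₃ : D.SL (D.G.src h) (a ++ [h₁, h₃]) (D.G.tgt h₃) :=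
        SL.prefix hD (B := d) (by simpa using hw) (sa.append (n₁₃.seg hD))
      have hdec : D.retr [h, h'] = D.retract a ++ (D.retr [h₁, h₂] ++ D.retract b) := by
        rw [← hretr, show a ++ [h₁] ++ h₂ :: b = a ++ ([h₁, h₂] ++ b) by simp,
          retract_append hD sa, retract_append hD (n₁₂.seg hD), n₁₂.retract_pair]
      have hrb : D.retract (D.G.rev b) = D.G.rev (D.retract b) := by
        have := retract_rev hD sb.rev
        simpa using this
      have hra : D.retract a <+: D.retr [h, h'] := by rw [hdec]; exact List.prefix_append _ _
      have hrb' : D.retract (D.G.rev b) <+: D.G.rev (D.retr [h, h']) := by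
        rw [hrb, hdec, D.G.rev_append, D.G.rev_append, List.append_assoc]
        exact List.prefix_append _ _
      by_cases hPa : P <+: D.retract a
      · exact front sla (List.prefix_append _ _) hra hPa
      by_cases hSb : D.G.rev S <+: D.retract (D.G.rev b)
      · exact back slb (List.prefix_append _ _) hrb' hSb
      -- The cut lies inside the auxiliary edge `h₁ h₂`. In the ray, the path `a` is continued by
      -- the auxiliary edge `h₁ h₃` instead, which has the same direction as `h₁ h₂`.
      obtain ⟨P', rfl⟩ : D.retract a <+: P :=
        (List.prefix_or_prefix_of_prefix (hPS ▸ List.prefix_append _ _) hra).resolve_left hPa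
      rw [hdec, List.append_assoc, List.append_cancel_left_eq] at hPS
      have hP' : P' ≠ [] := by rintro rfl; exact hPa (by simp)
      obtain ⟨S', hS'⟩ : ∃ S', D.retr [h₁, h₂] = P' ++ S' := by
        rcases List.append_eq_append_iff.1 hPS with ⟨y, h4, h5⟩ | ⟨y, h4, h5⟩
        · exact absurd (by rw [hrb, h5, D.G.rev_append]; exact List.prefix_append _ _) hSb
        · exact ⟨y, h4⟩
      have hS'' : S = S' ++ D.retract b := by
        rw [hS', List.append_assoc, List.append_cancel_left_eq] at hPS
        exact hPS.symm
      have hS'ne : S' ≠ [] := by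
        rintro rfl
        exact hSb (by rw [hrb, hS'']; simp)
      cases a with
      | nil =>
        simp only [List.nil_append, List.singleton_append] at hR
        exact absurd ((List.cons.inj hR).1 ▸ (n₁₂.isRel hD).1) hf.1
      | cons y a =>
        have hy : y = D.dir h h' := by
          simp only [List.cons_append] at hR
          exact (List.cons.inj hR).1
        subst hy
        have hlt : (D.retr [h₁, h₂]).length < (D.retr [h, h']).length := by
          rw [hdec, D.retract_edge (noAux_of_not_rel hD hf.1)]
          simp
          omega
        obtain ⟨k₀, hk₀⟩ := ih h₁ h₂ n₁₂ hlt P' S' hS' hP' hS'ne Ja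
        refine ⟨max j k₀, fun k hk => ?_⟩
        have h7 := hJa _ a h₁ h₃ _ _ _ hf n₁₃ sl₃ (D.G.nf_reduced _)
          (n₁₂.dir_eq hB n₁₃ ▸ hk₀ k ((le_max_right _ _).trans hk)) j k
          ((le_max_left _ _).trans hk)
        rw [map_iterate_append, geod_append hD ((sa.retract hD).map_iterate hD _),
          geod_map_iterate hD (sa.retract hD) sa (geod_retract hD sa)]
        exact h7
    · obtain ⟨sa, sb⟩ := hx hxaux
      rw [retract_append hD sa] at hretr
      have sla := SL.prefix hD hw sa
      have slb := SL.prefix hD hw' sb.rev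
      have hra : D.retract a <+: D.retr [h, h'] := by rw [← hretr]; exact List.prefix_append _ _
      have hrb : D.retract (D.G.rev b) <+: D.G.rev (D.retr [h, h']) := by
        rw [retract_rev hD sb, ← hretr, D.G.rev_append]
        exact List.prefix_append _ _
      by_cases hPa : P <+: D.retract a
      · exact front sla List.prefix_rfl hra hPa
      · refine back slb List.prefix_rfl hrb ?_
        rw [hPS] at hretr
        rcases List.append_eq_append_iff.1 hretr with ⟨y, h4, h5⟩ | ⟨y, h4, h5⟩
        · rw [retract_rev hD sb, h5, D.G.rev_append]
          exact List.prefix_append _ _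
        · exact absurd (h4 ▸ List.prefix_append _ _) hPa

end TrackData

/-! ### Injectivity on homotopy classes of paths -/

namespace SerreGraph

theorem nf_rev_append_append (G : SerreGraph) (B C : List G.E) :
    G.nf (G.rev B ++ (B ++ C)) = G.nf C := by
  rw [← List.append_assoc, ← G.nf_nf_append, G.nf_rev_append, List.nil_append]

theorem nf_append_rev_append (G : SerreGraph) (B C : List G.E) :
    G.nf (B ++ (G.rev B ++ C)) = G.nf C := by
  rw [← List.append_assoc, ← G.nf_nf_append, G.nf_append_rev, List.nil_append]

end SerreGraph

namespace TrackData

variable {D : TrackData} {n : ℕ} {α : MulAut (FreeGroup (Fin n))}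

theorem pathHomotopic_of_nf {u v : D.G.V} {l l' : List D.G.E} (hl : D.G.IsPath u l v)
    (hl' : D.G.IsPath u l' v) (h : D.G.nf l = D.G.nf l') : D.G.PathHomotopic D.Rule u v l l' := by
  have key : ∀ {l}, D.G.IsPath u l v → D.G.PathHomotopic D.Rule u v l (D.G.nf l) :=
    fun hl => D.G.pathHomotopic_red (fun e _ => Or.inl ⟨e, rfl, rfl⟩) hl
  exact (key hl).trans (h ▸ (key hl').symm)

/-- Since the map represents an automorphism, it is injective on homotopy classes of paths. -/
theorem pathHomotopic_of_map (hB : IsBetaTrainTrack D α) {u v : D.G.V} {l l' : List D.G.E}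
    (hl : D.G.IsPath u l v) (hl' : D.G.IsPath u l' v)
    (h : D.G.PathHomotopic D.Rule (D.fV u) (D.fV v) (D.map l) (D.map l')) :
    D.G.PathHomotopic D.Rule u v l l' := by
  have hD := hB.toIsTrackMap
  obtain ⟨θ, ⟨hθ, -⟩, ⟨c₀, hc₀, hrep⟩, -⟩ := hB.marking
  obtain ⟨c, hc⟩ := hD.connected u
  have hnil : D.G.IsPath D.base [] D.base := rfl
  have hone : θ [] = 1 := by simpa using (hθ [] [] hnil hnil).1
  have happ := @SerreGraph.isPath_append D.G
  have hA : D.G.IsPath D.base (c ++ (l ++ (D.G.rev l' ++ D.G.rev c))) D.base :=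
    happ hc (happ hl (happ hl'.rev hc.rev))
  have hmc := isPath_map hD hc
  have hml := isPath_map hD hl
  have hml' := isPath_map hD hl'
  have h1 : D.G.PathHomotopic D.Rule D.base D.base
      (c₀ ++ D.map (c ++ (l ++ (D.G.rev l' ++ D.G.rev c))) ++ D.G.rev c₀) [] := by
    have h2 := h.append (happ hc₀ hmc) (happ hml'.rev (happ hmc.rev hc₀.rev))
    have h3 : D.G.IsPath D.base (c₀ ++ D.map c ++ D.map l' ++ (D.G.rev (D.map l') ++
        (D.G.rev (D.map c) ++ D.G.rev c₀))) D.base :=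
      happ (happ (happ hc₀ hmc) hml') (happ hml'.rev (happ hmc.rev hc₀.rev))
    have h4 := h2.trans (pathHomotopic_of_nf h3 hnil (by
      rw [List.append_assoc, ← D.G.nf_append_nf, D.G.nf_append_rev_append, D.G.nf_append_nf,
        List.append_assoc, ← D.G.nf_append_nf, D.G.nf_append_rev_append, D.G.nf_append_nf,
        D.G.nf_append_rev]; rfl))
    simpa [map_append, map_rev hD] using h4
  have h2 : θ (c ++ (l ++ (D.G.rev l' ++ D.G.rev c))) = 1 := by
    have h3 := (hθ _ [] (h1.isPath_iff.2 hnil) hnil).2.2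
      (D.G.homotopic_iff.2 ⟨_, _, h1.isPath_iff.2 hnil, hnil, h1⟩)
    rw [hrep _ hA, hone] at h3
    exact (map_eq_one_iff α α.injective).1 h3
  have h3 := ((hθ _ [] hA hnil).2.1 (h2.trans hone.symm)).pathHomotopic hA hnil
  have h4 := h3.append hc.rev (happ hc hl')
  have e1 : D.G.nf l = D.G.nf (D.G.rev c ++ (c ++ (l ++ (D.G.rev l' ++ D.G.rev c))) ++
      (c ++ l')) := by
    rw [List.append_assoc, List.append_assoc, D.G.nf_rev_append_append, List.append_assoc,
      List.append_assoc, ← D.G.nf_append_nf, ← D.G.nf_append_nf (D.G.rev l'),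
      D.G.nf_rev_append_append, D.G.nf_append_nf (D.G.rev l'), D.G.nf_rev_append, List.append_nil]
  have e2 : D.G.nf (D.G.rev c ++ [] ++ (c ++ l')) = D.G.nf l' := by
    rw [List.append_nil, D.G.nf_rev_append_append]
  exact (pathHomotopic_of_nf hl (happ (happ hc.rev hA) (happ hc hl')) e1).trans
    (h4.trans (pathHomotopic_of_nf (happ (happ hc.rev hnil) (happ hc hl')) hl' e2))

/-- Iterates of the map are injective on geodesics between vertices of `Γ`. -/
theorem geod_injective (hB : IsBetaTrainTrack D α) {u v : D.G.V} {l l' : List D.G.E}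
    (hl : D.Seg u l v) (hl' : D.Seg u l' v) (k : ℕ)
    (h : D.geod (D.map^[k] l) = D.geod (D.map^[k] l')) : D.geod l = D.geod l' := by
  have hD := hB.toIsTrackMap
  induction k with
  | zero => exact h
  | succ k ih =>
    have h1 := hl.map_iterate hD k
    have h2 := hl'.map_iterate hD k
    rw [Function.iterate_succ_apply', Function.iterate_succ_apply'] at h
    have := (pathHomotopic_iff_geod hD (h1.map hD) (h2.map hD)).2 h
    exact ih ((pathHomotopic_iff_geod hD h1 h2).1 (pathHomotopic_of_map hB h1.2.2 h2.2.2 this))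

/-! ### Pre-INPs in the retraction of a path in the relative part -/

/-- An arc which leaves an auxiliary star does not cancel with the retraction of the preceding
path in `X`. -/
theorem head_retract_append_ne (hB : IsBetaTrainTrack D α) {e₁ e₂ f₁ f₂ : D.G.E}
    {Z W : List D.G.E} (he : D.IsAuxEdge e₁ e₂) (hf : D.IsAuxEdge f₁ f₂)
    (hZ : D.Seg (D.G.tgt e₂) Z (D.G.src f₁)) (hX : D.InX Z)
    (hr : D.G.Reduced ([e₁, e₂] ++ (Z ++ [f₁, f₂]))) (hW : D.G.Reduced W)
    (hWf : W.head? = some (D.dir f₁ f₂)) :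
    (D.G.nf (D.retract Z ++ W)).head? ≠ some (D.dir (D.G.inv e₂) (D.G.inv e₁)) := by
  have hD := hB.toIsTrackMap
  have h1 := retract_reduced_of_inX hB ((he.seg hD).append (hZ.append (hf.seg hD)))
    ((he.inX hD).append (hX.append (hf.inX hD))) hr
  rw [retract_append hD (he.seg hD), retract_append hD hZ, he.retract_pair, hf.retract_pair,
    ← List.append_assoc] at h1
  obtain ⟨-, R, -, hR, -⟩ := hf.dir_spec hB
  have h2 := h1.replace_right hW (by rw [hWf, hR]; rfl)
  rw [List.append_assoc] at h2
  rw [D.G.nf_eq_self (h2.infix (List.suffix_append _ _).isInfix)]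
  intro h3
  obtain ⟨R', hR'⟩ := he.retr_last hB
  refine ((D.G.reduced_append_iff).1 h2).2.2
    (D.G.inv (D.dir (D.G.inv e₂) (D.G.inv e₁))) (by rw [hR']; simp) _ h3 ?_
  rw [D.G.inv_inv]

/-- If an arc leaves an auxiliary star, and together with a path in `X` it leaves another
auxiliary star, then the path in `X` is a part of one star. -/
theorem exists_star_of_dir (hB : IsBetaTrainTrack D α) {t : ℕ} (ht1 : 1 ≤ t)
    (ht : D.IsPeriod t) :
    ∃ J, ∀ h h' g g' Z W, D.IsAuxEdge h h' → D.IsAuxEdge g g' →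
      D.Seg (D.G.tgt h') Z (D.G.src g) → D.InX Z → D.G.Reduced Z → D.G.Reduced W →
      D.Dir t (D.dir g g') J W →
      D.Dir t (D.dir (D.G.inv h') (D.G.inv h)) J (D.G.nf (D.retract Z ++ W)) →
      (g = D.G.inv h' ∧ Z = []) ∨
        (D.IsAuxEdge (D.G.inv h') (D.G.inv g) ∧ Z = [D.G.inv h', D.G.inv g]) := by
  have hD := hB.toIsTrackMap
  obtain ⟨J, hJ⟩ := exists_dir_star hB ht1 ht 0
  refine ⟨J, fun h h' g g' Z W hh hg hZ hX hr hW hdW hd => ?_⟩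
  -- remove an auxiliary edge at the end of `Z` which cancels with the arc
  obtain ⟨f₁, f₂, Z₁, W₁, hf, hZ₁, hr₁, hW₁, hhead, hnf, hcase⟩ : ∃ f₁ f₂ Z₁ W₁,
      D.IsAuxEdge f₁ f₂ ∧ D.Seg (D.G.tgt h') Z₁ (D.G.src f₁) ∧ D.G.Reduced (Z₁ ++ [f₁, f₂]) ∧
      D.G.Reduced W₁ ∧ W₁.head? = some (D.dir f₁ f₂) ∧
      D.G.nf (D.retract Z ++ W) = D.G.nf (D.retract Z₁ ++ W₁) ∧
      ((f₁ = g ∧ f₂ = g' ∧ Z = Z₁) ∨ (f₂ = D.G.inv g ∧ Z = Z₁ ++ [f₁, D.G.inv g])) := by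
    by_cases hend : ∃ L₀, Z = L₀ ++ [D.G.inv g]
    · obtain ⟨L₀, rfl⟩ := hend
      obtain ⟨Z₁, f₁, rfl, hf, hs⟩ := hZ.ends_auxEdge hD hr (by exact hg.1)
      rw [List.append_assoc, List.singleton_append] at *
      refine ⟨f₁, D.G.inv g, Z₁, D.G.nf (D.retr [f₁, D.G.inv g] ++ W), hf, hs, hr,
        D.G.nf_reduced _, ?_, ?_, Or.inr ⟨rfl, rfl⟩⟩
      · exact (hJ _ _ g' hf (by rwa [D.G.inv_inv]) W hW (by rwa [D.G.inv_inv])).head hD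
          (isFixedDir_dir hB ht1 ht hf)
      · rw [retract_append hD hs, hf.retract_pair, List.append_assoc, D.G.nf_append_nf]
    · refine ⟨g, g', Z, W, hg, hZ, ?_, hW, hdW.head hD (isFixedDir_dir hB ht1 ht hg), rfl,
        Or.inl ⟨rfl, rfl, rfl⟩⟩
      rw [D.G.reduced_append_iff]
      refine ⟨hr, hg.reduced_pair, fun x hx y hy hyx => hend ?_⟩
      obtain rfl : g = y := by simpa using hy
      rw [Option.mem_def, List.getLast?_eq_some_iff] at hx
      obtain ⟨L₀, hx⟩ := hx
      exact ⟨L₀, by rw [hx, hyx, D.G.inv_inv]⟩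
  have hX₁ : D.InX Z₁ := by
    rcases hcase with ⟨-, -, rfl⟩ | ⟨-, rfl⟩
    · exact hX
    · exact hX.subset (List.subset_append_left _ _)
  rw [hnf] at hd
  by_cases hstart : ∃ L₀, Z₁ = D.G.inv h' :: L₀
  · -- an auxiliary edge at the beginning of `Z` is removed as well
    exfalso
    obtain ⟨L₀, rfl⟩ := hstart
    have haux : D.IsAuxV (D.G.tgt (D.G.inv h')) := by rw [D.G.tgt_inv, hh.2.1]; exact hh.1
    rcases hZ₁.front hD with h0 | ⟨e, l', he, h0⟩ | ⟨e, e₂, Z₂, -, he₂, -, h0, hs⟩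
    · simp at h0
    · obtain ⟨rfl, -⟩ := List.cons.inj h0
      exact he (Or.inr haux)
    · obtain ⟨rfl, rfl⟩ := List.cons.inj h0
      have ha : D.IsAuxEdge (D.G.inv h') e₂ := ⟨haux, he₂,
        (List.isChain_cons_cons.1 hr₁).1⟩
      refine head_retract_append_ne hB ha hf hs (hX₁.subset (by simp)) (by simpa using hr₁)
        hW₁ hhead ?_
      have har := ha.rev
      rw [D.G.inv_inv] at har ⊢
      have h1 := (hJ _ _ (D.G.inv h) har hh.rev _ (D.G.nf_reduced _) hd).head hD
        (isFixedDir_dir hB ht1 ht har)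
      rw [D.retract_aux haux, ha.piece_eq, D.G.nf_append_nf, List.append_assoc] at h1
      have h2 : D.retr [D.G.inv e₂, h'] = D.G.rev (D.retr [D.G.inv h', e₂]) := by
        rw [← ha.retr_rev hD, D.G.inv_inv]
      rwa [h2, D.G.nf_rev_append_append] at h1
  · by_cases hbad : Z₁ = [] ∧ f₁ = D.G.inv h'
    · obtain ⟨rfl, rfl⟩ := hbad
      rcases hcase with ⟨rfl, rfl, rfl⟩ | ⟨rfl, rfl⟩
      · exact Or.inl ⟨rfl, rfl⟩
      · exact Or.inr ⟨hf, rfl⟩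
    · exfalso
      refine head_retract_append_ne hB hh hf hZ₁ hX₁ ?_ hW₁ hhead
        (hd.head hD (isFixedDir_dir hB ht1 ht hh.rev))
      rw [D.G.reduced_append_iff]
      refine ⟨hh.reduced_pair, hr₁, fun x hx y hy hyx => ?_⟩
      obtain rfl : h' = x := by simpa using hx
      subst hyx
      cases Z₁ with
      | nil => exact hbad ⟨rfl, by simpa using hy⟩
      | cons z Z₁ => exact hstart ⟨Z₁, by simpa using hy⟩

/-- A pre-INP is not a proper initial part of another one, since it does not grow. -/
theorem retr_eq_of_prefix (hB : IsBetaTrainTrack D α) {k k' p p' : D.G.E}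
    (hk : D.IsAuxEdge k k') (hp : D.IsAuxEdge p p') {B : List D.G.E}
    (h : D.retr [k, k'] = D.retr [p, p'] ++ B) : B = [] := by
  have hD := hB.toIsTrackMap
  obtain ⟨t, ht1, ht⟩ := exists_isPeriod hB
  by_contra hne
  obtain ⟨k₀, hk₀⟩ := properPartsGrow hB ht1 ht hk _ _ h (hp.retr_ne_nil hB) hne
    (D.retr [p, p']).length
  have h1 := hk₀ k₀ le_rfl
  have h2 : D.geod (D.map^[t * k₀] (D.retr [p, p'])) = D.retr [p, p'] := by
    refine (geod_map_iterate hD (hp.retr_seg hD) (hp.seg hD) ?_ _).trans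
      (ht.geod_map_pair hB hp k₀).2
    rw [hp.geod_pair hD, geod, retract_noAux _ (hD.retr_aux _ _ hp).2,
      D.G.nf_eq_self (hp.retr_reduced hD)]
  rw [h2] at h1
  have h3 := pow_le_length_ray hB ht (isFixedDir_dir hB ht1 ht hk) (D.retr [p, p']).length
  have h4 := h1.length_le
  have h5 : (D.retr [p, p']).length < 2 ^ (D.retr [p, p']).length := Nat.lt_two_pow_self
  omega

/-- A pre-INP in the retraction of a reduced path in `X` does not run over parts of two different
auxiliary edges of this path. The two ends of the pre-INP would grow under iteration, but the
pre-INP does not, so that the path in `X` between the two auxiliary edges would eventually be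
homotopic to a part of one star. -/
theorem retr_ne_of_two_auxEdges (hB : IsBetaTrainTrack D α) {p p' q q' k k' : D.G.E}
    {Y P S Q Q' : List D.G.E} (hp : D.IsAuxEdge p p') (hq : D.IsAuxEdge q q')
    (hk : D.IsAuxEdge k k') (hY : D.Seg (D.G.tgt p') Y (D.G.src q)) (hX : D.InX Y)
    (hr : D.G.Reduced ([p, p'] ++ (Y ++ [q, q']))) (hPS : D.retr [p, p'] = P ++ S)
    (hQ : D.retr [q, q'] = Q ++ Q') (hS : S ≠ []) (hQne : Q ≠ []) :
    D.retr [k, k'] ≠ S ++ (D.retract Y ++ Q) := by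
  have hD := hB.toIsTrackMap
  obtain ⟨t, ht1, ht⟩ := exists_isPeriod hB
  intro hkk
  by_cases hP : P = []
  · subst hP
    rw [List.nil_append] at hPS
    have := retr_eq_of_prefix hB hk hp (hPS ▸ hkk)
    simp at this
    exact hQne this.2
  by_cases hQ' : Q' = []
  · subst hQ'
    rw [List.append_nil] at hQ
    have := retr_eq_of_prefix hB hk.rev hq.rev (B := D.G.rev (S ++ D.retract Y)) (by
      rw [hk.retr_rev hD, hkk, hq.retr_rev hD, hQ]; simp)
    rw [D.G.rev_eq_nil] at this
    simp at this
    exact hS this.1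
  obtain ⟨J, hJ⟩ := exists_star_of_dir hB ht1 ht
  have hfp := isFixedDir_dir hB ht1 ht hp.rev
  -- the number of iterations makes the images of `S` and `Q` longer than the fixed `retr [k, k']`
  obtain ⟨k₁, hk₁⟩ := properPartsGrow hB ht1 ht hq _ _ hQ hQne hQ' J
  obtain ⟨k₂, hk₂⟩ := properPartsGrow hB ht1 ht hp.rev (D.G.rev S) (D.G.rev P)
    (by rw [hp.retr_rev hD, hPS, D.G.rev_append]) (fun h => hS (D.G.rev_eq_nil.1 h))
    (fun h => hP (D.G.rev_eq_nil.1 h))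
    (max J ((D.retract (D.ray t (D.dir (D.G.inv p') (D.G.inv p)) J)).length +
      (D.retr [k, k']).length))
  set i := max k₁ k₂
  have h1 := hk₁ i (le_max_left _ _)
  have h2 := hk₂ i (le_max_right _ _)
  have hmp := ht.seg_map hB hp i
  have hmq := ht.seg_map hB hq i
  have hsegS : ∃ w, D.Seg w S (D.G.tgt p') := by
    have h3 := hp.retr_seg hD
    have h4 := (hD.retr_aux p p' hp).2
    rw [hPS] at h3 h4
    obtain ⟨w, h5, h6⟩ := D.G.isPath_append_iff.1 h3.2.2
    have h7 : D.Seg _ P w := NoAux.seg (fun e he => h4 e (by simp [he])) h3.1 h5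
    exact ⟨w, h7.2.1, h3.2.1, h6⟩
  obtain ⟨w, hsegS⟩ := hsegS
  have hYm := hY.map_iterate hD (t * i)
  rw [hmp.2, hmq.1] at hYm
  set Y' := D.xred (D.map^[t * i] Y) with hY'
  have hYX : D.InX Y' := (hX.map_iterate hD _).xred
  have hYr : D.G.Reduced Y' := by
    refine List.IsChain.imp_of_mem_imp ?_ (D.G.redOn_red D.IsRel (D.map^[t * i] Y))
    exact fun a b ha _ h => h (hYX a ha)
  have hgY : D.retract Y' = D.geod (D.map^[t * i] Y) := by
    rw [← geod_xred hD hYm, geod, D.G.nf_eq_self (retract_reduced_of_inX hB hYm.xred hYX hYr)]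
  set τ := D.geod (D.map^[t * i] Q) with hτ
  set U := D.G.nf (D.retract Y' ++ τ) with hU
  have hall : D.retr [k, k'] =
      D.G.nf (D.G.rev (D.geod (D.map^[t * i] (D.G.rev S))) ++ U) := by
    have h3 : D.geod (D.map^[t * i] (D.retr [k, k'])) = D.retr [k, k'] := by
      refine (geod_map_iterate hD (hk.retr_seg hD) (hk.seg hD) ?_ _).trans
        (ht.geod_map_pair hB hk i).2
      rw [hk.geod_pair hD, geod, retract_noAux _ (hD.retr_aux _ _ hk).2,
        D.G.nf_eq_self (hk.retr_reduced hD)]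
    rw [hkk, map_iterate_append, geod_append hD (hsegS.map_iterate hD _), map_iterate_append,
      geod_append hD ((hY.retract hD).map_iterate hD _),
      geod_map_iterate hD (hY.retract hD) hY (geod_retract hD hY), ← hkk, ← hgY, ← hU] at h3
    rw [map_iterate_rev hD, geod_rev hD (hsegS.map_iterate hD _), D.G.rev_rev, h3]
  -- The image of `S` is long but `retr [k, k']` is not, so that almost all of the image of `S` is
  -- cancelled by `U`. Hence `U` follows the ray of `S⁻¹`.
  have hdir : D.Dir t (D.dir (D.G.inv p') (D.G.inv p)) J U := by
    have hσr : D.G.Reduced (D.G.rev (D.geod (D.map^[t * i] (D.G.rev S)))) :=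
      D.G.reduced_rev (D.G.nf_reduced _)
    obtain ⟨a, c, b, e1, e2, e3⟩ := D.G.exists_cancellation hσr (D.G.nf_reduced _)
    rw [← hU] at e2 e3
    have h3 : D.geod (D.map^[t * i] (D.G.rev S)) = D.G.rev c ++ D.G.rev a := by
      rw [← D.G.rev_rev (D.geod _), e1, D.G.rev_append]
    have h4 : D.retract (D.ray t (D.dir (D.G.inv p') (D.G.inv p)) J) <+:
        D.G.rev c ++ D.G.rev a := h3 ▸ h2.mono hB hfp (le_max_left _ _)
    have h5 := h2.length_le
    have h6 := pow_le_length_ray hB ht hfp (max J ((D.retract (D.ray t (D.dir (D.G.inv p')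
      (D.G.inv p)) J)).length + (D.retr [k, k']).length))
    have h7 := le_max_right J ((D.retract (D.ray t (D.dir (D.G.inv p') (D.G.inv p)) J)).length +
      (D.retr [k, k']).length)
    have h8 := (Nat.lt_two_pow_self (n := max J ((D.retract (D.ray t (D.dir (D.G.inv p')
      (D.G.inv p)) J)).length + (D.retr [k, k']).length))).le
    have h9 : a.length ≤ (D.retr [k, k']).length := by rw [hall, e3]; simp
    rw [h3] at h5
    have h10 : (D.retract (D.ray t (D.dir (D.G.inv p') (D.G.inv p)) J)).length ≤
        (D.G.rev c).length := by
      rw [List.length_append, D.G.rev_length a] at h5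
      omega
    rw [Dir, e2]
    exact (List.prefix_of_prefix_length_le h4 (List.prefix_append _ _) h10).trans
      (List.prefix_append _ _)
  rcases hJ p p' q q' Y' τ hp hq hYm.xred hYX hYr (D.G.nf_reduced _) h1 hdir with
    ⟨rfl, hY0⟩ | ⟨ha, hY0⟩
  · have h3 : D.geod Y = D.geod [] := by
      have hnil : D.Seg (D.G.tgt p') [] (D.G.src (D.G.inv p')) := by
        have := Seg.nil hY.1; exact this
      refine geod_injective hB hY hnil (t * i) ?_
      rw [← geod_xred hD hYm, ← hY', hY0, map_iterate_nil]
    have h4 : Y = [] := by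
      have := xred_eq_of_geod_eq hB hY (Seg.nil hY.1 : D.Seg (D.G.tgt p') [] _) hX
        (by intro e he; simp at he) h3
      rw [D.xred_of_reduced (hr.infix ⟨[p, p'], [D.G.inv p', q'], by simp⟩)] at this
      exact this
    subst h4
    exact (List.isChain_cons_cons.1 (List.isChain_cons_cons.1 hr).2).1 rfl
  · have h3 : D.Seg (D.G.tgt p') [D.G.inv p', D.G.inv q] (D.G.src q) := by
      have := ha.seg hD
      rwa [D.G.tgt_inv q] at this
    have h4 : D.geod Y = D.geod [D.G.inv p', D.G.inv q] := by
      refine geod_injective hB hY h3 (t * i) ?_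
      rw [← geod_xred hD hYm, ← hY', hY0, (ht.geod_map_pair hB ha i).2, ha.geod_pair hD]
    have h5 := xred_eq_of_geod_eq hB hY h3 hX (ha.inX hD) h4
    rw [D.xred_of_reduced (hr.infix ⟨[p, p'], [q, q'], by simp⟩),
      D.xred_of_reduced ha.reduced_pair] at h5
    subst h5
    exact (List.isChain_cons_cons.1 (List.isChain_cons_cons.1 hr).2).1 rfl

end TrackData

/-! ### Isolated pre-INPs -/

namespace TrackData

variable {D : TrackData} {n : ℕ} {α : MulAut (FreeGroup (Fin n))}

/-- An edge of the train track part in the retraction of a reduced path in `X` belongs to the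
pre-INP of an auxiliary edge of this path. -/
theorem exists_auxEdge_of_retract_eq (hB : IsBetaTrainTrack D α) {u v : D.G.V}
    {y A B : List D.G.E} {e : D.G.E} (hy : D.Seg u y v) (hX : D.InX y) (hr : D.G.Reduced y)
    (he : ¬ D.IsRel e) (h : D.retract y = A ++ e :: B) :
    ∃ y₁ p p' y₂ P S, y = y₁ ++ [p, p'] ++ y₂ ∧ D.IsAuxEdge p p' ∧ D.Seg u y₁ (D.G.src p) ∧
      D.Seg (D.G.tgt p') y₂ v ∧ D.retr [p, p'] = P ++ e :: S ∧ A = D.retract y₁ ++ P ∧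
      B = S ++ D.retract y₂ := by
  have hD := hB.toIsTrackMap
  rcases hy.retract_eq_append hD h with ⟨M₁, M₂, w, rfl, h1, h2, rfl, h4⟩ |
    ⟨M₁, g, g', M₂, P', S', rfl, hg, h1, h2, rfl, h3, h4, h5, h6⟩
  · rcases h2.front hD with rfl | ⟨x, l, hx, rfl⟩ | ⟨p, p', l, hp, hp', hs, rfl, hl⟩
    · simp at h4
    · rw [D.retract_edge hx] at h4
      exact absurd (hX x (by simp)) ((List.cons.inj h4).1 ▸ he)
    · have hpp : D.IsAuxEdge p p' := ⟨hp, hp', (List.isChain_cons_cons.1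
        (hr.infix (List.suffix_append M₁ _).isInfix)).1⟩
      obtain ⟨z, R, hR⟩ := List.exists_cons_of_ne_nil (hpp.retr_ne_nil hB)
      rw [D.retract_aux hp, hpp.piece_eq, hR] at h4
      obtain ⟨rfl, rfl⟩ := List.cons.inj h4
      exact ⟨M₁, p, p', l, [], R, by simp, hpp, hs ▸ h1, hl, hR, by simp, rfl⟩
  · obtain ⟨z, R, rfl⟩ := List.exists_cons_of_ne_nil h6
    obtain ⟨rfl, rfl⟩ := List.cons.inj h3
    exact ⟨M₁, g, g', M₂, P', R, rfl, hg, h1, h2, h4, by simp, rfl⟩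

/-- Two auxiliary edges of a path are equal or disjoint. -/
theorem Seg.auxEdge_trichotomy (hD : IsTrackMap D) {u : D.G.V} {z₁ z₂ x₁ x₂ : List D.G.E}
    {q q' r r' : D.G.E} (hz : D.Seg u z₁ (D.G.src q)) (hq : D.IsAuxEdge q q')
    (hr : D.IsAuxEdge r r') (h : z₁ ++ [q, q'] ++ z₂ = x₁ ++ [r, r'] ++ x₂) :
    (z₁ = x₁ ∧ q = r ∧ q' = r') ∨
      (∃ m, x₁ = z₁ ++ [q, q'] ++ m ∧ z₂ = m ++ [r, r'] ++ x₂) ∨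
      ∃ m, z₁ = x₁ ++ [r, r'] ++ m := by
  rw [List.append_assoc] at h
  rcases hz.auxEdge_position hr h with ⟨m, rfl, hm⟩ | ⟨m, hm, -⟩
  · match m, hm with
    | [], hm =>
      simp at hm
      exact Or.inl ⟨by simp, hm.1, hm.2.1⟩
    | [a], hm =>
      simp at hm
      obtain ⟨rfl, rfl, -⟩ := hm
      exact absurd hr.1 (hD.aux_ends _ (hq.2.1 ▸ hq.1))
    | a :: b :: m, hm =>
      simp at hm
      obtain ⟨rfl, rfl, hm⟩ := hm
      exact Or.inr (Or.inl ⟨m, by simp, by simp [hm]⟩)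
  · exact Or.inr (Or.inr ⟨m, hm⟩)

/-- In the retraction of a reduced path in `X`, the pre-INP of an auxiliary edge of the path
contains all pre-INPs which meet it in more than a point. -/
theorem contains_of_overlap (hB : IsBetaTrainTrack D α) {u v : D.G.V}
    {y₁ y₂ A B : List D.G.E} {p p' k k' : D.G.E} (hy : D.Seg u (y₁ ++ [p, p'] ++ y₂) v)
    (hX : D.InX (y₁ ++ [p, p'] ++ y₂)) (hr : D.G.Reduced (y₁ ++ [p, p'] ++ y₂))
    (hp : D.IsAuxEdge p p') (hk : D.IsAuxEdge k k')
    (h : D.retract (y₁ ++ [p, p'] ++ y₂) = A ++ D.retr [k, k'] ++ B)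
    (h₁ : (D.retract y₁).length < A.length + (D.retr [k, k']).length)
    (h₂ : A.length < (D.retract y₁).length + (D.retr [p, p']).length) :
    (D.retract y₁).length ≤ A.length ∧
      A.length + (D.retr [k, k']).length ≤ (D.retract y₁).length + (D.retr [p, p']).length := by
  have hD := hB.toIsTrackMap
  have hy₁ := (Seg.rhat_split hD hp hy).1
  obtain ⟨E, -, R, -, hR, hE⟩ := hk.exists_head hB
  obtain ⟨E', -, R', -, hR', hE'⟩ := hk.exists_last hB
  -- the pre-INP starts and ends inside pre-INPs of auxiliary edges of the path
  obtain ⟨z₁, q, q', z₂, P, S, hz, hq, hz₁, hz₂, hqr, hA, hB₁⟩ :=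
    exists_auxEdge_of_retract_eq hB hy hX hr hE (A := A) (B := R ++ B) (by rw [h, hR]; simp)
  obtain ⟨x₁, r, r', x₂, P₂, S₂, hx, hrr, hx₁, hx₂, hrr', hA₂, hB₂⟩ :=
    exists_auxEdge_of_retract_eq hB hy hX hr hE' (A := A ++ R') (B := B) (by rw [h, hR']; simp)
  have hlen : ∀ {u l p p' m}, D.Seg u l (D.G.src p) → D.IsAuxEdge p p' →
      (D.retract (l ++ [p, p'] ++ m)).length =
        (D.retract l).length + (D.retr [p, p']).length + (D.retract m).length := by
    intro u l p p' m hl hp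
    rw [List.append_assoc, retract_append hD hl, retract_append hD (hp.seg hD), hp.retract_pair]
    simp
    omega
  have l1 := congrArg List.length hA
  have l2 := congrArg List.length hA₂
  have l3 := congrArg List.length hqr
  have l4 := congrArg List.length hrr'
  have l5 := congrArg List.length hR
  have l6 := congrArg List.length hR'
  simp only [List.length_append, List.length_cons, List.length_nil] at l1 l2 l3 l4 l5 l6
  rcases hz₁.auxEdge_trichotomy hD hq hrr (hz.symm.trans hx) with ⟨rfl, rfl, rfl⟩ |
    ⟨m, rfl, rfl⟩ | ⟨m, rfl⟩
  · -- the pre-INP is contained in the one of the auxiliary edge `q q'`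
    rcases hy₁.auxEdge_trichotomy hD hp hq hz with ⟨rfl, rfl, rfl⟩ | ⟨m, rfl, -⟩ | ⟨m, rfl⟩
    · omega
    · rw [hlen hy₁ hp] at *
      omega
    · rw [hlen hz₁ hq] at *
      omega
  · exfalso
    have hm : D.Seg (D.G.tgt q') m (D.G.src r) := hx₁.of_append_left (hz₁.append (hq.seg hD))
    refine retr_ne_of_two_auxEdges hB hq hrr hk hm (hX.subset ?_) (hr.infix ?_) hqr
      (Q := P₂ ++ [E']) (Q' := S₂) (by rw [hrr']; simp) (by simp) (by simp) ?_
    · rw [hx]; intro a ha; simp [ha]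
    · exact ⟨z₁, x₂, by rw [hx]; simp⟩
    · rw [hx] at h
      have e1 : D.retract (z₁ ++ [q, q'] ++ m ++ [r, r'] ++ x₂) = D.retract z₁ ++ (D.retr [q, q'] ++
          (D.retract m ++ (D.retr [r, r'] ++ D.retract x₂))) := by
        rw [show z₁ ++ [q, q'] ++ m ++ [r, r'] ++ x₂ =
          z₁ ++ ([q, q'] ++ (m ++ ([r, r'] ++ x₂))) by simp,
          retract_append hD hz₁, retract_append hD (hq.seg hD), retract_append hD hm,
          retract_append hD (hrr.seg hD), hq.retract_pair, hrr.retract_pair]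
      rw [e1, hqr, hrr', hB₂, hA] at h
      simp only [List.append_assoc, List.append_cancel_left_eq, List.cons_append] at h
      have h' : (E :: S ++ (D.retract m ++ (P₂ ++ [E']))) ++ (S₂ ++ D.retract x₂) =
          D.retr [k, k'] ++ (S₂ ++ D.retract x₂) := by simpa using h
      exact (List.append_cancel_right h').symm
  · rw [hlen hx₁ hrr] at *
    omega

/-! ### Counting edges of normalized paths -/

/-- The path given by a list of edges and auxiliary edges. -/
def pathOf (D : TrackData) (ps : List (D.G.E ⊕ D.G.E × D.G.E)) : List D.G.E :=
  ps.flatMap (Sum.elim (fun e => [e]) (fun p => [p.1, p.2]))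

/-- The retraction of the path given by a list of edges and auxiliary edges. -/
noncomputable def imageOf (D : TrackData) (ps : List (D.G.E ⊕ D.G.E × D.G.E)) : List D.G.E :=
  ps.flatMap (Sum.elim (fun e => [e]) (fun p => D.retr [p.1, p.2]))

/-- The retraction of the path given by a list of edges and auxiliary edges, where the edges which
belong to the path itself are marked. -/
noncomputable def marked (D : TrackData) (ps : List (D.G.E ⊕ D.G.E × D.G.E)) :
    List (D.G.E × Bool) :=
  ps.flatMap (Sum.elim (fun e => [(e, true)]) (fun p => (D.retr [p.1, p.2]).map fun e => (e, false)))

open Classical in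
/-- The number of marked edges of the train track part. -/
noncomputable def markedCnt (D : TrackData) (w : List (D.G.E × Bool)) : ℕ :=
  w.countP fun x => decide (x.2 = true ∧ ¬ D.IsRel x.1)

theorem map_fst_marked (ps : List (D.G.E ⊕ D.G.E × D.G.E)) :
    (D.marked ps).map Prod.fst = D.imageOf ps := by
  induction ps with
  | nil => rfl
  | cons x ps ih =>
    rw [marked, imageOf, List.flatMap_cons, List.flatMap_cons, List.map_append, ← marked,
      ← imageOf, ih]
    cases x <;> simp [Function.comp_def]

/-- The items of the list are non-auxiliary edges and auxiliary edges. -/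
def IsItemList (D : TrackData) (ps : List (D.G.E ⊕ D.G.E × D.G.E)) : Prop :=
  ∀ x ∈ ps, Sum.elim (fun e => ¬ D.IsAux e) (fun p => D.IsAuxEdge p.1 p.2) x

theorem markedCnt_marked (hD : IsTrackMap D) {ps : List (D.G.E ⊕ D.G.E × D.G.E)}
    (hps : D.IsItemList ps) : D.markedCnt (D.marked ps) = D.cnt (D.pathOf ps) := by
  induction ps with
  | nil => rfl
  | cons x ps ih =>
    have ih := ih fun y hy => hps y (List.mem_cons_of_mem _ hy)
    have hx := hps x List.mem_cons_self
    rw [marked, pathOf, List.flatMap_cons, List.flatMap_cons, ← marked, ← pathOf, cnt_append,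
      markedCnt, List.countP_append, ← markedCnt, ← markedCnt, ih]
    congr 1
    cases x with
    | inl e => by_cases he : D.IsRel e <;> simp [markedCnt, cnt, he]
    | inr p =>
      rw [show D.cnt (Sum.elim (fun e => [e]) (fun p => [p.1, p.2]) (Sum.inr p)) = 0 from
        D.cnt_eq_zero.2 (IsAuxEdge.inX hD hx)]
      simp [markedCnt, List.countP_map, Function.comp_def]

/-- A marked edge is an item of the list. -/
theorem exists_of_marked_eq {ps : List (D.G.E ⊕ D.G.E × D.G.E)} {a b : List (D.G.E × Bool)}
    {e : D.G.E} (h : D.marked ps = a ++ (e, true) :: b) :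
    ∃ ps₁ ps₂, ps = ps₁ ++ Sum.inl e :: ps₂ ∧ D.marked ps₁ = a := by
  induction ps generalizing a with
  | nil => simp [marked] at h
  | cons x ps ih =>
    rw [marked, List.flatMap_cons, ← marked] at h
    cases x with
    | inl e' =>
      cases a with
      | nil =>
        simp at h
        obtain ⟨rfl, -⟩ := h
        exact ⟨[], ps, rfl, rfl⟩
      | cons y a =>
        simp at h
        obtain ⟨rfl, h⟩ := h
        obtain ⟨ps₁, ps₂, rfl, rfl⟩ := ih h
        exact ⟨Sum.inl e' :: ps₁, ps₂, rfl, rfl⟩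
    | inr p =>
      simp only [Sum.elim_inr] at h
      rcases List.append_eq_append_iff.1 h with ⟨c, rfl, h'⟩ | ⟨c, h1, h2⟩
      · obtain ⟨ps₁, ps₂, rfl, rfl⟩ := ih h'
        exact ⟨Sum.inr p :: ps₁, ps₂, rfl, rfl⟩
      · cases c with
        | nil =>
          obtain ⟨ps₁, ps₂, rfl, h3⟩ := ih (a := []) (by simpa using h2.symm)
          refine ⟨Sum.inr p :: ps₁, ps₂, rfl, ?_⟩
          rw [marked, List.flatMap_cons, ← marked, h3]
          simpa using h1
        | cons y c =>
          exfalso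
          have : (e, true) ∈ (D.retr [p.1, p.2]).map fun e => (e, false) := by
            rw [h1]; simp at h2; simp [← h2.1]
          simp at this

/-- A cut of the path at a non-auxiliary vertex comes from a cut of the list of items. -/
theorem exists_of_pathOf_eq (hD : IsTrackMap D) {ps : List (D.G.E ⊕ D.G.E × D.G.E)}
    (hps : D.IsItemList ps) {u w : D.G.V} {g₁ g₂ : List D.G.E} (hg : D.Seg u g₁ w)
    (h : D.pathOf ps = g₁ ++ g₂) :
    ∃ ps₁ ps₂, ps = ps₁ ++ ps₂ ∧ D.pathOf ps₁ = g₁ ∧ D.pathOf ps₂ = g₂ := by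
  induction ps generalizing g₁ u with
  | nil =>
    simp [pathOf] at h
    exact ⟨[], [], rfl, by simp [pathOf, h.1], by simp [pathOf, h.2]⟩
  | cons x ps ih =>
    have ih := @ih fun y hy => hps y (List.mem_cons_of_mem _ hy)
    have hx := hps x List.mem_cons_self
    by_cases hg₁ : g₁ = []
    · subst hg₁
      exact ⟨[], x :: ps, rfl, rfl, by simpa using h⟩
    obtain ⟨z, g₁, rfl⟩ := List.exists_cons_of_ne_nil hg₁
    rw [pathOf, List.flatMap_cons, ← pathOf] at h
    have hz := hg.2.2.1
    cases x with
    | inl e =>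
      simp at h
      obtain ⟨rfl, h⟩ := h
      have h1 := hg.of_append_left (l := [e]) (hz ▸ D.seg_singleton hx)
      obtain ⟨ps₁, ps₂, rfl, rfl, rfl⟩ := ih h1 h
      exact ⟨Sum.inl e :: ps₁, ps₂, rfl, rfl, rfl⟩
    | inr p =>
      simp at h
      obtain ⟨rfl, h⟩ := h
      cases g₁ with
      | nil =>
        exact absurd ((show D.G.tgt p.1 = w from hg.2.2.2) ▸ hx.1) hg.2.1
      | cons z g₁ =>
        simp at h
        obtain ⟨rfl, h⟩ := h
        have h1 := hg.of_append_left (l := [p.1, p.2]) (hz ▸ IsAuxEdge.seg hD hx)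
        obtain ⟨ps₁, ps₂, rfl, rfl, rfl⟩ := ih h1 h
        exact ⟨Sum.inr p :: ps₁, ps₂, rfl, rfl, rfl⟩

theorem retract_pathOf (hD : IsTrackMap D) {ps : List (D.G.E ⊕ D.G.E × D.G.E)}
    (hps : D.IsItemList ps) : D.retract (D.pathOf ps) = D.imageOf ps := by
  induction ps with
  | nil => rfl
  | cons x ps ih =>
    have ih := ih fun y hy => hps y (List.mem_cons_of_mem _ hy)
    have hx := hps x List.mem_cons_self
    rw [imageOf, pathOf, List.flatMap_cons, List.flatMap_cons, ← imageOf, ← pathOf, ← ih]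
    cases x with
    | inl e => exact D.retract_edge hx _
    | inr p =>
      have := retract_append hD (IsAuxEdge.seg hD hx) (D.pathOf ps)
      rwa [IsAuxEdge.retract_pair hx] at this

end TrackData

/-- If no entry at distance at least `N` from both ends of a list has a property, then at most `2 N`
entries have it. -/
theorem List.countP_le_of_middle {β : Type*} (p : β → Bool) (N : ℕ) (l : List β)
    (h : ∀ c x d, l = c ++ x :: d → N ≤ c.length → N ≤ d.length → ¬ p x) :
    l.countP p ≤ 2 * N := by
  by_cases hl : l.length ≤ 2 * N
  · exact List.countP_le_length.trans hl
  · set m := (l.drop N).take (l.length - 2 * N) with hm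
    set r := (l.drop N).drop (l.length - 2 * N) with hr
    have h1 : l = l.take N ++ (m ++ r) := by rw [hm, hr, List.take_append_drop,
      List.take_append_drop]
    have h2 : (l.take N).length = N := by simp; omega
    have h3 : r.length = N := by simp [hr]; omega
    have h4 : m.countP p = 0 := by
      rw [List.countP_eq_zero]
      intro x hx
      obtain ⟨s, t, hst⟩ := List.append_of_mem hx
      refine h (l.take N ++ s) x (t ++ r) ?_ (by rw [List.length_append]; omega)
        (by rw [List.length_append]; omega)
      conv_lhs => rw [h1, hst]
      simp
    have h5 := List.countP_le_length (p := p) (l := l.take N)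
    have h6 := List.countP_le_length (p := p) (l := r)
    rw [h1, List.countP_append, List.countP_append, h4]
    omega

namespace TrackData

variable {D : TrackData} {n : ℕ} {α : MulAut (FreeGroup (Fin n))}

/-- If `retr l` is reduced, then it agrees with `retract l`. If `depth = 0`, then `retr` is the
identity and there are no auxiliary edges, so that only backtracking could make a difference. -/
theorem retr_eq_retract (hD : IsTrackMap D) {u v : D.G.V} {l : List D.G.E} (hl : D.Seg u l v)
    (hr : D.G.Reduced (D.retr l)) : D.retr l = D.retract l ∧ D.NoAux (D.retr l) := by
  by_cases h0 : D.depth = 0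
  · -- there are no auxiliary edges
    have h1 : ∀ l, D.retr l = l := fun l => by rw [retr, h0]; rfl
    rw [h1] at hr ⊢
    suffices h : D.NoAux l from ⟨(D.retract_noAux h).symm, h⟩
    induction hl using Seg.induction hD with
    | nil => intro e he; simp at he
    | edge e l he hs ih =>
      have h2 := ih (hr.infix (List.suffix_cons _ _).isInfix)
      intro x hx
      rcases List.mem_cons.1 hx with rfl | hx
      · exact he
      · exact h2 x hx
    | aux h h' l hh hh' hs hs' ih =>
      exact absurd h0 (IsAuxEdge.depth_ne hD ⟨hh, hh', (List.isChain_cons_cons.1 hr).1⟩)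
  · rw [← retract_eq_iterate hD h0 hl]
    exact ⟨rfl, hl.noAux_retract hD⟩

theorem isItemList_of_isReplacement {a b : unitInterval} {ps : List (D.G.E ⊕ D.G.E × D.G.E)}
    (hno : D.NoAux (D.imageOf ps))
    (hps : ∀ i h h', D.Isolated (D.imageOf ps) a b i h h' ↔
      ∃ ps₁ ps₂, ps = ps₁ ++ [Sum.inr (h, h')] ++ ps₂ ∧ (D.imageOf ps₁).length = i) :
    D.IsItemList ps := by
  intro x hx
  cases x with
  | inl e => exact hno e (List.mem_flatMap.2 ⟨_, hx, by simp⟩)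
  | inr p =>
    obtain ⟨ps₁, ps₂, h⟩ := List.append_of_mem hx
    exact ((hps _ p.1 p.2).2 ⟨ps₁, ps₂, by simpa using h, rfl⟩).1.1

/-- The edges of the train track part of a normalized path, whose positions in the retraction lie
deep inside the retraction of a reduced path in `X`, belong to isolated pre-INPs, and hence they
are not edges of the normalized path itself. -/
theorem not_marked_of_deep (hB : IsBetaTrainTrack D α) {K : ℕ} (hK : 1 ≤ K)
    (hKr : ∀ h h', D.IsAuxEdge h h' → (D.retr [h, h']).length ≤ K) {a b : unitInterval}
    {ps : List (D.G.E ⊕ D.G.E × D.G.E)}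
    (hps : ∀ i h h', D.Isolated (D.imageOf ps) a b i h h' ↔
      ∃ ps₁ ps₂, ps = ps₁ ++ [Sum.inr (h, h')] ++ ps₂ ∧ (D.imageOf ps₁).length = i)
    {A c d B : List (D.G.E × Bool)} {e : D.G.E}
    (hm : D.marked ps = A ++ c ++ (e, true) :: (d ++ B)) (hc : 2 * K ≤ c.length)
    (hd : 2 * K ≤ d.length) {u v : D.G.V} {y : List D.G.E} (hy : D.Seg u y v) (hX : D.InX y)
    (hr : D.G.Reduced y) (hin : c.map Prod.fst ++ e :: d.map Prod.fst <:+: D.retract y) :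
    D.IsRel e := by
  have hD := hB.toIsTrackMap
  by_contra he
  obtain ⟨s, s', hs⟩ := hin
  obtain ⟨y₁, p, p', y₂, P, S, rfl, hp, hy₁, hy₂, hR, e1, e2⟩ :=
    exists_auxEdge_of_retract_eq hB hy hX hr he (A := s ++ c.map Prod.fst)
      (B := d.map Prod.fst ++ s') (by rw [← hs]; simp)
  have lR := congrArg List.length hR
  have hRK := hKr p p' hp
  simp only [List.length_append, List.length_cons] at lR
  -- the pre-INP which contains the edge lies in the given subpath
  obtain ⟨c₁, e3, e4⟩ : ∃ c₁, D.retract y₁ = s ++ c₁ ∧ c.map Prod.fst = c₁ ++ P := by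
    rcases List.append_eq_append_iff.1 e1 with ⟨x, h1, h2⟩ | ⟨x, h1, h2⟩
    · exact ⟨x, h1, h2⟩
    · have := congrArg List.length h2
      simp at this
      omega
  obtain ⟨d₁, e5, e6⟩ : ∃ d₁, D.retract y₂ = d₁ ++ s' ∧ d.map Prod.fst = S ++ d₁ := by
    rcases List.append_eq_append_iff.1 e2 with ⟨x, h1, h2⟩ | ⟨x, h1, h2⟩
    · have := congrArg List.length h1
      simp at this
      omega
    · exact ⟨x, h2, h1⟩
  have l4 := congrArg List.length e4
  have l6 := congrArg List.length e6
  simp only [List.length_append, List.length_map] at l4 l6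
  have hρ : D.imageOf ps = A.map Prod.fst ++ (c₁ ++ D.retr [p, p'] ++ d₁) ++ B.map Prod.fst := by
    rw [← map_fst_marked, hm]
    simp only [List.map_append, List.map_cons, e4, e6, hR]
    simp
  have hry : D.retract (y₁ ++ [p, p'] ++ y₂) = s ++ (c₁ ++ D.retr [p, p'] ++ d₁) ++ s' := by
    rw [← hs, e4, e6, hR]; simp
  have hiso : D.Isolated (D.imageOf ps) a b (A.length + c₁.length) p p' := by
    refine ⟨⟨hp, A.map Prod.fst ++ c₁, d₁ ++ B.map Prod.fst, by rw [hρ]; simp, by simp,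
      fun h => ?_, fun h => ?_⟩, ?_⟩
    · have := congrArg List.length h
      simp only [List.length_append, List.length_map, List.length_nil] at this
      omega
    · have := congrArg List.length h
      simp only [List.length_append, List.length_map, List.length_nil] at this
      omega
    rintro j k k' ⟨hk, A₂, B₂, h1, rfl, -, -⟩ hov
    have hkK := hKr k k' hk
    have hlen := congrArg List.length (h1.symm.trans hρ)
    simp only [List.length_append, List.length_map] at hlen
    have hA₁ : A.map Prod.fst <+: D.imageOf ps :=
      ⟨c₁ ++ D.retr [p, p'] ++ d₁ ++ B.map Prod.fst, by rw [hρ]; simp⟩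
    have hA₂ : A₂ <+: D.imageOf ps := ⟨D.retr [k, k'] ++ B₂, by rw [h1]; simp⟩
    obtain ⟨A₃, rfl⟩ : A.map Prod.fst <+: A₂ :=
      List.prefix_of_prefix_length_le hA₁ hA₂ (by rw [List.length_map]; omega)
    obtain ⟨B₃, rfl⟩ : B.map Prod.fst <:+ B₂ :=
      List.suffix_of_suffix_length_le (l₃ := D.imageOf ps) ⟨_, hρ.symm⟩ ⟨_, h1.symm⟩
        (by rw [List.length_map]; omega)
    have h2 : A₃ ++ D.retr [k, k'] ++ B₃ = c₁ ++ D.retr [p, p'] ++ d₁ := by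
      have h3 := h1.symm.trans hρ
      simp only [List.append_assoc, List.append_cancel_left_eq] at h3
      have h4 : (A₃ ++ D.retr [k, k'] ++ B₃) ++ B.map Prod.fst =
          (c₁ ++ D.retr [p, p'] ++ d₁) ++ B.map Prod.fst := by simpa using h3
      exact List.append_cancel_right h4
    have l3 := congrArg List.length e3
    simp only [List.length_append, List.length_map] at l3 hov ⊢
    have := contains_of_overlap hB hy hX hr hp hk (A := s ++ A₃) (B := B₃ ++ s')
      (by rw [hry, ← h2]; simp) (by simp only [List.length_append]; omega)
      (by simp only [List.length_append]; omega)
    simp only [List.length_append] at this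
    omega
  -- an isolated pre-INP has been replaced
  obtain ⟨ps₁, ps₂, h1, h2⟩ := (hps _ p p').1 hiso
  obtain ⟨qs₁, qs₂, h3, h4⟩ := exists_of_marked_eq hm
  have h5 : (D.imageOf qs₁).length = A.length + c.length := by
    rw [← map_fst_marked, h4]; simp
  have happ : ∀ as bs, (D.imageOf (as ++ bs)).length =
      (D.imageOf as).length + (D.imageOf bs).length := by
    intro as bs
    simp [imageOf]
  rw [h3, List.append_assoc] at h1
  rcases List.append_eq_append_iff.1 h1 with ⟨x, rfl, h6⟩ | ⟨x, rfl, h6⟩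
  · cases x with
    | nil => simp at h6
    | cons z x =>
      obtain ⟨rfl, -⟩ := List.cons.inj h6
      rw [happ] at h2
      have : 1 ≤ (D.imageOf (Sum.inl e :: x)).length := by simp [imageOf]
      omega
  · cases x with
    | nil => simp at h6
    | cons z x =>
      obtain ⟨rfl, -⟩ := List.cons.inj h6
      rw [happ] at h5
      have : (D.retr [p, p']).length ≤ (D.imageOf (Sum.inr (p, p') :: x)).length := by
        simp [imageOf]
      omega

/-- A path of length at most one, or a subpath of the retraction of a reduced path in `X`. -/
def IsBlock (D : TrackData) (l : List D.G.E) : Prop :=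
  l.length ≤ 1 ∨ ∃ u v y, D.Seg u y v ∧ D.InX y ∧ D.G.Reduced y ∧ l <:+: D.retract y

theorem IsBlock.infix {l m : List D.G.E} (h : D.IsBlock l) (hm : m <:+: l) : D.IsBlock m := by
  rcases h with h | ⟨u, v, y, h1, h2, h3, h4⟩
  · exact Or.inl (hm.length_le.trans h)
  · exact Or.inr ⟨u, v, y, h1, h2, h3, hm.trans h4⟩

theorem isBlock_nil : D.IsBlock [] := Or.inl (by simp)

/-- The path is composed of `m` blocks. -/
def BlockCover (D : TrackData) : ℕ → List D.G.E → Prop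
  | 0, l => l = []
  | m + 1, l => ∃ a b, l = a ++ b ∧ D.IsBlock a ∧ BlockCover D m b

theorem BlockCover.append {m k : ℕ} {A B : List D.G.E} (hA : D.BlockCover m A)
    (hB : D.BlockCover k B) : D.BlockCover (m + k) (A ++ B) := by
  induction m generalizing A with
  | zero => rw [show A = [] from hA, Nat.zero_add]; exact hB
  | succ m ih =>
    obtain ⟨a, b, rfl, ha, hb⟩ := hA
    rw [Nat.add_right_comm]
    exact ⟨a, b ++ B, List.append_assoc _ _ _, ha, ih hb⟩

theorem blockCover_nil (m : ℕ) : D.BlockCover m [] := by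
  induction m with
  | zero => rfl
  | succ m ih => exact ⟨[], [], rfl, isBlock_nil, ih⟩

theorem BlockCover.of_append_left {m : ℕ} {A B : List D.G.E} (h : D.BlockCover m (A ++ B)) :
    D.BlockCover m A := by
  induction m generalizing A with
  | zero => exact (List.append_eq_nil_iff.1 h).1
  | succ m ih =>
    obtain ⟨a, b, h1, ha, hb⟩ := h
    rcases List.append_eq_append_iff.1 h1 with ⟨x, rfl, -⟩ | ⟨x, rfl, rfl⟩
    · exact ⟨A, [], by simp, ha.infix (List.prefix_append _ _).isInfix, blockCover_nil m⟩
    · exact ⟨a, x, rfl, ha, ih hb⟩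

theorem BlockCover.of_append_right {m : ℕ} {A B : List D.G.E} (h : D.BlockCover m (A ++ B)) :
    D.BlockCover m B := by
  induction m generalizing A with
  | zero => exact (List.append_eq_nil_iff.1 h).2
  | succ m ih =>
    obtain ⟨a, b, h1, ha, hb⟩ := h
    rcases List.append_eq_append_iff.1 h1 with ⟨x, rfl, rfl⟩ | ⟨x, rfl, rfl⟩
    · exact ⟨x, b, rfl, ha.infix (List.suffix_append _ _).isInfix, hb⟩
    · exact ⟨[], B, rfl, isBlock_nil, ih hb⟩

theorem BlockCover.nf_append {m k : ℕ} {A B : List D.G.E} (hA : D.BlockCover m A)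
    (hB : D.BlockCover k B) (hAr : D.G.Reduced A) (hBr : D.G.Reduced B) :
    D.BlockCover (m + k) (D.G.nf (A ++ B)) := by
  obtain ⟨a, c, b, rfl, rfl, h⟩ := D.G.exists_cancellation hAr hBr
  rw [h]
  exact hA.of_append_left.append hB.of_append_right

/-- The geodesic of a path is composed of blocks, whose number is bounded in terms of the relative
length of the path. -/
theorem blockCover_geod (hB : IsBetaTrainTrack D α) {u v : D.G.V} {l : List D.G.E}
    (hl : D.Seg u l v) : D.BlockCover (2 * D.cnt l + 1) (D.geod l) := by
  have hD := hB.toIsTrackMap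
  induction hk : D.cnt l generalizing u l with
  | zero =>
    have hX := D.cnt_eq_zero.1 hk
    have hr : D.G.Reduced (D.xred l) := by
      refine List.IsChain.imp_of_mem_imp ?_ (D.G.redOn_red D.IsRel l)
      exact fun a b ha _ h => h (hX.xred a ha)
    refine ⟨D.geod l, [], by simp, Or.inr ⟨u, v, D.xred l, hl.xred, hX.xred, hr, ?_⟩, rfl⟩
    rw [← geod_xred hD hl, geod, D.G.nf_eq_self (retract_reduced_of_inX hB hl.xred hX.xred hr)]
  | succ k ih =>
    obtain ⟨y, e, l', rfl, hy, he⟩ : ∃ y e l', l = y ++ e :: l' ∧ D.InX y ∧ ¬ D.IsRel e := by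
      clear ih hl
      induction l with
      | nil => simp at hk
      | cons x l ih =>
        by_cases hx : D.IsRel x
        · rw [D.cnt_cons_of_rel hx] at hk
          obtain ⟨y, e, l', rfl, hy, he⟩ := ih hk
          refine ⟨x :: y, e, l', rfl, fun z hz => ?_, he⟩
          rcases List.mem_cons.1 hz with rfl | hz
          · exact hx
          · exact hy z hz
        · exact ⟨[], x, l, rfl, by intro z hz; simp at hz, hx⟩
    have hea := noAux_of_not_rel hD he
    have hes := D.seg_singleton hea
    obtain ⟨w, h1, h2⟩ := D.G.isPath_append_iff.1 hl.2.2
    obtain rfl : D.G.src e = w := h2.1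
    have hys : D.Seg u y (D.G.src e) := ⟨hl.1, hes.1, h1⟩
    have hls : D.Seg (D.G.tgt e) l' v := ⟨hes.2.1, hl.2.1, h2.2⟩
    rw [cnt_append, D.cnt_cons_of_not_rel he, D.cnt_eq_zero.2 hy] at hk
    have h3 := ih hls (by omega)
    have h4 : D.BlockCover 1 (D.geod y) := by
      have hX := hy
      have hr : D.G.Reduced (D.xred y) := by
        refine List.IsChain.imp_of_mem_imp ?_ (D.G.redOn_red D.IsRel y)
        exact fun a b ha _ h => h (hX.xred a ha)
      refine ⟨D.geod y, [], by simp, Or.inr ⟨u, _, D.xred y, hys.xred, hX.xred, hr, ?_⟩, rfl⟩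
      rw [← geod_xred hD hys, geod,
        D.G.nf_eq_self (retract_reduced_of_inX hB hys.xred hX.xred hr)]
    have h5 : D.BlockCover 1 [e] := ⟨[e], [], rfl, Or.inl (by simp), rfl⟩
    have h6 : D.geod (y ++ e :: l') = D.G.nf (D.geod y ++ D.G.nf ([e] ++ D.geod l')) := by
      have h7 : D.geod (e :: l') = D.G.nf ([e] ++ D.geod l') := by
        rw [geod, D.retract_edge hea, geod, D.G.nf_append_nf]
        rfl
      rw [geod_append hD hys, h7]
    rw [h6, show 2 * (k + 1) + 1 = 1 + (1 + (2 * k + 1)) by ring]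
    exact h4.nf_append (h5.nf_append h3 (List.isChain_singleton _) (D.G.nf_reduced _))
      (D.G.nf_reduced _) (D.G.nf_reduced _)

/-- A subpath of a normalized path runs over few edges of the train track part, compared to the
other paths which are homotopic to it in the complex. -/
theorem exists_cnt_le_of_isNormalized (hB : IsBetaTrainTrack D α) :
    ∃ C : ℕ, ∀ γ : D.G.Arc, D.IsNormalized γ → ∀ u v lA lB, lA <:+: γ.edges → D.Seg u lA v →
      D.Seg u lB v → D.geod lA = D.geod lB → D.cnt lA ≤ (2 * D.cnt lB + 1) * C := by
  classical
  have hD := hB.toIsTrackMap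
  have := hD.finite_E
  have := Fintype.ofFinite D.G.E
  -- `K` bounds the lengths of the pre-INPs
  set K := 1 + ∑ p : D.G.E × D.G.E, (D.retr [p.1, p.2]).length with hKdef
  have hK : 1 ≤ K := by omega
  have hKr : ∀ h h', D.IsAuxEdge h h' → (D.retr [h, h']).length ≤ K := by
    intro h h' _
    have := Finset.single_le_sum (f := fun p : D.G.E × D.G.E => (D.retr [p.1, p.2]).length)
      (fun _ _ => Nat.zero_le _) (Finset.mem_univ (h, h'))
    simp only at this
    omega
  refine ⟨4 * K + 1, fun γ hγ u v lA lB hin hA hlB hgeod => ?_⟩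
  obtain ⟨⟨hf, hl, -⟩, hred, ps, h1, h2, h3⟩ := hγ
  change γ.edges = D.pathOf ps at h1
  change D.retr γ.edges = D.imageOf ps at h2
  rw [h2] at h3
  replace h3 : ∀ i h h', D.Isolated (D.imageOf ps) γ.a γ.b i h h' ↔
      ∃ ps₁ ps₂, ps = ps₁ ++ [Sum.inr (h, h')] ++ ps₂ ∧ (D.imageOf ps₁).length = i := h3
  have hγs : D.Seg γ.first γ.edges γ.last := ⟨hf, hl, γ.isPath⟩
  obtain ⟨h4, h5⟩ := retr_eq_retract hD hγs hred
  rw [h2] at h5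
  have hitem := isItemList_of_isReplacement h5 h3
  by_cases hne : lA = []
  · subst hne; simp
  obtain ⟨g₁, g₂, hg⟩ := hin
  -- the items which form the subpath
  obtain ⟨p₁, p₂, p₃, hp, hpA⟩ : ∃ p₁ p₂ p₃, ps = p₁ ++ p₂ ++ p₃ ∧ D.pathOf p₂ = lA := by
    have h6 := hγs
    rw [← hg, List.append_assoc] at h6
    obtain ⟨w, h7, h8⟩ := D.G.isPath_append_iff.1 h6.2.2
    obtain ⟨w', h9, -⟩ := D.G.isPath_append_iff.1 h8
    obtain rfl := hA.2.2.src_unique h9 hne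
    obtain ⟨p₁, q, rfl, -, hq⟩ := exists_of_pathOf_eq hD hitem (g₁ := g₁) (g₂ := lA ++ g₂)
      ⟨hf, hA.1, h7⟩ (by rw [← h1, ← hg]; simp)
    obtain ⟨p₂, p₃, rfl, hp₂, -⟩ := exists_of_pathOf_eq hD (g₁ := lA) (g₂ := g₂)
      (fun x hx => hitem x (by simp [hx])) hA hq
    exact ⟨p₁, p₂, p₃, by simp, hp₂⟩
  have hitem₂ : D.IsItemList p₂ := fun x hx => hitem x (by rw [hp]; simp [hx])
  have himg : D.imageOf p₂ = D.geod lA := by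
    rw [← retract_pathOf hD hitem₂, hpA, geod, D.G.nf_eq_self]
    rw [← hpA, retract_pathOf hD hitem₂]
    rw [h2] at hred
    refine hred.infix ⟨D.imageOf p₁, D.imageOf p₃, ?_⟩
    rw [hp]; simp [imageOf]
  have hmark : D.marked ps = D.marked p₁ ++ D.marked p₂ ++ D.marked p₃ := by
    rw [hp]; simp [marked]
  rw [← hpA, ← markedCnt_marked hD hitem₂]
  have hcov : D.BlockCover (2 * D.cnt lB + 1) ((D.marked p₂).map Prod.fst) := by
    rw [map_fst_marked, himg, hgeod]
    exact blockCover_geod hB hlB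
  -- count in each block separately
  generalize 2 * D.cnt lB + 1 = M at hcov
  generalize D.marked p₁ = A at hmark
  generalize D.marked p₂ = m at hmark hcov
  generalize D.marked p₃ = B at hmark
  clear himg hpA hp hitem₂ hgeod hlB hA hg hne
  induction M generalizing A m with
  | zero =>
    have h6 : m = [] := by simpa using (show m.map Prod.fst = [] from hcov)
    subst h6
    simp [markedCnt]
  | succ M ih =>
    obtain ⟨x, z, h6, hx, hz⟩ := hcov
    obtain ⟨m₁, m₂, rfl, rfl, rfl⟩ := List.map_eq_append_iff.1 h6
    have h7 := ih (A ++ m₁) m₂ hz (by rw [hmark]; simp)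
    have h8 : D.markedCnt m₁ ≤ 4 * K + 1 := by
      rcases hx with hx | ⟨u, v, y, hy, hX, hr, hin⟩
      · rw [List.length_map] at hx
        exact (List.countP_le_length.trans hx).trans (by omega)
      · have h9 := List.countP_le_of_middle
          (fun x : D.G.E × Bool => decide (x.2 = true ∧ ¬ D.IsRel x.1)) (2 * K) m₁ (by
            rintro c ⟨e, t⟩ d rfl hc hd h10
            obtain ⟨h11, h12⟩ := of_decide_eq_true h10
            simp only at h11
            subst h11
            refine h12 (not_marked_of_deep hB hK hKr h3 (A := A) (c := c) (d := d)
              (B := m₂ ++ B) (by rw [hmark]; simp) hc hd hy hX hr ?_)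
            simpa using hin)
        have h10 : D.markedCnt m₁ ≤ 2 * (2 * K) := h9
        omega
    have h9 : D.markedCnt (m₁ ++ m₂) = D.markedCnt m₁ + D.markedCnt m₂ := List.countP_append
    rw [h9]
    have : (M + 1) * (4 * K + 1) = M * (4 * K + 1) + (4 * K + 1) := by ring
    omega

end TrackData

/-! ### Points of a graph and the vertices near them -/

namespace SerreGraph

/-- The set of the endpoints of the cell which contains a point: a vertex is near itself only, an
interior point of an edge is near both endpoints of the edge. -/
def RawPt.near {G : SerreGraph} : G.RawPt → Set G.V
  | .vert v => {v}
  | .onEdge e s => {v | (v = G.src e ∧ s ≠ 1) ∨ (v = G.tgt e ∧ s ≠ 0)}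

/-- The vertices near a point of the geometric realization. -/
def Pt.near {G : SerreGraph} : G.Pt → Set G.V :=
  Quot.lift RawPt.near (by
    intro x y h
    ext v
    cases h with
    | zero e => simp [RawPt.near]
    | flip e s =>
      have h0 : unitInterval.symm s = 0 ↔ s = 1 := by
        rw [unitInterval.symm_eq_zero]
      have h1 : unitInterval.symm s = 1 ↔ s = 0 := by
        rw [unitInterval.symm_eq_one]
      simp only [RawPt.near, Set.mem_ofPred_eq, ne_eq, h0, h1, G.tgt_inv]
      exact or_comm)

theorem Pt.near_nonempty {G : SerreGraph} (P : G.Pt) : ∃ v, v ∈ P.near := by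
  induction P using Quot.ind with
  | mk x =>
    cases x with
    | vert v => exact ⟨v, rfl⟩
    | onEdge e s =>
      by_cases h : s = 0
      · exact ⟨G.src e, Or.inl ⟨rfl, by rw [h]; exact zero_ne_one⟩⟩
      · exact ⟨G.tgt e, Or.inr ⟨rfl, h⟩⟩

theorem Arc.exists_path_near_source {G : SerreGraph} (A : G.Arc) {v : G.V}
    (hv : v ∈ A.source.near) : ∃ c, G.IsPath A.first c v ∧ c.length ≤ 1 := by
  have hp := A.isPath
  rw [Arc.source] at hv
  cases h : A.edges with
  | nil =>
    simp only [h, List.head?_nil] at hv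
    exact ⟨[], hv.symm, by simp⟩
  | cons e l =>
    rw [h] at hp
    simp only [h, List.head?_cons] at hv
    rcases hv with ⟨rfl, -⟩ | ⟨rfl, -⟩
    · exact ⟨[], hp.1.symm, by simp⟩
    · exact ⟨[e], ⟨hp.1, rfl⟩, by simp⟩

theorem Arc.exists_path_near_target {G : SerreGraph} (A : G.Arc) {v : G.V}
    (hv : v ∈ A.target.near) : ∃ c, G.IsPath A.last c v ∧ c.length ≤ 1 := by
  have hp := A.isPath
  rw [Arc.target] at hv
  rcases List.eq_nil_or_concat A.edges with h | ⟨l, e, h⟩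
  · simp only [h, List.getLast?_nil] at hv
    exact ⟨[], hv.symm, by simp⟩
  · rw [List.concat_eq_append] at h
    rw [h] at hp
    have he := hp.tgt_last
    simp only [h, List.getLast?_concat] at hv
    rcases hv with ⟨rfl, -⟩ | ⟨rfl, -⟩
    · exact ⟨[G.inv e], ⟨he, G.tgt_inv e⟩, by simp⟩
    · exact ⟨[], he.symm, by simp⟩

/-- Paths with the same initial point start with edges whose initial vertices are joined by at most
two edges. -/
theorem Arc.exists_path_first {G : SerreGraph} {A B : G.Arc} (h : A.source = B.source) :
    ∃ c, G.IsPath A.first c B.first ∧ c.length ≤ 2 := by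
  obtain ⟨v, hv⟩ := A.source.near_nonempty
  obtain ⟨c, hc, hc'⟩ := A.exists_path_near_source hv
  obtain ⟨d, hd, hd'⟩ := B.exists_path_near_source (h ▸ hv)
  refine ⟨c ++ G.rev d, G.isPath_append hc hd.rev, ?_⟩
  simp only [List.length_append, rev, List.length_reverse, List.length_map]
  omega

theorem Arc.exists_path_last {G : SerreGraph} {A B : G.Arc} (h : A.target = B.target) :
    ∃ c, G.IsPath A.last c B.last ∧ c.length ≤ 2 := by
  obtain ⟨v, hv⟩ := A.target.near_nonempty
  obtain ⟨c, hc, hc'⟩ := A.exists_path_near_target hv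
  obtain ⟨d, hd, hd'⟩ := B.exists_path_near_target (h ▸ hv)
  refine ⟨c ++ G.rev d, G.isPath_append hc hd.rev, ?_⟩
  simp only [List.length_append, rev, List.length_reverse, List.length_map]
  omega

end SerreGraph

/-! ### Paths in the universal covering -/

namespace TrackData

variable {D : TrackData} {n : ℕ} {α : MulAut (FreeGroup (Fin n))}

/-- The covering map on edges. -/
def edgeProj (D : TrackData) (y : D.cover.E) : D.G.E := y.1.2

/-- A path in the universal covering which starts at the class of `p` ends at the class of the
concatenation of `p` and the projection of the path. -/
theorem exists_of_isPath_cover {p : {p : D.G.EPath // p.first = D.base}} {l : List D.cover.E}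
    {y : D.CoverV} (h : D.cover.IsPath (Quot.mk _ p) l y) :
    ∃ q : {p : D.G.EPath // p.first = D.base}, y = Quot.mk _ q ∧
      q.1.edges = p.1.edges ++ l.map D.edgeProj ∧
      D.G.IsPath p.1.last (l.map D.edgeProj) q.1.last := by
  induction l generalizing p with
  | nil => exact ⟨p, h.symm, by simp, rfl⟩
  | cons e l ih =>
    obtain ⟨⟨x, e⟩, he⟩ := e
    obtain ⟨h1, h2⟩ := h
    obtain rfl : x = Quot.mk _ p := h1
    have he' : p.1.last = D.G.src e := he
    obtain ⟨q, rfl, hq, hq'⟩ := ih (p := D.snoc e p) h2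
    refine ⟨q, rfl, ?_, ?_⟩
    · rw [hq]; simp only [snoc, he', dif_pos, List.append_assoc]; rfl
    · have h3 : (D.snoc e p).1.last = D.G.tgt e := by simp [snoc, he']
      exact ⟨he'.symm, h3 ▸ hq'⟩

theorem isPath_base (p : {p : D.G.EPath // p.first = D.base}) :
    D.G.IsPath D.base p.1.edges p.1.last := by
  obtain ⟨⟨u, v, l, h⟩, hp⟩ := p
  obtain rfl : u = D.base := hp
  exact h

theorem pathHomotopic_of_eqvGen {p q : {p : D.G.EPath // p.first = D.base}}
    (h : Relation.EqvGen (fun p q : {p : D.G.EPath // p.first = D.base} =>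
      D.G.Move D.Rule p.1 q.1) p q) :
    p.1.last = q.1.last ∧ D.G.PathHomotopic D.Rule D.base p.1.last p.1.edges q.1.edges := by
  induction h with
  | rel p q h =>
    obtain ⟨-, h2, h3⟩ := h
    exact ⟨h2, Relation.EqvGen.rel _ _ ⟨isPath_base p, h2 ▸ isPath_base q, h3⟩⟩
  | refl p => exact ⟨rfl, .refl _ _ _ _ _⟩
  | symm p q _ ih => exact ⟨ih.1.symm, ih.1 ▸ ih.2.symm⟩
  | trans p q r _ _ ih ih' => exact ⟨ih.1.trans ih'.1, ih.2.trans (ih.1 ▸ ih'.2)⟩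

/-- Paths in the universal covering with the same endpoints project to homotopic paths. -/
theorem pathHomotopic_of_cover {x y : D.CoverV} {l l' : List D.cover.E}
    (h : D.cover.IsPath x l y) (h' : D.cover.IsPath x l' y) :
    ∃ v, D.G.IsPath (D.coverProj x) (l.map D.edgeProj) v ∧
      D.G.IsPath (D.coverProj x) (l'.map D.edgeProj) v ∧
      D.G.PathHomotopic D.Rule (D.coverProj x) v (l.map D.edgeProj)
        (l'.map D.edgeProj) := by
  induction x using Quot.ind with
  | mk p =>
    obtain ⟨q, rfl, hq, hqp⟩ := exists_of_isPath_cover h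
    obtain ⟨q', hqq, hq', hqp'⟩ := exists_of_isPath_cover h'
    obtain ⟨h1, h2⟩ := pathHomotopic_of_eqvGen (Quot.eqvGen_exact hqq)
    have hp : D.G.IsPath D.base p.1.edges p.1.last := isPath_base p
    rw [← h1] at hqp'
    refine ⟨q.1.last, hqp, hqp', ?_⟩
    change D.G.PathHomotopic D.Rule p.1.last _ _ _
    have hcancel : ∀ m, D.G.IsPath p.1.last m q.1.last →
        D.G.PathHomotopic D.Rule p.1.last q.1.last (D.G.rev p.1.edges ++ (p.1.edges ++ m)) m :=
      fun m hm => (pathHomotopic_of_nf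
        (D.G.isPath_append hp.rev (D.G.isPath_append hp hm)) hm
        (D.G.nf_rev_append_append _ _))
    have h3 := SerreGraph.PathHomotopic.append hp.rev h2
      (show D.G.IsPath q.1.last [] q.1.last from rfl)
    rw [List.append_nil, List.append_nil, hq, hq'] at h3
    exact (hcancel _ hqp).symm.trans (h3.trans (hcancel _ hqp'))

/-- A subpath of a path with non-auxiliary endpoints can be extended within `X` so that its
endpoints become non-auxiliary. -/
theorem Seg.exists_extension (hD : IsTrackMap D) {u v u' v' : D.G.V} {l₁ l l₂ : List D.G.E}
    (h : D.Seg u' (l₁ ++ l ++ l₂) v') (hl : D.G.IsPath u l v) (hne : l ≠ []) :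
    ∃ x y m₁ m₂, ¬ D.IsAuxV x ∧ ¬ D.IsAuxV y ∧ D.G.IsPath x m₁ u ∧ D.G.IsPath v m₂ y ∧
      D.InX m₁ ∧ D.InX m₂ ∧ m₁ ++ l ++ m₂ <:+: l₁ ++ l ++ l₂ := by
  obtain ⟨hu', hv', hp⟩ := h
  obtain ⟨w, hp, hp₂⟩ := D.G.isPath_append_iff.1 hp
  obtain ⟨w', hp₁, hp⟩ := D.G.isPath_append_iff.1 hp
  obtain rfl := hl.src_unique hp hne
  obtain rfl := hl.end_unique hp
  have hleft : ∃ x m₁, ¬ D.IsAuxV x ∧ D.G.IsPath x m₁ u ∧ D.InX m₁ ∧ m₁ <:+ l₁ := by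
    by_cases hu : D.IsAuxV u
    · rcases List.eq_nil_or_concat l₁ with rfl | ⟨l₀, e, rfl⟩
      · obtain rfl : u' = u := hp₁
        exact absurd hu hu'
      · rw [List.concat_eq_append] at hp₁ ⊢
        have he : D.G.tgt e = u := hp₁.tgt_last
        refine ⟨D.G.src e, [e], fun hx => hD.aux_ends e hx (he ▸ hu), ⟨rfl, he⟩, ?_,
          List.suffix_append _ _⟩
        intro z hz
        obtain rfl := List.mem_singleton.1 hz
        exact hD.aux_rel _ (Or.inr (he ▸ hu))
    · exact ⟨u, [], hu, rfl, by intro z hz; simp at hz, List.nil_suffix⟩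
  have hright : ∃ y m₂, ¬ D.IsAuxV y ∧ D.G.IsPath v m₂ y ∧ D.InX m₂ ∧ m₂ <+: l₂ := by
    by_cases hv : D.IsAuxV v
    · cases l₂ with
      | nil =>
        obtain rfl : v = v' := hp₂
        exact absurd hv hv'
      | cons e l₀ =>
        have he : D.G.src e = v := hp₂.1
        refine ⟨D.G.tgt e, [e], hD.aux_ends e (he ▸ hv), ⟨he, rfl⟩, ?_, ⟨l₀, rfl⟩⟩
        intro z hz
        obtain rfl := List.mem_singleton.1 hz
        exact hD.aux_rel _ (Or.inl (he ▸ hv))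
    · exact ⟨v, [], hv, rfl, by intro z hz; simp at hz, List.nil_prefix⟩
  obtain ⟨x, m₁, hx, hm₁, hX₁, s, rfl⟩ := hleft
  obtain ⟨y, m₂, hy, hm₂, hX₂, t, rfl⟩ := hright
  exact ⟨x, y, m₁, m₂, hx, hy, hm₁, hm₂, hX₁, hX₂, s, t, by simp⟩

/-! ### Relative lengths in the universal covering -/

theorem relLength_mem (o : Option D.cover.E) :
    0 ≤ o.elim 0 D.relLength ∧ o.elim 0 D.relLength ≤ 1 := by
  cases o with
  | none => simp
  | some e =>
    simp only [Option.elim_some, relLength]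
    split_ifs <;> simp

theorem sum_relLength (l : List D.cover.E) :
    (l.map D.relLength).sum = D.cnt (l.map D.edgeProj) := by
  induction l with
  | nil => simp [cnt]
  | cons e l ih =>
    rw [List.map_cons, List.sum_cons, List.map_cons, ih, relLength]
    split_ifs with h
    · rw [D.cnt_cons_of_rel (e := D.edgeProj e) h, zero_add]
    · rw [D.cnt_cons_of_not_rel (e := D.edgeProj e) h]; push_cast; ring

theorem length_le_cnt (A : D.cover.Arc) :
    A.length D.relLength ≤ D.cnt (A.edges.map D.edgeProj) := by
  rw [SerreGraph.Arc.length, sum_relLength]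
  have h1 := mul_nonneg A.a.2.1 (relLength_mem A.edges.head?).1
  have h2 := mul_nonneg A.b.2.1 (relLength_mem A.edges.getLast?).1
  linarith

theorem cnt_le_length_add (A : D.cover.Arc) :
    (D.cnt (A.edges.map D.edgeProj) : ℝ) ≤ A.length D.relLength + 2 := by
  rw [SerreGraph.Arc.length, sum_relLength]
  have h1 := mul_le_one₀ A.a.2.2 (relLength_mem A.edges.head?).1 (relLength_mem A.edges.head?).2
  have h2 := mul_le_one₀ A.b.2.2 (relLength_mem A.edges.getLast?).1
    (relLength_mem A.edges.getLast?).2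
  linarith

end TrackData

open TrackData in
theorem proposition7 {n : ℕ} (α : MulAut (FreeGroup (Fin n))) (D : TrackData)
    (hD : IsBetaTrainTrack D α) :
    ∃ lam mu : ℝ, 0 < lam ∧ 0 < mu ∧
      ∀ (γ₀ : D.G.Arc) (γ : D.cover.Arc), D.IsNormalized γ₀ → D.IsLift γ γ₀ →
        D.cover.IsQuasiGeodesic D.relLength lam mu γ := by
  obtain ⟨C, hC⟩ := exists_cnt_le_of_isNormalized hD
  have hlam : (0 : ℝ) < 2 * (C + 1) := by positivity
  refine ⟨2 * (C + 1), 13 * (C + 1), hlam, by positivity, ?_⟩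
  rintro γ₀ γ hγ₀ ⟨-, hedges, -, -⟩ A ⟨l₁, l₂, hA, -, -⟩
  have hsub : γ₀.edges = l₁.map D.edgeProj ++ A.edges.map D.edgeProj ++ l₂.map D.edgeProj := by
    rw [← hedges, hA, List.map_append, List.map_append]; rfl
  have hseg : D.Seg γ₀.first (l₁.map D.edgeProj ++ A.edges.map D.edgeProj ++ l₂.map D.edgeProj) γ₀.last :=
    ⟨hγ₀.1.1, hγ₀.1.2.1, hsub ▸ γ₀.isPath⟩
  have key : ∀ B : D.cover.Arc, B.source = A.source → B.target = A.target →
      D.cnt (A.edges.map D.edgeProj) ≤ (2 * D.cnt (B.edges.map D.edgeProj) + 9) * (C + 1) := by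
    intro B hs ht
    by_cases hne : A.edges.map D.edgeProj = []
    · rw [hne, D.cnt_eq_zero.2 (by intro z hz; simp at hz)]
      exact Nat.zero_le _
    obtain ⟨c, hc, hc'⟩ := SerreGraph.Arc.exists_path_first hs.symm
    obtain ⟨d, hd, hd'⟩ := SerreGraph.Arc.exists_path_last ht
    obtain ⟨v, hp, hp', hh⟩ := pathHomotopic_of_cover A.isPath
      (D.cover.isPath_append (D.cover.isPath_append hc B.isPath) hd)
    obtain ⟨x, y, m₁, m₂, hx, hy, hm₁, hm₂, hX₁, hX₂, hin⟩ :=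
      hseg.exists_extension hD.toIsTrackMap hp hne
    have hh' := SerreGraph.PathHomotopic.append hm₁ hh hm₂
    have hgeod := PathHtpy2.geod_eq hD.toIsTrackMap hx hy hh'
    have hcore := hC γ₀ hγ₀ x y _ _ (hsub ▸ hin)
      ⟨hx, hy, D.G.isPath_append (D.G.isPath_append hm₁ hp) hm₂⟩
      ⟨hx, hy, D.G.isPath_append (D.G.isPath_append hm₁ hp') hm₂⟩ hgeod
    have hc₁ := D.cnt_le_length (c.map D.edgeProj)
    have hd₁ := D.cnt_le_length (d.map D.edgeProj)
    rw [List.length_map] at hc₁ hd₁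
    simp only [List.map_append, cnt_append, D.cnt_eq_zero.2 hX₁, D.cnt_eq_zero.2 hX₂] at hcore
    rw [zero_add, add_zero] at hcore
    exact hcore.trans (Nat.mul_le_mul (by omega) (Nat.le_succ C))
  -- divide by `2 * (C + 1)` to compare with the infimum which defines the distance
  have hdist : (A.length D.relLength - 13 * (C + 1)) / (2 * (C + 1)) ≤
      D.cover.pathDist D.relLength A.source A.target := by
    refine le_csInf ⟨_, A, rfl, rfl, rfl⟩ ?_
    rintro x ⟨B, hs, ht, rfl⟩
    rw [div_le_iff₀ hlam]
    have h1 : (D.cnt (A.edges.map D.edgeProj) : ℝ) ≤ (2 * D.cnt (B.edges.map D.edgeProj) + 9) * (C + 1) := by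
      exact_mod_cast key B hs ht
    have h2 : (2 * (D.cnt (B.edges.map D.edgeProj) : ℝ) + 9) * (C + 1) ≤
        (2 * (B.length D.relLength + 2) + 9) * (C + 1) := by
      have := cnt_le_length_add B
      gcongr
    have h3 := length_le_cnt A
    linarith
  rw [div_le_iff₀ hlam] at hdist
  linarith
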